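/- Let $k$ be an algebraically closed field of characteristic $p>0$, let $\mathcal O$ be a finite extension of $W(k)$ (a discrete valuation ring, with maximal ideal $\mathfrak m$), and let $\sigma$ be an automorphism of $\mathcal O$ lifting the $p$-power Frobenius of $k$. Let $\Gamma$ be the $p$-adic completion of $\mathcal O[[t]][t^{-1}]$, and let $\Gamma_{\mathrm{con}}\subseteq\Gamma$ be the subring of series $\sum_{i\in\mathbb Z}x_it^i$ with $\liminf_{i\to\infty}v_p(x_{-i})/i>0$. Extend $\sigma$ to an endomorphism of $\Gamma$ that lifts $x\mapsto x^p$ on $\Gamma/\mathfrak m\Gamma=k((t))$ and maps $\Gamma_{\mathrm{con}}$ into itself. Let $\Gamma^{\mathrm{perf}}$ be the $p$-adically complete extension of $\Gamma$ with residue field the perfect closure of $k((t))$, i.e. the $p$-adic completion of the direct limit of $\Gamma\xrightarrow{\sigma}\Gamma\xrightarrow{\sigma}\cdots$, with the induced $\sigma$. For $R$ one of these rings, an $F$-crystal over $R$ is a finite locally free $R$-module $M$ with a $\sigma$-linear map $F:M\to M$ whose linearization $R\otimes_{\sigma,R}M\to M$ becomes an isomorphism after inverting $p$. An $(F,\nabla)$-crystal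 over $\Gamma_{\mathrm{con}}$ is an $F$-crystal $M$ with a connection $\nabla:M\to M\otimes\Gamma_{\mathrm{con}}\,dt$ over $\mathcal O$ such that $\nabla\circ F=(F\otimes d\sigma)\circ\nabla$. An $F$-crystal is constant if it has an isobasis (elements of $M$ forming a basis of $M[1/p]$ over $R[1/p]$) $e_1,\dots,e_r$ with $Fe_j=\lambda_je_j$ for nonzero $\lambda_j\in\mathcal O$ with $\lambda_j^\sigma=\lambda_j$. It is unipotent if it has a finite filtration $0=M_0\subseteq\cdots\subseteq M_n=M$ by $F$-stable submodules such that each $M_{i}/M_{i-1}$ is an $F$-crystal and is constant. **Theorem.** Let $M$ be an $(F,\nabla)$-crystal over $\Gamma_{\mathrm{con}}$. Suppose that the Galois representation associated to $M$ is trivial, i.e. that $M$ becomes constant over $\Gamma^{\mathrm{perf}}$, possibly after a finite extension of $\mathcal O$. Then $M$ is unipotent as an $F$-crystal, after the same finite extension of $\mathcal O$. Precisely: let $\mathcal O'$ be a finite extension of $\mathcal O$ ($\mathcal O'=\mathcal O$ is allowed), with $\sigma$ extended to an automorphism $\sigma'$ of $\mathcal O'$ lifting Frobenius on $k$ and to such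 an endomorphism $\sigma'$ of the ring $\Gamma'$ formed from $\mathcal O'$. If the $F$-crystal $M\otimes_{\Gamma_{\mathrm{con}}}\Gamma'^{\mathrm{perf}}$ is constant, then the $F$-crystal $M\otimes_{\Gamma_{\mathrm{con}}}\Gamma'_{\mathrm{con}}$ over $\Gamma'_{\mathrm{con}}$ is unipotent. -/

import Mathlib

open Filter
open scoped TensorProduct LaurentSeries

noncomputable section

namespace OCrys

universe u v w

/-! ### `p`-adic completion of a ring, with its functoriality -/

/-- The `p`-adic completion `lim R / p ^ n R` of a commutative ring `R`. -/
abbrev PComp (p : ℕ) (R : Type u) [CommRing R] : Type u :=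
  AdicCompletion (Ideal.span {(p : R)}) R

lemma mem_pow_iff (p : ℕ) {R : Type u} [CommRing R] (n : ℕ) (x : R) :
    x ∈ ((Ideal.span {(p : R)}) ^ n • ⊤ : Submodule R R) ↔ (p : R) ^ n ∣ x := by
  rw [smul_eq_mul, Ideal.mul_top, Ideal.span_singleton_pow, Ideal.mem_span_singleton]

lemma pow_dvd_map (p : ℕ) {R : Type u} {S : Type v} [CommRing R] [CommRing S] (g : R →+ S)
    (n : ℕ) {x : R} (h : (p : R) ^ n ∣ x) : (p : S) ^ n ∣ g x := by
  obtain ⟨y, rfl⟩ := h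
  refine ⟨g y, ?_⟩
  have e1 : (p : R) ^ n * y = (p ^ n) • y := by rw [nsmul_eq_mul]; push_cast; rfl
  have e2 : (p : S) ^ n * g y = (p ^ n) • g y := by rw [nsmul_eq_mul]; push_cast; rfl
  rw [e1, e2, map_nsmul]

/-- An additive map `R → S` induces an additive map on `R / p ^ n`. -/
def quotMap (p : ℕ) {R : Type u} {S : Type v} [CommRing R] [CommRing S] (g : R →+ S) (n : ℕ) :
    (R ⧸ ((Ideal.span {(p : R)}) ^ n • ⊤ : Submodule R R)) →+
      (S ⧸ ((Ideal.span {(p : S)}) ^ n • ⊤ : Submodule S S)) :=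
  QuotientAddGroup.map _ _ g (by
    intro x hx
    exact (mem_pow_iff p n (g x)).2 (pow_dvd_map p g n ((mem_pow_iff p n x).1 hx)))

/-- The map induced on `p`-adic completions by an additive map of rings
(such as a derivation, or a coefficient functional). -/
def PComp.mapAdd (p : ℕ) {R : Type u} {S : Type v} [CommRing R] [CommRing S] (g : R →+ S) :
    PComp p R →+ PComp p S where
  toFun x := ⟨fun n => quotMap p g n (x.val n), by
    intro m n hmn
    change AdicCompletion.transitionMap (Ideal.span {(p : S)}) S hmn (quotMap p g n (x.val n)) =
      quotMap p g m (x.val m)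
    have hx := AdicCompletion.transitionMap_comp_eval_apply (Ideal.span {(p : R)}) R hmn x
    rw [← hx]
    generalize x.val n = y
    obtain ⟨y, rfl⟩ := Submodule.mkQ_surjective _ y
    rfl⟩
  map_zero' := by
    apply AdicCompletion.ext
    intro n
    exact map_zero (quotMap p g n)
  map_add' x y := by
    apply AdicCompletion.ext
    intro n
    exact map_add (quotMap p g n) _ _

/-- The ring homomorphism induced on `p`-adic completions by a ring homomorphism. -/
def PComp.map (p : ℕ) {R : Type u} {S : Type v} [CommRing R] [CommRing S] (f : R →+* S) :
    PComp p R →+* PComp p S where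
  __ := PComp.mapAdd p (f : R →+ S)
  map_one' := by
    apply AdicCompletion.ext
    intro n
    change quotMap p (f : R →+ S) n (Submodule.mkQ _ (1 : R)) = Submodule.mkQ _ (1 : S)
    rw [← map_one f]
    rfl
  map_mul' x y := by
    apply AdicCompletion.ext
    intro n
    change quotMap p (f : R →+ S) n ((x * y).val n) =
      quotMap p (f : R →+ S) n (x.val n) * quotMap p (f : R →+ S) n (y.val n)
    rw [AdicCompletion.val_mul]
    generalize x.val n = a
    generalize y.val n = b
    obtain ⟨a, rfl⟩ := Submodule.mkQ_surjective _ a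
    obtain ⟨b, rfl⟩ := Submodule.mkQ_surjective _ b
    change Submodule.mkQ _ (f (a * b)) = Submodule.mkQ _ (f a * f b)
    rw [map_mul]

/-! ### The ring `Γ` and its overconvergent subring -/

/-- `Γ`: the `p`-adic completion of `O[[t]][t⁻¹]`. -/
abbrev Gam (p : ℕ) (O : Type u) [CommRing O] : Type u := PComp p O⸨X⸩

section

variable (p : ℕ) (O : Type u) [CommRing O]

/-- The canonical map `O[[t]][t⁻¹] → Γ`. -/
def Gam.of : O⸨X⸩ →+* Gam p O := algebraMap O⸨X⸩ (Gam p O)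

/-- The constants `O → Γ`. -/
def Gam.C : O →+* Gam p O := (Gam.of p O).comp HahnSeries.C

/-- The coefficient of `t ^ i` in an element of `Γ`, as an element of the `p`-adic completion
of `O` (which is `O` itself when `O` is `p`-adically complete). -/
def Gam.coeff (i : ℤ) : Gam p O →+ PComp p O :=
  PComp.mapAdd p (HahnSeries.coeff.addMonoidHom i : O⸨X⸩ →+ O)

/-- The derivation `d / dt` of `Γ`. -/
def Gam.deriv : Gam p O →+ Gam p O :=
  PComp.mapAdd p (LaurentSeries.derivative O : O⸨X⸩ →ₗ[O] O⸨X⸩).toAddMonoidHom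

end

lemma Gam.exists_rep {p : ℕ} {O : Type u} [CommRing O] (x : Gam p O) (n : ℕ) :
    ∃ y : O⸨X⸩, Submodule.mkQ _ y = x.val n :=
  Submodule.mkQ_surjective _ _

lemma Gam.coeff_val_eq_zero_iff {p : ℕ} {O : Type u} [CommRing O] (x : Gam p O) (n : ℕ)
    (y : O⸨X⸩) (hy : Submodule.mkQ _ y = x.val n) (i : ℤ) :
    (Gam.coeff p O i x).val n = 0 ↔ (p : O) ^ n ∣ y.coeff i := by
  change quotMap p _ n (x.val n) = 0 ↔ _
  rw [← hy, ← mem_pow_iff]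
  exact Submodule.Quotient.mk_eq_zero _

/-- The growth condition `liminf v_p(x_{-i}) / i > 0` as `i → ∞`, for `x = ∑ x_i t ^ i` in `Γ`:
there is `c > 0` such that, for all large `i`, the coefficient `x_{-i}` is divisible by `p ^ n`
for every integer `n ≤ c * i`. -/
def IsOverconvergent (p : ℕ) (O : Type u) [CommRing O] (x : Gam p O) : Prop :=
  ∃ c : ℝ, 0 < c ∧ ∀ᶠ i : ℕ in atTop, ∀ n : ℕ, (n : ℝ) ≤ c * i →
    (Gam.coeff p O (-(i : ℤ)) x).val n = 0

lemma IsOverconvergent.add {p : ℕ} {O : Type u} [CommRing O] {x y : Gam p O}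
    (hx : IsOverconvergent p O x) (hy : IsOverconvergent p O y) :
    IsOverconvergent p O (x + y) := by
  obtain ⟨c, hc, hx⟩ := hx
  obtain ⟨d, hd, hy⟩ := hy
  refine ⟨min c d, lt_min hc hd, ?_⟩
  filter_upwards [hx, hy] with i hx hy n hn
  have hi : (0 : ℝ) ≤ i := Nat.cast_nonneg i
  rw [map_add, AdicCompletion.val_add_apply,
    hx n (hn.trans (mul_le_mul_of_nonneg_right (min_le_left _ _) hi)),
    hy n (hn.trans (mul_le_mul_of_nonneg_right (min_le_right _ _) hi)), add_zero]

lemma IsOverconvergent.neg {p : ℕ} {O : Type u} [CommRing O] {x : Gam p O}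
    (hx : IsOverconvergent p O x) : IsOverconvergent p O (-x) := by
  obtain ⟨c, hc, hx⟩ := hx
  refine ⟨c, hc, ?_⟩
  filter_upwards [hx] with i hx n hn
  rw [map_neg, AdicCompletion.val_neg_apply, hx n hn, neg_zero]

/-- Laurent series with finite principal part are overconvergent. -/
lemma isOverconvergent_of (p : ℕ) (O : Type u) [CommRing O] (y : O⸨X⸩) :
    IsOverconvergent p O (Gam.of p O y) := by
  refine ⟨1, one_pos, ?_⟩
  obtain ⟨b, hb⟩ : ∃ b : ℤ, ∀ j < b, y.coeff j = 0 :=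
    ⟨y.order, fun j hj => HahnSeries.coeff_eq_zero_of_lt_order hj⟩
  filter_upwards [eventually_gt_atTop b.natAbs] with i hi n _
  rw [Gam.coeff_val_eq_zero_iff (Gam.of p O y) n y rfl, hb _ (by omega)]
  exact dvd_zero _

lemma IsOverconvergent.mul {p : ℕ} {O : Type u} [CommRing O] {x y : Gam p O}
    (hx : IsOverconvergent p O x) (hy : IsOverconvergent p O y) :
    IsOverconvergent p O (x * y) := by
  obtain ⟨c, hc, hx⟩ := hx
  obtain ⟨d, hd, hy⟩ := hy
  obtain ⟨a, hx⟩ := eventually_atTop.1 hx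
  obtain ⟨b, hy⟩ := eventually_atTop.1 hy
  refine ⟨min c d / 2, half_pos (lt_min hc hd), ?_⟩
  filter_upwards [eventually_ge_atTop (2 * (a + b))] with i hi n hn
  obtain ⟨x', hx'⟩ := x.exists_rep n
  obtain ⟨y', hy'⟩ := y.exists_rep n
  have hxy : Submodule.mkQ _ (x' * y') = (x * y).val n := by
    rw [AdicCompletion.val_mul, ← hx', ← hy']
    rfl
  rw [Gam.coeff_val_eq_zero_iff _ n _ hxy, HahnSeries.coeff_mul]
  refine Finset.dvd_sum fun ij hij => ?_
  have hsum : ij.1 + ij.2 = -(i : ℤ) := (Finset.mem_antidiagonal.1 hij).2.2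
  have key : ∀ (e : ℝ), min c d ≤ e → ∀ m : ℕ, i ≤ 2 * m → (n : ℝ) ≤ e * m := by
    intro e he m hm
    have hm' : (i : ℝ) ≤ 2 * m := by exact_mod_cast hm
    have h0 : (0 : ℝ) ≤ m := Nat.cast_nonneg m
    have h1 : min c d / 2 * i ≤ min c d / 2 * (2 * m) :=
      mul_le_mul_of_nonneg_left hm' (half_pos (lt_min hc hd)).le
    have h2 : min c d * m ≤ e * m := mul_le_mul_of_nonneg_right he h0
    linarith
  by_cases h : 2 * ij.1 ≤ -(i : ℤ)
  · apply Dvd.dvd.mul_right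
    rw [← Gam.coeff_val_eq_zero_iff x n x' hx']
    have := hx ij.1.natAbs (by omega) n (key c (min_le_left _ _) _ (by omega))
    rwa [show -(ij.1.natAbs : ℤ) = ij.1 by omega] at this
  · apply Dvd.dvd.mul_left
    rw [← Gam.coeff_val_eq_zero_iff y n y' hy']
    have := hy ij.2.natAbs (by omega) n (key d (min_le_right _ _) _ (by omega))
    rwa [show -(ij.2.natAbs : ℤ) = ij.2 by omega] at this

lemma IsOverconvergent.deriv {p : ℕ} {O : Type u} [CommRing O] {x : Gam p O}
    (hx : IsOverconvergent p O x) : IsOverconvergent p O (Gam.deriv p O x) := by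
  obtain ⟨c, hc, hx⟩ := hx
  obtain ⟨a, hx⟩ := eventually_atTop.1 hx
  refine ⟨c / 2, half_pos hc, ?_⟩
  filter_upwards [eventually_ge_atTop (a + 2)] with i hi n hn
  obtain ⟨x', hx'⟩ := x.exists_rep n
  have hd : Submodule.mkQ _ (LaurentSeries.derivative O x') = (Gam.deriv p O x).val n := by
    change _ = quotMap p _ n (x.val n)
    rw [← hx']
    rfl
  rw [Gam.coeff_val_eq_zero_iff _ n _ hd, LaurentSeries.derivative_apply,
    LaurentSeries.hasseDeriv_coeff, zsmul_eq_mul]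
  apply Dvd.dvd.mul_left
  rw [← Gam.coeff_val_eq_zero_iff x n x' hx']
  have hi' : ((i - 1 : ℕ) : ℝ) = (i : ℝ) - 1 := by
    rw [Nat.cast_sub (by omega)]
    simp
  have h2 : (2 : ℝ) ≤ i := by exact_mod_cast (show 2 ≤ i by omega)
  have := hx (i - 1) (by omega) n (by
    rw [hi']
    have : c / 2 * i ≤ c * (i - 1) := by nlinarith
    linarith)
  rwa [show -((i - 1 : ℕ) : ℤ) = -(i : ℤ) + (1 : ℕ) by omega] at this

/-- The coefficientwise map of Laurent series induced by a ring homomorphism. -/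
def laurentMap {O : Type u} {O' : Type v} [CommRing O] [CommRing O'] (f : O →+* O') :
    O⸨X⸩ →+* O'⸨X⸩ where
  toFun y := HahnSeries.map y f
  map_zero' := by ext; simp
  map_one' := HahnSeries.map_one f.toMonoidWithZeroHom
  map_add' x y := by ext; simp
  map_mul' x y := HahnSeries.map_mul (f : O →ₙ+* O')

lemma IsOverconvergent.map {p : ℕ} {O : Type u} {O' : Type v} [CommRing O] [CommRing O']
    (f : O →+* O') {x : Gam p O} (hx : IsOverconvergent p O x) :
    IsOverconvergent p O' (PComp.map p (laurentMap f) x) := by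
  obtain ⟨c, hc, hx⟩ := hx
  refine ⟨c, hc, ?_⟩
  filter_upwards [hx] with i hx n hn
  obtain ⟨x', hx'⟩ := x.exists_rep n
  have hd : Submodule.mkQ _ ((laurentMap f) x') =
      (PComp.map p (laurentMap f) x).val n := by
    change _ = quotMap p _ n (x.val n)
    rw [← hx']
    rfl
  rw [Gam.coeff_val_eq_zero_iff _ n _ hd]
  have h := (Gam.coeff_val_eq_zero_iff x n x' hx' _).1 (hx n hn)
  change (p : O') ^ n ∣ f (x'.coeff _)
  exact pow_dvd_map p (f : O →+ O') n h

/-- `Γ_con`: the subring of `Γ` of series `∑ x_i t ^ i` with `liminf v_p(x_{-i}) / i > 0`. -/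
def GamCon (p : ℕ) (O : Type u) [CommRing O] : Subring (Gam p O) where
  carrier := {x | IsOverconvergent p O x}
  mul_mem' := IsOverconvergent.mul
  one_mem' := by
    have := isOverconvergent_of p O 1
    rwa [map_one] at this
  add_mem' := IsOverconvergent.add
  zero_mem' := by
    have := isOverconvergent_of p O 0
    rwa [map_zero] at this
  neg_mem' := IsOverconvergent.neg

section

variable (p : ℕ) (O : Type u) [CommRing O]

/-- The constants `O → Γ_con`. -/
def GamCon.C : O →+* GamCon p O :=
  (Gam.C p O).codRestrict (GamCon p O) fun a => isOverconvergent_of p O (HahnSeries.C a)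

/-- The series parameter `t`, as an element of `Γ_con`. -/
def GamCon.t : GamCon p O :=
  ⟨Gam.of p O (HahnSeries.single 1 1), isOverconvergent_of p O _⟩

/-- The derivation `d / dt` of `Γ_con`. -/
def GamCon.deriv : GamCon p O →+ GamCon p O where
  toFun x := ⟨Gam.deriv p O (x : Gam p O), IsOverconvergent.deriv x.2⟩
  map_zero' := Subtype.ext (map_zero (Gam.deriv p O))
  map_add' x y := Subtype.ext (map_add (Gam.deriv p O) (x : Gam p O) (y : Gam p O))

/-- The coefficientwise map `Γ → Γ'` attached to an extension `O → O'` of coefficient rings. -/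
def Gam.ext (O' : Type v) [CommRing O'] [Algebra O O'] : Gam p O →+* Gam p O' :=
  PComp.map p (laurentMap (algebraMap O O'))

/-- The coefficientwise map `Γ_con → Γ'_con`. -/
def GamCon.ext (O' : Type v) [CommRing O'] [Algebra O O'] : GamCon p O →+* GamCon p O' :=
  (Gam.ext p O O').restrict (GamCon p O) (GamCon p O') fun _ hx =>
    IsOverconvergent.map (algebraMap O O') hx

end

/-! ### Frobenius lifts -/

/-- `σ` is an automorphism of the local ring `O` lifting the `p`-power map on its residue field. -/
def LiftsFrobenius (p : ℕ) {O : Type u} [CommRing O] [IsLocalRing O] (σ : O ≃+* O) : Prop :=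
  ∀ x : O, σ x - x ^ p ∈ IsLocalRing.maximalIdeal O

/-- An endomorphism `σ` of `Γ` lifting the `p`-power map on the residue field `Γ / 𝔪 Γ = k((t))`,
compatible with the given automorphism of `O`, and mapping `Γ_con` into itself. -/
structure FrobLift (p : ℕ) {O : Type u} [CommRing O] [IsLocalRing O] (σ₀ : O ≃+* O) where
  /-- the endomorphism of `Γ` -/
  toHom : Gam p O →+* Gam p O
  lifts : ∀ x, toHom x - x ^ p ∈ (IsLocalRing.maximalIdeal O).map (Gam.C p O)
  compat : ∀ a : O, toHom (Gam.C p O a) = Gam.C p O (σ₀ a)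
  map_con : ∀ x ∈ GamCon p O, toHom x ∈ GamCon p O

/-- The Frobenius lift on `Γ_con`. -/
def FrobLift.con {p : ℕ} {O : Type u} [CommRing O] [IsLocalRing O] {σ₀ : O ≃+* O}
    (σ : FrobLift p σ₀) : GamCon p O →+* GamCon p O :=
  σ.toHom.restrict (GamCon p O) (GamCon p O) σ.map_con

/-! ### The ring `Γ^perf` -/

/-- The direct limit of `A → A → A → ⋯` along an endomorphism `τ`, i.e. the universal ring over
`A` on which `τ` becomes an automorphism. -/
abbrev Colim {A : Type u} [CommRing A] (τ : A →+* A) : Type u :=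
  Ring.DirectLimit (fun _ : ℕ => A) (fun i j _ => ((τ ^ (j - i) : A →+* A) : A → A))

/-- The endomorphism of the direct limit induced by `τ`. -/
def Colim.frob {A : Type u} [CommRing A] (τ : A →+* A) : Colim τ →+* Colim τ :=
  Ring.DirectLimit.map (f := fun i j _ => τ ^ (j - i)) (f' := fun i j _ => τ ^ (j - i))
    (fun _ => τ) (by
      intro i j _
      change τ * τ ^ (j - i) = τ ^ (j - i) * τ
      rw [← pow_succ, ← pow_succ'])

/-- The inclusion of the initial copy of `A`. -/
def Colim.of {A : Type u} [CommRing A] (τ : A →+* A) : A →+* Colim τ :=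
  Ring.DirectLimit.of (fun _ : ℕ => A) _ 0

section

variable {p : ℕ} {O : Type u} [CommRing O] [IsLocalRing O] {σ₀ : O ≃+* O} (σ : FrobLift p σ₀)

/-- `Γ^perf`: the `p`-adic completion of the direct limit of `Γ → Γ → ⋯` along `σ`. It is the
`p`-adically complete extension of `Γ` whose residue field is the direct limit of `k((t))` along
the `p`-power map, i.e. the perfect closure of `k((t))`. -/
abbrev GamPerf : Type u := PComp p (Colim σ.toHom)

/-- The Frobenius `σ` on `Γ^perf`. -/
def GamPerf.frob : GamPerf σ →+* GamPerf σ := PComp.map p (Colim.frob σ.toHom)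

/-- The embedding `Γ → Γ^perf`. -/
def GamPerf.of : Gam p O →+* GamPerf σ :=
  (algebraMap (Colim σ.toHom) (GamPerf σ)).comp (Colim.of σ.toHom)

/-- The constants `O → Γ^perf`. -/
def GamPerf.C : O →+* GamPerf σ := (GamPerf.of σ).comp (Gam.C p O)

lemma GamPerf.of_frob (x : Gam p O) :
    GamPerf.of σ (σ.toHom x) = GamPerf.frob σ (GamPerf.of σ x) := by
  have h : Colim.of σ.toHom (σ.toHom x) = Colim.frob σ.toHom (Colim.of σ.toHom x) :=
    (Ring.DirectLimit.map_apply_of (G := fun _ : ℕ => Gam p O) (G' := fun _ : ℕ => Gam p O)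
      (f := fun i j _ => σ.toHom ^ (j - i)) (f' := fun i j _ => σ.toHom ^ (j - i))
      (fun _ => σ.toHom) _ (i := 0) x).symm
  change algebraMap (Colim σ.toHom) (GamPerf σ) _ = _
  rw [h]
  rfl

end

/-! ### `F`-crystals -/

/-- The ring `S`, regarded as an algebra over `R` through the ring homomorphism `φ : R → S`. -/
def Along {R : Type u} {S : Type v} [CommRing R] [CommRing S] (_φ : R →+* S) : Type v := S

instance {R : Type u} {S : Type v} [CommRing R] [CommRing S] (φ : R →+* S) :
    CommRing (Along φ) := inferInstanceAs (CommRing S)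

instance {R : Type u} {S : Type v} [CommRing R] [CommRing S] (φ : R →+* S) :
    Algebra R (Along φ) := φ.toAlgebra

/-- The identity of `S`, as a map `S → Along φ`. -/
def Along.mk {R : Type u} {S : Type v} [CommRing R] [CommRing S] (φ : R →+* S) : S →+* Along φ :=
  RingHom.id S

/-- The identity of `S`, as a map `Along φ → S`. -/
def Along.out {R : Type u} {S : Type v} [CommRing R] [CommRing S] (φ : R →+* S) : Along φ →+* S :=
  RingHom.id S

/-- An endomorphism of `S`, regarded as an endomorphism of `Along φ`. -/
abbrev Along.lift {R : Type u} {S : Type v} [CommRing R] [CommRing S] (φ : R →+* S)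
    (τ : S →+* S) : Along φ →+* Along φ :=
  (Along.mk φ).comp (τ.comp (Along.out φ))

section

variable {R : Type u} {M : Type w} [CommRing R] [AddCommGroup M] [Module R M] {σ : R →+* R}

/-- The linearization `R ⊗_{σ, R} M → M`, `a ⊗ m ↦ a F(m)`, of a `σ`-linear map `F`. -/
def linearization (F : M →ₛₗ[σ] M) : Along σ ⊗[R] M →+ M :=
  TensorProduct.liftAddHom
    (AddMonoidHom.mk' (fun a : Along σ => AddMonoidHom.mk' (fun m : M => Along.out σ a • F m)
        (fun m m' => by rw [map_add, smul_add]))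
      (fun a b => by
        ext m
        exact add_smul (Along.out σ a) (Along.out σ b) (F m)))
    (fun r a m => by
      change (σ r * Along.out σ a) • F m = Along.out σ a • F (r • m)
      rw [LinearMap.map_smulₛₗ, smul_smul, mul_comm])

/-- `F`-crystals over `R`: finite locally free modules `M` with a `σ`-linear map `F : M → M`
whose linearization becomes an isomorphism after inverting `p`, i.e. has cokernel and kernel
killed elementwise by powers of `p`. -/
structure IsFCrystal (p : ℕ) (F : M →ₛₗ[σ] M) : Prop where
  finite : Module.Finite R M
  projective : Module.Projective R M
  coker : ∀ m : M, ∃ (n : ℕ) (z : Along σ ⊗[R] M), linearization F z = p ^ n • m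
  ker : ∀ z : Along σ ⊗[R] M, linearization F z = 0 → ∃ n : ℕ, p ^ n • z = 0

/-- The `F`-crystal is constant: it has an isobasis (elements of `M` forming a basis after
inverting `p`) of eigenvectors for `F`, with eigenvalues in the ring `O₀` of `σ₀`-invariants of
`O`. Here `ι` gives the `O`-algebra structure of `R`. -/
def IsConstant (p : ℕ) {O : Type v} [CommRing O] (σ₀ : O ≃+* O) (ι : O →+* R)
    (F : M →ₛₗ[σ] M) : Prop :=
  ∃ (r : ℕ) (e : Fin r → M) (lam : Fin r → O),
    (∀ j, lam j ≠ 0 ∧ σ₀ (lam j) = lam j ∧ F (e j) = ι (lam j) • e j) ∧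
    LinearIndependent R e ∧
    ∀ m : M, ∃ n : ℕ, p ^ n • m ∈ Submodule.span R (Set.range e)

/-- The map induced by `F` on the quotient `N' / N` for `F`-stable submodules `N ≤ N'`. -/
def subquotient (F : M →ₛₗ[σ] M) (N N' : Submodule R M) (h : ∀ x ∈ N, F x ∈ N)
    (h' : ∀ x ∈ N', F x ∈ N') : (N' ⧸ N.submoduleOf N') →ₛₗ[σ] (N' ⧸ N.submoduleOf N') :=
  Submodule.mapQ _ _ (F.restrict h') (fun x hx => h x hx)

/-- The `F`-crystal is unipotent: it has a finite filtration `0 = M_0 ≤ ⋯ ≤ M_n = M` by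
`F`-stable submodules whose successive quotients are constant `F`-crystals. -/
def IsUnipotent (p : ℕ) {O : Type v} [CommRing O] (σ₀ : O ≃+* O) (ι : O →+* R)
    (F : M →ₛₗ[σ] M) : Prop :=
  ∃ (n : ℕ) (Fil : ℕ → Submodule R M) (_ : ∀ i, Fil i ≤ Fil (i + 1))
    (hF : ∀ i, ∀ x ∈ Fil i, F x ∈ Fil i),
    Fil 0 = ⊥ ∧ Fil n = ⊤ ∧
    ∀ i < n, IsFCrystal p (subquotient F (Fil i) (Fil (i + 1)) (hF i) (hF (i + 1))) ∧
      IsConstant p σ₀ ι (subquotient F (Fil i) (Fil (i + 1)) (hF i) (hF (i + 1)))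

/-- The additive map `a ⊗ m ↦ τ a ⊗ F m`. -/
def baseChangeAdd {S : Type v} [CommRing S] (φ : R →+* S) (τ : S →+* S)
    (h : ∀ x, φ (σ x) = τ (φ x)) (F : M →ₛₗ[σ] M) :
    (Along φ ⊗[R] M) →+ (Along φ ⊗[R] M) :=
  TensorProduct.liftAddHom
    (AddMonoidHom.mk' (fun a : Along φ => AddMonoidHom.mk'
        (fun m : M => Along.mk φ (τ (Along.out φ a)) ⊗ₜ[R] F m)
        (fun m m' => by rw [map_add, TensorProduct.tmul_add]))
      (fun a b => by
        ext m
        change Along.mk φ (τ (Along.out φ a + Along.out φ b)) ⊗ₜ[R] F m = _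
        rw [map_add]
        exact TensorProduct.add_tmul _ _ _))
    (fun r a m => by
      change Along.mk φ (τ (φ r * Along.out φ a)) ⊗ₜ[R] F m =
        Along.mk φ (τ (Along.out φ a)) ⊗ₜ[R] F (r • m)
      rw [LinearMap.map_smulₛₗ, map_mul, ← h, ← TensorProduct.smul_tmul]
      rfl)

/-- The base change `τ ⊗ F` of a `σ`-linear map `F` along a ring homomorphism `φ : R → S` with
`φ ∘ σ = τ ∘ φ`. -/
def baseChange {S : Type v} [CommRing S] (φ : R →+* S) (τ : S →+* S)
    (h : ∀ x, φ (σ x) = τ (φ x)) (F : M →ₛₗ[σ] M) :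
    (Along φ ⊗[R] M) →ₛₗ[Along.lift φ τ] (Along φ ⊗[R] M) where
  toFun := baseChangeAdd φ τ h F
  map_add' := map_add _
  map_smul' s z := by
    induction z with
    | zero => rw [smul_zero, map_zero, smul_zero]
    | tmul a m =>
      change Along.mk φ (τ (Along.out φ s * Along.out φ a)) ⊗ₜ[R] F m = _
      rw [map_mul]
      rfl
    | add x y hx hy => rw [smul_add, map_add, map_add, smul_add, hx, hy]

end

/-! ### `(F, ∇)`-crystals over `Γ_con` -/

/-- An `(F, ∇)`-crystal over `Γ_con`: an `F`-crystal with a connection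
`∇ : M → M ⊗ Ω`, where `Ω = Γ_con dt` is the module of (continuous) differentials. We write
`∇ m = D m ⊗ dt`; horizontality of `F` says that `∇ (F m) = (F ⊗ dσ) (∇ m) = F (D m) ⊗ d(σ t)`. -/
structure FNablaCrystal {p : ℕ} {O : Type u} [CommRing O] [IsLocalRing O] {σ₀ : O ≃+* O}
    (σ : FrobLift p σ₀) (M : Type w) [AddCommGroup M] [Module (GamCon p O) M] where
  /-- the Frobenius -/
  F : M →ₛₗ[σ.con] M
  isFCrystal : IsFCrystal p F
  /-- the connection, contracted with `d / dt` -/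
  D : M →+ M
  leibniz : ∀ (x : GamCon p O) (m : M), D (x • m) = GamCon.deriv p O x • m + x • D m
  horizontal : ∀ m, D (F m) = GamCon.deriv p O (σ.con (GamCon.t p O)) • F (D m)

/-! ### Extension of the coefficient ring -/

section

variable {p : ℕ} {O : Type u} [CommRing O] [IsLocalRing O] {σ₀ : O ≃+* O}
  {O' : Type v} [CommRing O'] [IsLocalRing O'] {σ₀' : O' ≃+* O'} [Algebra O O']

/-- The Frobenius lift `σ'` on `Γ'` extends the Frobenius lift `σ` on `Γ`. -/
def FrobLift.Extends (σ' : FrobLift p σ₀') (σ : FrobLift p σ₀) : Prop :=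
  ∀ x : Gam p O, σ'.toHom (Gam.ext p O O' x) = Gam.ext p O O' (σ.toHom x)

/-- The map `Γ_con → Γ'^perf`. -/
def GamCon.toPerf (O : Type u) [CommRing O] [Algebra O O'] (σ' : FrobLift p σ₀') :
    GamCon p O →+* GamPerf σ' :=
  (GamPerf.of σ').comp ((GamCon p O').subtype.comp (GamCon.ext p O O'))

variable {M : Type w} [AddCommGroup M] [Module (GamCon p O) M]

/-- The Frobenius on the base change of an `(F, ∇)`-crystal from `Γ_con` to `Γ'_con`. -/
def FNablaCrystal.frobExt {σ : FrobLift p σ₀} (X : FNablaCrystal σ M) (σ' : FrobLift p σ₀')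
    (h : σ'.Extends σ) :
    (Along (GamCon.ext p O O') ⊗[GamCon p O] M)
      →ₛₗ[Along.lift (GamCon.ext p O O') σ'.con]
      (Along (GamCon.ext p O O') ⊗[GamCon p O] M) :=
  baseChange (GamCon.ext p O O') σ'.con (fun x : GamCon p O => by
    apply Subtype.ext
    exact (h (x : Gam p O)).symm) X.F

/-- The Frobenius on the base change of an `(F, ∇)`-crystal from `Γ_con` to `Γ'^perf`. -/
def FNablaCrystal.frobPerf {σ : FrobLift p σ₀} (X : FNablaCrystal σ M) (σ' : FrobLift p σ₀')
    (h : σ'.Extends σ) :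
    (Along (GamCon.toPerf O σ') ⊗[GamCon p O] M)
      →ₛₗ[Along.lift (GamCon.toPerf O σ') (GamPerf.frob σ')]
      (Along (GamCon.toPerf O σ') ⊗[GamCon p O] M) :=
  baseChange (GamCon.toPerf O σ') (GamPerf.frob σ') (fun x : GamCon p O => by
    rw [← show _ = GamPerf.frob σ' (GamCon.toPerf O σ' x) from GamPerf.of_frob σ' _]
    exact congrArg (GamPerf.of σ') (h (x : Gam p O)).symm) X.F

end

end OCrys

end

/-! ### Linear algebra over fields `C ⊆ K ⊆ L` with Frobenius. -/

noncomputable section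

namespace OCrys

universe u v w

set_option linter.unusedSectionVars false

/-! Let C ⊆ K ⊆ L be the fraction fields of Γ'_con, Γ' and Γ'^perf. After inverting p, the claim is
that a space P over C with horizontal Frobenius F, spanned over L by eigenvectors, is a successive
extension of eigenlines. Such a flag is then pulled back to the lattice M ⊗ Γ'_con; the pulled back
steps are saturated, so the rank one quotients are free over the discrete valuation ring Γ'_con
(`HasFlag.isUnipotent`). `PeriodDatum` isolates what is needed of the three fields, and
`hasFlag_of_span_eigenvectors` is an induction on dim P.

Let a be an eigenvalue of largest p-adic valuation and v the coordinate functional of its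
eigenvector, restricted to P, so that v(Fu) = aσ(v(u)). As every eigenvalue divides a, there is a
basis q of P over C with aq = HF(q) and H integral (`exists_good_basis`): high Frobenius powers move
an eigenbasis close to P. Hence v(q) = Hσ(v(q)). Iterating, and approximating σ^m(v(q)) by elements
of C, one finds that v takes values in K (`exists_preimage_of_eq_sum`). The failure δ of v to
respect the connections satisfies δ = sHσ(δ), where s = dσ(t)/dt is divisible by the uniformizer, so
δ = 0 (`eq_zero_of_eq_sum`).

The image Q ⊆ K of v is in fact C. It contains 1: the chosen eigenvector gives w in L ⊗ Q with
eigenvalue a which multiplies out to 1, its coordinates satisfy σ(W) = HW in a basis of Q, and a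
K-linear retraction L → K sends such W into C (`one_mem_of_eigenvector`). Then Q/C has smaller
dimension, so it has a flag by induction, and integrating along this flag gives Q ⊆ C, because an
element of K with derivative in C lies in C (`le_range_of_hasFlag`). Finally ker v is smaller than P
and spanned over L by the remaining eigenvectors, so induction finishes.

Two facts carry the analysis. Integration divides coefficients by integers, whose valuations grow
only logarithmically, and so preserves overconvergence (`CoeffUnif.mem_gamCon_of_deriv`). The
retraction Θ is built from a left inverse ψ of Frobenius (`exists_leftInverse`), using ψ^n on the
n-th copy of Γ' in the direct limit; then Θ = ψΘσ, and σ(W) = HW gives Θ(W) = ψ(HΘ(W)). Since ψ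
divides orders of poles by p while H adds a bounded amount, the solution is overconvergent
(`mem_gamCon_of_fixed`). -/

/-- Fields `C ⊆ K ⊆ L` with compatible Frobenius endomorphisms, and a derivation on `K` and `C`,
with the properties of the fraction fields of `Γ_con`, `Γ` and `Γ^perf` that control the
`(F, ∇)`-modules over `C` which are spanned by eigenvectors over `L`. -/
structure PeriodDatum (p : ℕ) (C K L : Type u) [Field C] [Field K] [Field L] [Algebra C K]
    [Algebra K L] [Algebra C L] [IsScalarTower C K L] where
  /-- the Frobenius of `C` -/
  σC : C →+* C
  /-- the Frobenius of `K` -/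
  σK : K →+* K
  /-- the Frobenius of `L` -/
  σL : L →+* L
  σK_algebraMap : ∀ x, σK (algebraMap C K x) = algebraMap C K (σC x)
  σL_algebraMap : ∀ x, σL (algebraMap K L x) = algebraMap K L (σK x)
  /-- the derivation of `C` -/
  DC : C →+ C
  /-- the derivation of `K` -/
  DK : K →+ K
  DK_algebraMap : ∀ x, DK (algebraMap C K x) = algebraMap C K (DC x)
  DK_mul : ∀ x y, DK (x * y) = DK x * y + x * DK y
  /-- the derivative of the Frobenius lift of the parameter -/
  s : C
  DK_σK : ∀ x, DK (σK x) = algebraMap C K s * σK (DK x)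
  /-- the integral elements of `L` -/
  Lo : ValuationSubring L
  inv_p_notMem : (p : L)⁻¹ ∉ Lo
  σL_mem : ∀ x ∈ Lo, σL x ∈ Lo
  bounded : ∀ z : L, ∃ n : ℕ, (p : L) ^ n * z ∈ Lo
  sep : ∀ z : L, (∀ n : ℕ, ∃ y ∈ Lo, z = (p : L) ^ n * y) → z = 0
  /-- a uniformizer -/
  ϖ : L
  σL_ϖ : ∃ c ∈ Lo, σL ϖ = ϖ * c
  s_ϖ : ∃ c ∈ Lo, algebraMap C L s = ϖ * c
  ϖ_pow : ∃ e : ℕ, ∃ c ∈ Lo, ϖ ^ e = p * c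
  closed : ∀ z : L, (∀ n : ℕ, ∃ y : K, ∃ c ∈ Lo, z - algebraMap K L y = (p : L) ^ n * c) →
    ∃ y : K, algebraMap K L y = z
  dense : ∀ (z : L) (n : ℕ), ∃ (m : ℕ) (y : C), ∃ c ∈ Lo,
    (σL ^ m) z - algebraMap C L y = (p : L) ^ n * c
  integ : ∀ (z : K) (y : C), DK z = algebraMap C K y → ∃ x : C, algebraMap C K x = z
  /-- a retraction of `L` onto `K` -/
  retr : L →ₗ[K] K
  retr_one : retr 1 = 1
  retr_mem : ∀ {n : ℕ} (W : Fin n → L) (H : Fin n → Fin n → C),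
    (∀ i j, algebraMap C L (H i j) ∈ Lo) →
    (∀ i, σL (W i) = ∑ j, algebraMap C L (H i j) * W j) →
    ∀ i, ∃ x : C, algebraMap C K x = retr (W i)
  /-- the eigenvalues that are allowed -/
  eig : Set C
  eig_ne : ∀ a ∈ eig, a ≠ 0
  σC_eig : ∀ a ∈ eig, σC a = a
  DC_eig : ∀ a ∈ eig, DC a = 0

namespace PeriodDatum

variable {p : ℕ} {C K L : Type u} [Field C] [Field K] [Field L] [Algebra C K]
    [Algebra K L] [Algebra C L] [IsScalarTower C K L] (𝒟 : PeriodDatum p C K L)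

lemma algebraMap_CL (x : C) : algebraMap C L x = algebraMap K L (algebraMap C K x) :=
  IsScalarTower.algebraMap_apply C K L x

lemma σL_algebraMap_C (x : C) : 𝒟.σL (algebraMap C L x) = algebraMap C L (𝒟.σC x) := by
  rw [algebraMap_CL (K := K), σL_algebraMap, σK_algebraMap, ← algebraMap_CL]

lemma p_ne (𝒟 : PeriodDatum p C K L) : (p : L) ≠ 0 := by
  intro h
  exact 𝒟.inv_p_notMem (by rw [h, inv_zero]; exact 𝒟.Lo.zero_mem)

lemma p_mem : (p : L) ∈ 𝒟.Lo := natCast_mem _ _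

lemma σL_pow_mem (m : ℕ) {x : L} (hx : x ∈ 𝒟.Lo) : (𝒟.σL ^ m) x ∈ 𝒟.Lo := by
  induction m with
  | zero => exact hx
  | succ m ih => rw [pow_succ', RingHom.coe_mul]; exact 𝒟.σL_mem _ ih

/-- `z` is divisible by `p ^ n` in `Lo`. -/
def Dvd (n : ℕ) (z : L) : Prop := ∃ c ∈ 𝒟.Lo, z = (p : L) ^ n * c

variable {𝒟} in
lemma Dvd.add {n : ℕ} {y z : L} (hy : 𝒟.Dvd n y) (hz : 𝒟.Dvd n z) : 𝒟.Dvd n (y + z) := by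
  obtain ⟨a, ha, rfl⟩ := hy
  obtain ⟨b, hb, rfl⟩ := hz
  exact ⟨a + b, add_mem ha hb, by ring⟩

variable {𝒟} in
lemma Dvd.mul {m n : ℕ} {y z : L} (hy : 𝒟.Dvd m y) (hz : 𝒟.Dvd n z) :
    𝒟.Dvd (m + n) (y * z) := by
  obtain ⟨a, ha, rfl⟩ := hy
  obtain ⟨b, hb, rfl⟩ := hz
  exact ⟨a * b, mul_mem ha hb, by ring⟩

variable {𝒟} in
lemma Dvd.mono {m n : ℕ} (h : m ≤ n) {y : L} (hy : 𝒟.Dvd n y) : 𝒟.Dvd m y := by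
  obtain ⟨a, ha, rfl⟩ := hy
  obtain ⟨k, rfl⟩ := Nat.exists_eq_add_of_le h
  exact ⟨p ^ k * a, mul_mem (pow_mem 𝒟.p_mem _) ha, by ring⟩

variable {𝒟} in
lemma Dvd.sum {ι : Type*} (s : Finset ι) {n : ℕ} {f : ι → L} (h : ∀ i ∈ s, 𝒟.Dvd n (f i)) :
    𝒟.Dvd n (∑ i ∈ s, f i) := by
  classical
  induction s using Finset.induction_on with
  | empty => exact ⟨0, zero_mem _, by simp⟩
  | insert a s ha ih =>
    rw [Finset.sum_insert ha]
    exact (h _ (Finset.mem_insert_self _ _)).add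
      (ih fun i hi => h i (Finset.mem_insert_of_mem hi))

lemma dvd_zero_iff {z : L} : 𝒟.Dvd 0 z ↔ z ∈ 𝒟.Lo := by simp [Dvd]

variable {𝒟} in
lemma Dvd.map {n : ℕ} {y : L} (hy : 𝒟.Dvd n y) (m : ℕ) : 𝒟.Dvd n ((𝒟.σL ^ m) y) := by
  obtain ⟨a, ha, rfl⟩ := hy
  exact ⟨_, 𝒟.σL_pow_mem m ha, by rw [map_mul, map_pow, map_natCast]⟩

/-- Otherwise `1 + x` and `x` would both have valuation less than 1, and so would their difference
1. -/
lemma inv_one_add_mem {x : L} (hx : 𝒟.Dvd 1 x) : (1 + x)⁻¹ ∈ 𝒟.Lo := by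
  by_contra h
  obtain ⟨c, hc, rfl⟩ := hx
  have h1 : 𝒟.Lo.valuation (1 + p ^ 1 * c) < 1 := by
    rw [← not_le] 
    intro h2
    apply h
    rw [← 𝒟.Lo.valuation_le_one_iff, map_inv₀]
    exact inv_le_one_of_one_le₀ h2
  have h2 : 𝒟.Lo.valuation (p : L) < 1 := by
    rw [← not_le]
    intro h2
    apply 𝒟.inv_p_notMem
    rw [← 𝒟.Lo.valuation_le_one_iff, map_inv₀]
    exact inv_le_one_of_one_le₀ h2
  have h3 : 𝒟.Lo.valuation (p ^ 1 * c : L) < 1 := by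
    rw [pow_one, map_mul]
    exact mul_lt_one_of_lt_of_le h2 ((𝒟.Lo.valuation_le_one_iff _).2 hc)
  have h4 := (𝒟.Lo.valuation).map_sub (1 + p ^ 1 * c) (p ^ 1 * c)
  rw [add_sub_cancel_right, map_one] at h4
  exact absurd (max_lt h1 h3) (not_lt.2 h4)

/-- Simultaneous approximation of finitely many elements. -/
lemma dense_finite {ι : Type*} [Finite ι] (z : ι → L) (n : ℕ) : ∃ (m : ℕ) (y : ι → C),
    ∀ i, 𝒟.Dvd n ((𝒟.σL ^ m) (z i) - algebraMap C L (y i)) := by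
  have : Fintype ι := Fintype.ofFinite ι
  choose m y c hc h using fun i => 𝒟.dense (z i) n
  -- The exponents `m i` differ; the missing power of Frobenius is applied to each approximation,
  -- which preserves `C` and divisibility by `p ^ n`.
  refine ⟨∑ i, m i, fun i => (𝒟.σC ^ (∑ i, m i - m i)) (y i), fun i => ?_⟩
  have hm : m i ≤ ∑ i, m i := Finset.single_le_sum (fun _ _ => Nat.zero_le _) (Finset.mem_univ i)
  have e : ∀ (k : ℕ) (x : C), (𝒟.σL ^ k) (algebraMap C L x) = algebraMap C L ((𝒟.σC ^ k) x) := by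
    intro k x
    induction k with
    | zero => rfl
    | succ k ih => rw [pow_succ', RingHom.coe_mul, Function.comp_apply, ih, σL_algebraMap_C,
        pow_succ', RingHom.coe_mul, Function.comp_apply]
  have := (show 𝒟.Dvd n _ from ⟨c i, hc i, h i⟩).map (∑ i, m i - m i)
  rw [map_sub, e] at this
  rwa [← Function.comp_apply (f := ⇑(𝒟.σL ^ (∑ i, m i - m i))), ← RingHom.coe_mul, ← pow_add,
    Nat.sub_add_cancel hm] at this

/-! ### Modules with Frobenius and connection -/

/-- `σL` as a semilinear map over `C`. -/
def σLₛ : L →ₛₗ[𝒟.σC] L where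
  toFun := 𝒟.σL
  map_add' := map_add _
  map_smul' c x := by rw [Algebra.smul_def, map_mul, σL_algebraMap_C, Algebra.smul_def]

section

variable {P : Type u} [AddCommGroup P] [Module C P] (F : P →ₛₗ[𝒟.σC] P)

/-- The base change of `F` to `L`. -/
def frobL : L ⊗[C] P →ₛₗ[𝒟.σC] L ⊗[C] P := TensorProduct.map 𝒟.σLₛ F

lemma frobL_smul (a : L) (z : L ⊗[C] P) : 𝒟.frobL F (a • z) = 𝒟.σL a • 𝒟.frobL F z := by
  induction z with
  | zero => simp
  | tmul x y =>
    change (𝒟.σL (a * x)) ⊗ₜ[C] F y = 𝒟.σL a • (𝒟.σL x ⊗ₜ[C] F y)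
    rw [map_mul, TensorProduct.smul_tmul', smul_eq_mul]
  | add x y hx hy => rw [smul_add, map_add, map_add, hx, hy, smul_add]

lemma frobL_tmul (x : L) (y : P) : 𝒟.frobL F (x ⊗ₜ y) = 𝒟.σL x ⊗ₜ F y := rfl

/-- The eigenvectors of `F` over `L` whose eigenvalues divide `a`. -/
def eigenvectors (S : Set C) : Set (L ⊗[C] P) :=
  {z | ∃ b ∈ 𝒟.eig, b ∈ S ∧ 𝒟.frobL F z = algebraMap C L b • z}

/-- The connection `D` satisfies the Leibniz rule, and `F` is horizontal. -/
structure IsHorizontal (D : P →+ P) : Prop where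
  leibniz : ∀ (x : C) (m : P), D (x • m) = 𝒟.DC x • m + x • D m
  horizontal : ∀ m, D (F m) = 𝒟.s • F (D m)

/-- `P` is a successive extension of horizontal eigenlines. -/
def HasFlag (D : P →+ P) : Prop :=
  ∃ (n : ℕ) (Fil : ℕ → Submodule C P), Fil 0 = ⊥ ∧ Fil n = ⊤ ∧
    ∀ i < n, ∃ (q : P), ∃ b ∈ 𝒟.eig, q ∉ Fil i ∧ Fil (i + 1) = Fil i ⊔ Submodule.span C {q} ∧
      F q - b • q ∈ Fil i ∧ D q ∈ Fil i

variable {Q : Type u} [AddCommGroup Q] [Module C Q] (G : Q →ₛₗ[𝒟.σC] Q)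

lemma frobL_map (f : P →ₗ[C] Q) (h : ∀ x, f (F x) = G (f x)) (z : L ⊗[C] P) :
    𝒟.frobL G (f.baseChange L z) = f.baseChange L (𝒟.frobL F z) := by
  induction z with
  | zero => simp
  | tmul x y => simp [frobL_tmul, h]
  | add x y hx hy => rw [map_add, map_add, map_add, map_add, hx, hy]

lemma map_mem_eigenvectors (f : P →ₗ[C] Q) (h : ∀ x, f (F x) = G (f x)) {S : Set C}
    {z : L ⊗[C] P} (hz : z ∈ 𝒟.eigenvectors F S) : f.baseChange L z ∈ 𝒟.eigenvectors G S := by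
  obtain ⟨b, hb, hS, h1⟩ := hz
  exact ⟨b, hb, hS, by rw [frobL_map 𝒟 F G f h, h1, map_smul]⟩

/-- Being spanned by eigenvectors passes to quotients. -/
lemma span_eigenvectors_of_surjective (f : P →ₗ[C] Q) (hf : Function.Surjective f)
    (h : ∀ x, f (F x) = G (f x)) {S : Set C}
    (hP : Submodule.span L (𝒟.eigenvectors F S) = ⊤) :
    Submodule.span L (𝒟.eigenvectors G S) = ⊤ := by
  rw [eq_top_iff, ← LinearMap.range_eq_top.2
    (show Function.Surjective (f.baseChange L) from LinearMap.lTensor_surjective L hf),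
    LinearMap.range_eq_map, ← hP, Submodule.map_span_le]
  exact fun z hz => Submodule.subset_span (𝒟.map_mem_eigenvectors F G f h hz)

end

end PeriodDatum

/-! ### Bases in which Frobenius has an integral inverse up to a scalar. -/

namespace PeriodDatum

variable {p : ℕ} {C K L : Type u} [Field C] [Field K] [Field L] [Algebra C K]
    [Algebra K L] [Algebra C L] [IsScalarTower C K L] (𝒟 : PeriodDatum p C K L)

/-- The determinant is 1 plus a multiple of `p` in `Lo`, hence a unit there, and the adjugate is
integral. -/
lemma exists_inverse_one_add {r : ℕ} (Δ : Matrix (Fin r) (Fin r) L)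
    (h : ∀ i j, 𝒟.Dvd 1 (Δ i j)) :
    ∃ T : Matrix (Fin r) (Fin r) L, (∀ i j, T i j ∈ 𝒟.Lo) ∧ (1 + Δ) * T = 1 := by
  choose c hc h using h
  let c₀ : Matrix (Fin r) (Fin r) 𝒟.Lo := fun i j => ⟨c i j, hc i j⟩
  let p₀ : 𝒟.Lo := (p : 𝒟.Lo)
  let f : 𝒟.Lo →+* L := 𝒟.Lo.subtype
  have hΔ : 1 + Δ = f.mapMatrix (1 + p₀ • c₀) := by
    ext i j
    rw [map_add, map_one, Matrix.add_apply, Matrix.add_apply, h]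
    simp only [f, p₀, c₀]
    change _ = _ + ((p : 𝒟.Lo) : L) * c i j
    simp
  obtain ⟨x, hx⟩ : ∃ x, (1 + p₀ • c₀).det = 1 + p₀ * x := by
    rw [Matrix.det_one_add_smul]
    exact ⟨c₀.trace + Polynomial.eval p₀ _ * p₀, by ring⟩
  have hu : f (1 + p₀ * x) ≠ 0 ∧ (f (1 + p₀ * x))⁻¹ ∈ 𝒟.Lo := by
    have : 𝒟.Dvd 1 (p * (x : L)) := ⟨x, x.2, by simp⟩
    have h1 := 𝒟.inv_one_add_mem this
    have e : f (1 + p₀ * x) = 1 + p * (x : L) := by simp [f, p₀]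
    -- Integrality of the inverse does not exclude a zero determinant, as the inverse of 0 is 0; but
    -- then `-x` would invert `p` in `Lo`.
    refine ⟨?_, by rwa [e]⟩
    rw [e]
    intro h0
    apply 𝒟.inv_p_notMem
    have : (p : L) * (-x) = 1 := by linear_combination -h0
    rw [inv_eq_of_mul_eq_one_right this]
    exact neg_mem x.2
  refine ⟨fun i j => (f (1 + p₀ * x))⁻¹ * f ((1 + p₀ • c₀).adjugate i j), fun i j =>
    mul_mem hu.2 (Subtype.mem _), ?_⟩
  have := congrArg f.mapMatrix (Matrix.mul_adjugate (1 + p₀ • c₀))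
  rw [map_mul, ← hΔ, hx] at this
  have e : (fun i j => (f (1 + p₀ * x))⁻¹ * f ((1 + p₀ • c₀).adjugate i j)) =
    (f (1 + p₀ * x))⁻¹ • f.mapMatrix (1 + p₀ • c₀).adjugate := rfl
  rw [e, Matrix.mul_smul, this]
  ext i j
  by_cases hij : i = j
  · subst hij
    have := inv_mul_cancel₀ hu.1
    simpa using this
  · simp [hij]

section

variable {P : Type u} [AddCommGroup P] [Module C P] [Module.Finite C P]

omit [Module.Finite C P] in
lemma linearIndependent_of_tmul {r : ℕ} (x : Fin r → P)
    (h : LinearIndependent L (fun i => (1 : L) ⊗ₜ[C] x i)) : LinearIndependent C x := by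
  rw [Fintype.linearIndependent_iff] at h ⊢
  intro g hg i
  have := h (fun i => algebraMap C L (g i)) (by
    have := congrArg (fun y => (1 : L) ⊗ₜ[C] y) hg
    simpa [TensorProduct.tmul_sum, TensorProduct.tmul_smul] using this) i
  exact (map_eq_zero (algebraMap C L)).1 this

lemma linearIndependent_tmul_of_span (x : Fin (Module.finrank C P) → P)
    (h : ⊤ ≤ Submodule.span L (Set.range fun i => (1 : L) ⊗ₜ[C] x i)) :
    LinearIndependent L (fun i => (1 : L) ⊗ₜ[C] x i) :=
  linearIndependent_of_top_le_span_of_card_eq_finrank h (by simp)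

variable (F : P →ₛₗ[𝒟.σC] P)

omit [Module.Finite C P] in
lemma frobL_sum {ι : Type*} (s : Finset ι) (a : ι → L) (z : ι → L ⊗[C] P) :
    𝒟.frobL F (∑ i ∈ s, a i • z i) = ∑ i ∈ s, 𝒟.σL (a i) • 𝒟.frobL F (z i) := by
  rw [map_sum]
  exact Finset.sum_congr rfl fun i _ => 𝒟.frobL_smul F _ _

omit [Module.Finite C P] in
lemma frobL_iterate_sum {ι : Type*} (s : Finset ι) (m : ℕ) (a : ι → L) (z : ι → L ⊗[C] P) :
    (𝒟.frobL F)^[m] (∑ i ∈ s, a i • z i) =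
      ∑ i ∈ s, (𝒟.σL ^ m) (a i) • (𝒟.frobL F)^[m] (z i) := by
  induction m with
  | zero => rfl
  | succ m ih =>
    rw [Function.iterate_succ_apply', ih, frobL_sum]
    refine Finset.sum_congr rfl fun i _ => ?_
    rw [Function.iterate_succ_apply', pow_succ', RingHom.coe_mul, Function.comp_apply]

omit [Module.Finite C P] in
lemma frobL_iterate_tmul (m : ℕ) (y : P) :
    (𝒟.frobL F)^[m] ((1 : L) ⊗ₜ y) = (1 : L) ⊗ₜ (F^[m] y) := by
  induction m with
  | zero => rfl
  | succ m ih => rw [Function.iterate_succ_apply', ih, frobL_tmul, map_one,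
      Function.iterate_succ_apply']

/-- An eigenbasis extracted from a spanning set of eigenvectors. -/
lemma exists_eigenbasis {S : Set C} (h : Submodule.span L (𝒟.eigenvectors F S) = ⊤) :
    ∃ (e : Module.Basis (Fin (Module.finrank C P)) L (L ⊗[C] P)) (b : Fin (Module.finrank C P) → C),
      ∀ i, b i ∈ 𝒟.eig ∧ b i ∈ S ∧ 𝒟.frobL F (e i) = algebraMap C L (b i) • e i := by
  obtain ⟨B, hB, hspan, hli⟩ := exists_linearIndependent L (𝒟.eigenvectors F S)
  let e₀ : Module.Basis B L (L ⊗[C] P) := Module.Basis.mk hli (by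
    rw [Subtype.range_coe, hspan, h])
  have hfin : Finite B := Module.Finite.finite_basis e₀
  have := Fintype.ofFinite B
  have hcard : Fintype.card B = Module.finrank C P := by
    rw [← Module.finrank_eq_card_basis e₀, Module.finrank_baseChange]
  let e := e₀.reindex (Fintype.equivFinOfCardEq hcard)
  have he : ∀ i, e i ∈ 𝒟.eigenvectors F S := by
    intro i
    simp only [e, e₀, Module.Basis.reindex_apply, Module.Basis.mk_apply]
    exact hB (Subtype.mem _)
  choose b hb using he
  exact ⟨e, b, hb⟩

/-- A basis in which the inverse of `F`, multiplied by an eigenvalue of largest valuation, is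
integral. -/
lemma exists_good_basis (a : C) 
    (h : Submodule.span L (𝒟.eigenvectors F
      {b | algebraMap C L a / algebraMap C L b ∈ 𝒟.Lo}) = ⊤) :
    ∃ (q : Module.Basis (Fin (Module.finrank C P)) C P)
      (H : Fin (Module.finrank C P) → Fin (Module.finrank C P) → C),
      (∀ i j, algebraMap C L (H i j) ∈ 𝒟.Lo) ∧
      (LinearIndependent L fun i => (1 : L) ⊗ₜ[C] F (q i)) ∧
      ∀ j, a • q j = ∑ i, H i j • F (q i) := by
  classical
  obtain ⟨e, b, hb⟩ := 𝒟.exists_eigenbasis F h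
  let q₀ := Module.finBasis C P
  let qL := Algebra.TensorProduct.basis L q₀
  have hqL : ∀ i, qL i = (1 : L) ⊗ₜ q₀ i := fun i => Algebra.TensorProduct.basis_apply q₀ i
  choose c hc using fun k : Fin (Module.finrank C P) × Fin (Module.finrank C P) => 𝒟.bounded (e.repr (qL k.2) k.1)
  set c₀ := ∑ k, c k
  have hc₀ : ∀ i j, (p : L) ^ c₀ * e.repr (qL j) i ∈ 𝒟.Lo := by
    intro i j
    obtain ⟨d, hd⟩ := Nat.exists_eq_add_of_le
      (Finset.single_le_sum (f := c) (fun _ _ => Nat.zero_le _) (Finset.mem_univ (i, j)))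
    rw [show c₀ = c (i, j) + d from hd, pow_add, mul_comm (_ ^ _), mul_assoc]
    exact mul_mem (pow_mem 𝒟.p_mem _) (hc (i, j))
  -- Passing from coordinates in `q₀` to coordinates in the eigenbasis loses `p ^ c₀`; precision `c₀
  -- + 1` leaves an error divisible by `p`.
  obtain ⟨m, y, hy⟩ := 𝒟.dense_finite (fun k : Fin (Module.finrank C P) × Fin (Module.finrank C P) => qL.repr (e k.2) k.1) (c₀ + 1)
  have heig : ∀ k, (𝒟.frobL F)^[m] (e k) = algebraMap C L (b k) ^ m • e k := by
    intro k
    clear hy y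
    induction m with
    | zero => simp
    | succ m ih =>
      rw [Function.iterate_succ_apply', ih, frobL_smul, (hb k).2.2, map_pow, σL_algebraMap_C,
        𝒟.σC_eig _ (hb k).1, smul_smul, pow_succ]
  have hbne : ∀ k, algebraMap C L (b k) ≠ 0 := fun k =>
    (map_ne_zero _).2 (𝒟.eig_ne _ (hb k).1)
  -- `f k` is the `m`-th Frobenius iterate of `e k`. Its coordinates in the iterates of `q₀` are σ^m
  -- of those of `e k`, hence close to `C`.
  obtain ⟨f, hfdef⟩ : ∃ f : Fin (Module.finrank C P) → L ⊗[C] P,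
      ∀ k, f k = algebraMap C L (b k) ^ m • e k := ⟨_, fun _ => rfl⟩
  have hfF : ∀ k, 𝒟.frobL F (f k) = algebraMap C L (b k) • f k := by
    intro k
    rw [hfdef, frobL_smul, (hb k).2.2, map_pow, σL_algebraMap_C, 𝒟.σC_eig _ (hb k).1, smul_comm]
  have hfspan : ⊤ ≤ Submodule.span L (Set.range f) := by
    rw [← e.span_eq, Submodule.span_le]
    rintro _ ⟨k, rfl⟩
    have : e k = (algebraMap C L (b k) ^ m)⁻¹ • f k := by
      rw [hfdef, smul_smul, inv_mul_cancel₀ (pow_ne_zero _ (hbne k)), one_smul]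
    rw [SetLike.mem_coe, this]
    exact Submodule.smul_mem _ _ (Submodule.subset_span ⟨k, rfl⟩)
  -- Replacing the coordinates of `f` by their approximations in `C` gives vectors of `P` itself;
  -- `Δ` is the error, so that `q' = f (1 + Δ)`.
  let q' : Fin (Module.finrank C P) → P := fun j => ∑ i, y (i, j) • F^[m] (q₀ i)
  let Δ : Matrix (Fin (Module.finrank C P)) (Fin (Module.finrank C P)) L := fun k j => ∑ i, (𝒟.σL ^ m) (e.repr (qL i) k) *
    (algebraMap C L (y (i, j)) - (𝒟.σL ^ m) (qL.repr (e j) i))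
  have hΔ : ∀ k j, 𝒟.Dvd 1 (Δ k j) := by
    intro k j
    refine Dvd.sum _ fun i _ => ?_
    obtain ⟨d, hd, h1⟩ := hy (i, j)
    have h2 := 𝒟.σL_pow_mem m (hc₀ k i)
    refine ⟨-((𝒟.σL ^ m) (p ^ c₀ * e.repr (qL i) k) * d), neg_mem (mul_mem h2 hd), ?_⟩
    rw [← neg_sub, h1, map_mul, map_pow, map_natCast]
    ring
  have hq' : ∀ j, (1 : L) ⊗ₜ[C] q' j = ∑ k, (1 + Δ) k j • f k := by
    intro j
    have h1 : ∀ i, (1 : L) ⊗ₜ[C] F^[m] (q₀ i) = ∑ k, (𝒟.σL ^ m) (e.repr (qL i) k) • f k := by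
      intro i
      rw [← frobL_iterate_tmul, ← hqL, ← e.sum_repr (qL i), frobL_iterate_sum, e.sum_repr (qL i)]
      exact Finset.sum_congr rfl fun k _ => by rw [heig, hfdef]
    have h2 : f j = ∑ i, (𝒟.σL ^ m) (qL.repr (e j) i) • (1 : L) ⊗ₜ[C] F^[m] (q₀ i) := by
      rw [hfdef, ← heig, ← qL.sum_repr (e j), frobL_iterate_sum, qL.sum_repr (e j)]
      exact Finset.sum_congr rfl fun k _ => by rw [← frobL_iterate_tmul, hqL]
    have h3 : ∑ k, (1 + Δ) k j • f k = f j + ∑ k, Δ k j • f k := by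
      simp [Matrix.add_apply, add_smul, Finset.sum_add_distrib, Matrix.one_apply]
    have h4 : ∑ k, Δ k j • f k = ∑ i, (algebraMap C L (y (i, j)) -
        (𝒟.σL ^ m) (qL.repr (e j) i)) • (1 : L) ⊗ₜ[C] F^[m] (q₀ i) := by
      simp only [Δ, Finset.sum_smul]
      rw [Finset.sum_comm]
      refine Finset.sum_congr rfl fun i _ => ?_
      rw [h1, Finset.smul_sum]
      exact Finset.sum_congr rfl fun k _ => by rw [smul_smul, mul_comm]
    rw [h3, h4]
    nth_rewrite 1 [h2]
    rw [← Finset.sum_add_distrib]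
    simp only [q', TensorProduct.tmul_sum]
    refine Finset.sum_congr rfl fun i _ => ?_
    rw [← add_smul, add_sub_cancel, TensorProduct.tmul_smul, algebraMap_smul]
  obtain ⟨T, hT, hT1⟩ := 𝒟.exists_inverse_one_add Δ hΔ
  have hf : ∀ k, f k = ∑ j, T j k • (1 : L) ⊗ₜ[C] q' j := by
    intro k
    simp only [hq', Finset.smul_sum, smul_smul]
    rw [Finset.sum_comm]
    have : ∀ x, ∑ y, (T y k * (1 + Δ) x y) • f x = ((1 + Δ) * T) x k • f x := by
      intro x
      rw [Matrix.mul_apply, Finset.sum_smul]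
      exact Finset.sum_congr rfl fun _ _ => by rw [mul_comm]
    simp only [this, hT1]
    simp [Matrix.one_apply]
  have hfF' : ∀ k, f k = (algebraMap C L (b k))⁻¹ •
      ∑ j, 𝒟.σL (T j k) • (1 : L) ⊗ₜ[C] F (q' j) := by
    intro k
    have := hfF k
    rw [hf, frobL_sum] at this
    simp only [frobL_tmul, map_one] at this
    rw [this, smul_smul, inv_mul_cancel₀ (hbne k), one_smul, ← hf]
  have hli1 : LinearIndependent L (fun i => (1 : L) ⊗ₜ[C] q' i) := by
    apply linearIndependent_tmul_of_span
    refine hfspan.trans (Submodule.span_le.2 ?_)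
    rintro _ ⟨k, rfl⟩
    rw [SetLike.mem_coe, hf]
    exact sum_mem fun j _ => Submodule.smul_mem _ _ (Submodule.subset_span ⟨j, rfl⟩)
  have hli2 : LinearIndependent L (fun i => (1 : L) ⊗ₜ[C] F (q' i)) := by
    apply linearIndependent_tmul_of_span
    refine hfspan.trans (Submodule.span_le.2 ?_)
    rintro _ ⟨k, rfl⟩
    rw [SetLike.mem_coe, hfF']
    exact Submodule.smul_mem _ _ (sum_mem fun j _ =>
      Submodule.smul_mem _ _ (Submodule.subset_span ⟨j, rfl⟩))
  have hr : Fintype.card (Fin (Module.finrank C P)) = Module.finrank C P := by simp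
  let q := Module.Basis.mk (linearIndependent_of_tmul _ hli1)
    ((linearIndependent_of_tmul _ hli1).span_eq_top_of_card_eq_finrank' hr).ge
  let qF := Module.Basis.mk (linearIndependent_of_tmul _ hli2)
    ((linearIndependent_of_tmul _ hli2).span_eq_top_of_card_eq_finrank' hr).ge
  have hq : ∀ i, q i = q' i := fun i => Module.Basis.mk_apply _ _ i
  have hqF : ∀ i, qF i = F (q' i) := fun i => Module.Basis.mk_apply _ _ i
  refine ⟨q, fun i j => qF.repr (a • q j) i, ?_, by simpa only [hq] using hli2, fun j => ?_⟩
  · intro i j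
    have h1 : (1 : L) ⊗ₜ[C] (a • q' j) =
        ∑ i, algebraMap C L (qF.repr (a • q j) i) • (1 : L) ⊗ₜ[C] F (q' i) := by
      rw [← hq, ← qF.sum_repr (a • q j), TensorProduct.tmul_sum, qF.sum_repr (a • q j)]
      refine Finset.sum_congr rfl fun i _ => ?_
      rw [TensorProduct.tmul_smul, hqF, algebraMap_smul]
    -- From `f = q' T` and `F f = b f` the matrix sought is `σ(T) · diag(a / b) · (1 + Δ)`, a
    -- product of integral matrices. This is where every eigenvalue must divide `a`.
    have h2 : (1 : L) ⊗ₜ[C] (a • q' j) = ∑ i, (∑ k, 𝒟.σL (T i k) *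
        (algebraMap C L a / algebraMap C L (b k) * (1 + Δ) k j)) • (1 : L) ⊗ₜ[C] F (q' i) := by
      rw [TensorProduct.tmul_smul, ← algebraMap_smul L, hq', Finset.smul_sum]
      simp only [Finset.sum_smul]
      rw [Finset.sum_comm]
      refine Finset.sum_congr rfl fun k _ => ?_
      nth_rewrite 1 [hfF']
      rw [Finset.smul_sum, Finset.smul_sum, Finset.smul_sum]
      refine Finset.sum_congr rfl fun i _ => ?_
      simp only [smul_smul]
      congr 1
      rw [div_eq_mul_inv]
      ring
    have h3 := Fintype.linearIndependent_iff.1 hli2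
      (fun i => algebraMap C L (qF.repr (a • q j) i) - ∑ k, 𝒟.σL (T i k) *
        (algebraMap C L a / algebraMap C L (b k) * (1 + Δ) k j))
      (by simp only [sub_smul, Finset.sum_sub_distrib]; rw [← h1, h2, sub_self]) i
    rw [sub_eq_zero] at h3
    rw [h3]
    refine sum_mem fun k _ => mul_mem (𝒟.σL_mem _ (hT i k)) (mul_mem (hb k).2.1 ?_)
    rw [Matrix.add_apply]
    refine add_mem ?_ (𝒟.dvd_zero_iff.1 ((hΔ k j).mono (Nat.zero_le _)))
    rw [Matrix.one_apply]
    split_ifs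
    exacts [one_mem _, zero_mem _]
  · conv_lhs => rw [← qF.sum_repr (a • q j)]
    exact Finset.sum_congr rfl fun i _ => by simp only [hqF, hq]

end

end PeriodDatum

/-! ### Frobenius equations, stable subspaces of `K`, integration along a flag. -/

namespace PeriodDatum

variable {p : ℕ} {C K L : Type u} [Field C] [Field K] [Field L] [Algebra C K]
    [Algebra K L] [Algebra C L] [IsScalarTower C K L] (𝒟 : PeriodDatum p C K L)

/-- Solutions in `L` of an integral system `V = H σ(V)` lie in `K`. -/
lemma exists_preimage_of_eq_sum {r : ℕ} (V : Fin r → L) (H : Fin r → Fin r → C)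
    (hH : ∀ i j, algebraMap C L (H i j) ∈ 𝒟.Lo)
    (hV : ∀ j, V j = ∑ i, algebraMap C L (H i j) * 𝒟.σL (V i)) (j : Fin r) :
    ∃ y : K, algebraMap K L y = V j := by
  -- The iterated equation keeps integral coefficients while σ^m(V) becomes close to `C`, so `V` is
  -- a limit of elements of `K`.
  have key : ∀ m : ℕ, ∃ H' : Fin r → Fin r → C, (∀ i j, algebraMap C L (H' i j) ∈ 𝒟.Lo) ∧
      ∀ j, V j = ∑ i, algebraMap C L (H' i j) * (𝒟.σL ^ m) (V i) := by
    intro m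
    induction m with
    | zero =>
      refine ⟨fun i j => if i = j then 1 else 0, fun i j => ?_, fun j => by simp⟩
      beta_reduce
      split_ifs
      · rw [map_one]; exact one_mem _
      · rw [map_zero]; exact zero_mem _
    | succ m ih =>
      obtain ⟨H', hH', h⟩ := ih
      refine ⟨fun i j => ∑ k, H k j * 𝒟.σC (H' i k), fun i j => ?_, fun j => ?_⟩
      · rw [map_sum]
        refine sum_mem fun k _ => ?_
        rw [map_mul, ← σL_algebraMap_C]
        exact mul_mem (hH _ _) (𝒟.σL_mem _ (hH' _ _))
      · conv_lhs => rw [hV]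
        have : ∀ k, algebraMap C L (H k j) * 𝒟.σL (V k) = ∑ i, algebraMap C L (H k j) *
            (𝒟.σL (algebraMap C L (H' i k)) * (𝒟.σL ^ (m + 1)) (V i)) := by
          intro k
          conv_lhs => rw [h k]
          rw [map_sum, Finset.mul_sum]
          refine Finset.sum_congr rfl fun i _ => ?_
          rw [map_mul, pow_succ', RingHom.coe_mul, Function.comp_apply]
        simp only [this]
        rw [Finset.sum_comm]
        refine Finset.sum_congr rfl fun i _ => ?_
        rw [map_sum, Finset.sum_mul]
        refine Finset.sum_congr rfl fun k _ => ?_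
        rw [map_mul, σL_algebraMap_C, mul_assoc]
  apply 𝒟.closed
  intro n
  obtain ⟨m, y, hy⟩ := 𝒟.dense_finite V n
  obtain ⟨H', hH', h⟩ := key m
  refine ⟨∑ i, algebraMap C K (H' i j * y i), ?_⟩
  have : V j - algebraMap K L (∑ i, algebraMap C K (H' i j * y i)) =
      ∑ i, algebraMap C L (H' i j) * ((𝒟.σL ^ m) (V i) - algebraMap C L (y i)) := by
    rw [h j, map_sum, ← Finset.sum_sub_distrib]
    refine Finset.sum_congr rfl fun i _ => ?_
    rw [← algebraMap_CL, map_mul, mul_sub]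
  rw [this]
  refine Dvd.sum _ fun i _ => ?_
  have h1 := (𝒟.dvd_zero_iff.2 (hH' i j)).mul (hy i)
  rwa [zero_add] at h1

/-- Solutions in `K` of an integral system `δ = s H σ(δ)` vanish. -/
lemma eq_zero_of_eq_sum {r : ℕ} (δ : Fin r → K) (H : Fin r → Fin r → C)
    (hH : ∀ i j, algebraMap C L (H i j) ∈ 𝒟.Lo)
    (hδ : ∀ j, δ j = ∑ i, algebraMap C K (H i j) * (algebraMap C K 𝒟.s * 𝒟.σK (δ i)))
    (j : Fin r) : δ j = 0 := by
  choose c hc using fun i => 𝒟.bounded (algebraMap K L (δ i))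
  obtain ⟨s, hs, hs1⟩ := 𝒟.s_ϖ
  obtain ⟨u, hu, hu1⟩ := 𝒟.σL_ϖ
  -- After denominators are cleared, each use of the equation gains a factor `ϖ` from `s`, and
  -- σ(ϖ^n) remains divisible by `ϖ ^ n`.
  have key : ∀ n i, ∃ x ∈ 𝒟.Lo, (p : L) ^ (∑ i, c i) * algebraMap K L (δ i) = 𝒟.ϖ ^ n * x := by
    intro n
    induction n with
    | zero =>
      intro i
      refine ⟨_, ?_, by rw [pow_zero, one_mul]⟩
      obtain ⟨d, hd⟩ := Nat.exists_eq_add_of_le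
        (Finset.single_le_sum (f := c) (fun _ _ => Nat.zero_le _) (Finset.mem_univ i))
      rw [hd, pow_add, mul_comm (_ ^ _), mul_assoc]
      exact mul_mem (pow_mem 𝒟.p_mem _) (hc i)
    | succ n ih =>
      intro i
      choose x hx h using ih
      refine ⟨∑ k, algebraMap C L (H k i) * (s * (u ^ n * 𝒟.σL (x k))),
        sum_mem fun k _ => mul_mem (hH _ _) (mul_mem hs
          (mul_mem (pow_mem hu _) (𝒟.σL_mem _ (hx k)))), ?_⟩
      rw [hδ i, map_sum, Finset.mul_sum, Finset.mul_sum]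
      refine Finset.sum_congr rfl fun k _ => ?_
      have h1 := congrArg 𝒟.σL (h k)
      rw [map_mul, map_mul, map_pow, map_pow, map_natCast, hu1, σL_algebraMap] at h1
      rw [map_mul, map_mul, ← algebraMap_CL, ← algebraMap_CL, hs1]
      linear_combination (algebraMap C L (H k i) * (𝒟.ϖ * s)) * h1
  have h0 : (p : L) ^ (∑ i, c i) * algebraMap K L (δ j) = 0 := by
    apply 𝒟.sep
    intro n
    obtain ⟨e, d, hd, he⟩ := 𝒟.ϖ_pow
    obtain ⟨x, hx, h⟩ := key (e * n) j
    refine ⟨d ^ n * x, mul_mem (pow_mem hd _) hx, ?_⟩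
    rw [h, pow_mul, he]
    ring
  rcases mul_eq_zero.1 h0 with h | h
  · exact absurd h (pow_ne_zero _ 𝒟.p_ne)
  · exact (map_eq_zero (algebraMap K L)).1 h

section

variable {P : Type u} [AddCommGroup P] [Module C P] (F : P →ₛₗ[𝒟.σC] P)

/-- A finite-dimensional subspace of `K` stable under `a σ`, with an eigenvector over `L` of
eigenvalue `a` of largest valuation that multiplies out to `1`, contains `1`. -/
lemma one_mem_of_eigenvector (Q : Submodule C K) [Module.Finite C Q] (G : Q →ₛₗ[𝒟.σC] Q) (a : C)
    (h : Submodule.span L (𝒟.eigenvectors G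
      {b | algebraMap C L a / algebraMap C L b ∈ 𝒟.Lo}) = ⊤)
    (w : L ⊗[C] Q) (hw : 𝒟.frobL G w = algebraMap C L a • w)
    (hw1 : ((Algebra.linearMap K L).restrictScalars C ∘ₗ Q.subtype).liftBaseChange L w = 1) :
    (1 : K) ∈ Q := by
  obtain ⟨q, H, hH, hli, hq⟩ := 𝒟.exists_good_basis G a h
  let qL := Algebra.TensorProduct.basis L q
  have hqL : ∀ i, qL i = (1 : L) ⊗ₜ q i := fun i => Algebra.TensorProduct.basis_apply q i
  have hsum : w = ∑ j, qL.repr w j • (1 : L) ⊗ₜ[C] q j := by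
    conv_lhs => rw [← qL.sum_repr w]
    simp only [hqL]
  -- Both sides of `F w = a w` are expanded in the independent vectors `F (q i)`, by means of `a q =
  -- H F(q)`; this yields an equation of the form that `retr_mem` requires.
  have hW : ∀ i, 𝒟.σL (qL.repr w i) = ∑ j, algebraMap C L (H i j) * qL.repr w j := by
    intro i
    have h1 : 𝒟.frobL G w = ∑ j, 𝒟.σL (qL.repr w j) • (1 : L) ⊗ₜ[C] G (q j) := by
      conv_lhs => rw [hsum]
      rw [frobL_sum]
      simp only [frobL_tmul, map_one]
    have h2 : algebraMap C L a • w =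
        ∑ i, (∑ j, algebraMap C L (H i j) * qL.repr w j) • (1 : L) ⊗ₜ[C] G (q i) := by
      conv_lhs => rw [hsum]
      rw [Finset.smul_sum]
      simp only [Finset.sum_smul]
      rw [Finset.sum_comm]
      refine Finset.sum_congr rfl fun j _ => ?_
      rw [smul_comm, algebraMap_smul, ← TensorProduct.tmul_smul, hq, TensorProduct.tmul_sum,
        Finset.smul_sum]
      refine Finset.sum_congr rfl fun i _ => ?_
      rw [TensorProduct.tmul_smul, ← algebraMap_smul L (H i j), smul_smul, mul_comm]
    have h3 := Fintype.linearIndependent_iff.1 hli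
      (fun i => 𝒟.σL (qL.repr w i) - ∑ j, algebraMap C L (H i j) * qL.repr w j)
      (by simp only [sub_smul, Finset.sum_sub_distrib]; rw [← h1, ← h2, hw, sub_self]) i
    rwa [sub_eq_zero] at h3
  choose x hx using 𝒟.retr_mem _ H hH hW
  -- The `q j` lie in `K`, so the `K`-linear `retr` acts only on the coordinates of `w`, which it
  -- sends into `C`.
  have h1 : 𝒟.retr (((Algebra.linearMap K L).restrictScalars C ∘ₗ Q.subtype).liftBaseChange L w)
      = ∑ j, x j • (q j : K) := by
    conv_lhs => rw [hsum]
    rw [map_sum, map_sum]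
    refine Finset.sum_congr rfl fun j _ => ?_
    rw [map_smul, LinearMap.liftBaseChange_tmul, one_smul, smul_eq_mul, mul_comm]
    change 𝒟.retr (algebraMap K L (q j : K) * _) = _
    rw [← Algebra.smul_def, map_smul, ← hx, smul_eq_mul, Algebra.smul_def (x j), mul_comm]
  rw [hw1, 𝒟.retr_one] at h1
  rw [h1]
  exact sum_mem fun j _ => Q.smul_mem _ (q j).2

/-- The map induced on a quotient by an additive map. -/
def quotD (N : Submodule C P) (D : P →+ P) (h : ∀ x ∈ N, D x ∈ N) : P ⧸ N →+ P ⧸ N :=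
  QuotientAddGroup.map N.toAddSubgroup N.toAddSubgroup D h

variable {F} in
lemma IsHorizontal.quot {D : P →+ P} (hD : 𝒟.IsHorizontal F D) (N : Submodule C P)
    (hF : ∀ x ∈ N, F x ∈ N) (h : ∀ x ∈ N, D x ∈ N) :
    𝒟.IsHorizontal (Submodule.mapQ N N F hF) (quotD N D h) where
  leibniz x m := by
    obtain ⟨m, rfl⟩ := N.mkQ_surjective m
    exact congrArg N.mkQ (hD.leibniz x m)
  horizontal m := by
    obtain ⟨m, rfl⟩ := N.mkQ_surjective m
    exact congrArg N.mkQ (hD.horizontal m)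

/-- The map induced on a stable submodule by an additive map. -/
def restrD (N : Submodule C P) (D : P →+ P) (h : ∀ x ∈ N, D x ∈ N) : N →+ N where
  toFun x := ⟨D x, h x x.2⟩
  map_zero' := Subtype.ext (map_zero D)
  map_add' x y := Subtype.ext (map_add D (x : P) y)

variable {F} in
lemma IsHorizontal.restr {D : P →+ P} (hD : 𝒟.IsHorizontal F D) (N : Submodule C P)
    (hF : ∀ x ∈ N, F x ∈ N) (h : ∀ x ∈ N, D x ∈ N) :
    𝒟.IsHorizontal (F.restrict hF) (restrD N D h) where
  leibniz x m := Subtype.ext (hD.leibniz x m)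
  horizontal m := Subtype.ext (hD.horizontal m)

lemma DC_mul (x y : C) : 𝒟.DC (x * y) = 𝒟.DC x * y + x * 𝒟.DC y := by
  apply (algebraMap C K).injective
  rw [← DK_algebraMap, map_mul, DK_mul, map_add, map_mul, map_mul, DK_algebraMap, DK_algebraMap]

lemma DK_smul (c : C) (z : K) : 𝒟.DK (c • z) = 𝒟.DC c • z + c • 𝒟.DK z := by
  rw [Algebra.smul_def, DK_mul, DK_algebraMap, Algebra.smul_def, Algebra.smul_def]

/-- A flag on a quotient by constants integrates. -/
lemma le_range_of_hasFlag (Q : Submodule C K) (D : Q →+ Q) (hD : ∀ x, (D x : K) = 𝒟.DK x)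
    (N : Submodule C Q) (hN : ∀ x ∈ N, ∃ c : C, algebraMap C K c = x)
    (G : (Q ⧸ N) →ₛₗ[𝒟.σC] (Q ⧸ N)) (h : ∀ x ∈ N, D x ∈ N)
    (hflag : 𝒟.HasFlag G (quotD N D h)) (x : Q) : ∃ c : C, algebraMap C K c = x := by
  obtain ⟨n, Fil, h0, hn, hstep⟩ := hflag
  have key : ∀ i ≤ n, ∀ x : Q, N.mkQ x ∈ Fil i → ∃ c : C, algebraMap C K c = x := by
    intro i
    induction i with
    | zero =>
      intro _ x hx
      rw [h0, Submodule.mem_bot, Submodule.mkQ_apply, Submodule.Quotient.mk_eq_zero] at hx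
      exact hN x hx
    | succ i ih =>
      intro hi x hx
      obtain ⟨q, b, hb, hq, hsup, hFq, hDq⟩ := hstep i hi
      obtain ⟨q, rfl⟩ := N.mkQ_surjective q
      rw [hsup, Submodule.mem_sup] at hx
      obtain ⟨y, hy, z, hz, hyz⟩ := hx
      obtain ⟨c, rfl⟩ := Submodule.mem_span_singleton.1 hz
      -- Both `x - c q` and the derivative of `q` lie one step lower, hence in `C`; then `integ`
      -- puts `q` itself into `C`.
      obtain ⟨c₁, hc₁⟩ := ih (by omega) (x - c • q) (by
        rw [map_sub, map_smul, ← hyz, add_sub_cancel_right]; exact hy)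
      obtain ⟨c₂, hc₂⟩ := ih (by omega) (D q) hDq
      rw [hD] at hc₂
      obtain ⟨c₃, hc₃⟩ := 𝒟.integ _ _ hc₂.symm
      refine ⟨c₁ + c * c₃, ?_⟩
      rw [map_add, map_mul, hc₁, hc₃]
      simp [Algebra.smul_def]
  exact key n le_rfl x (by rw [hn]; trivial)

end

end PeriodDatum

/-! ### The induction on the dimension. -/

namespace PeriodDatum

variable {p : ℕ} {C K L : Type u} [Field C] [Field K] [Field L] [Algebra C K]
    [Algebra K L] [Algebra C L] [IsScalarTower C K L] (𝒟 : PeriodDatum p C K L)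

section

variable {P : Type u} [AddCommGroup P] [Module C P] (F : P →ₛₗ[𝒟.σC] P)

/-- A flag on the kernel of a horizontal functional with values in `C` extends to a flag. -/
lemma HasFlag.of_ker {D : P →+ P} (v : P →ₗ[C] C) (a : C) (ha : a ∈ 𝒟.eig)
    (hF : ∀ u, v (F u) = a * 𝒟.σC (v u)) (hD : ∀ u, v (D u) = 𝒟.DC (v u)) (w : P) (hw : v w = 1)
    (hFK : ∀ x ∈ LinearMap.ker v, F x ∈ LinearMap.ker v)
    (hDK : ∀ x ∈ LinearMap.ker v, D x ∈ LinearMap.ker v)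
    (h : 𝒟.HasFlag (F.restrict hFK) (restrD _ D hDK)) : 𝒟.HasFlag F D := by
  obtain ⟨n, Fil, h0, hn, hstep⟩ := h
  have hD1 : 𝒟.DC 1 = 0 := by
    have := 𝒟.DC_mul 1 1
    simpa using this
  -- One last step, generated by `w`, is added above the kernel: `F w - a w` and `D w` are killed by
  -- `v` because `v w = 1` and 1 has derivative 0.
  refine ⟨n + 1, fun i => if i ≤ n then (Fil i).map (LinearMap.ker v).subtype else ⊤, ?_, ?_, ?_⟩
  · simp [h0]
  · simp
  · intro i hi
    have hi' : i ≤ n := by omega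
    simp only [hi', if_true]
    rcases hi'.lt_or_eq with h1 | rfl
    · obtain ⟨q, b, hb, hq, hsup, hFq, hDq⟩ := hstep i h1
      refine ⟨q, b, hb, ?_, ?_, ⟨_, hFq, rfl⟩, ⟨_, hDq, rfl⟩⟩
      · rintro ⟨y, hy, hyq⟩
        exact hq (by rwa [← Subtype.ext hyq])
      · rw [if_pos (by omega), hsup, Submodule.map_sup, Submodule.map_span, Set.image_singleton]
        rfl
    · rw [if_neg (by omega), hn, Submodule.map_top, Submodule.range_subtype]
      refine ⟨w, a, ha, ?_, ?_, ?_, ?_⟩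
      · rw [LinearMap.mem_ker, hw]
        exact one_ne_zero
      · symm
        rw [eq_top_iff]
        intro u _
        rw [Submodule.mem_sup]
        refine ⟨u - v u • w, ?_, v u • w, Submodule.smul_mem _ _
          (Submodule.mem_span_singleton_self w), sub_add_cancel _ _⟩
        rw [LinearMap.mem_ker, map_sub, map_smul, hw]
        simp
      · rw [LinearMap.mem_ker, map_sub, map_smul, hF, hw]
        simp
      · rw [LinearMap.mem_ker, hD, hw, hD1]

/-- Over `C`, a module with horizontal Frobenius that is spanned by eigenvectors over `L` is a
successive extension of horizontal eigenlines. -/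
theorem hasFlag_of_span_eigenvectors (n : ℕ) : ∀ (P : Type u) [AddCommGroup P] [Module C P]
    [Module.Finite C P] (_ : Module.finrank C P = n) (F : P →ₛₗ[𝒟.σC] P) (D : P →+ P)
    (_ : 𝒟.IsHorizontal F D) (_ : Submodule.span L (𝒟.eigenvectors F Set.univ) = ⊤),
    𝒟.HasFlag F D := by
  induction n using Nat.strong_induction_on with
  | _ n ih =>
  intro P _ _ _ hn F D hD hspan
  rcases Nat.eq_zero_or_pos n with rfl | hpos
  · have : Subsingleton P := Module.finrank_zero_iff.1 hn
    exact ⟨0, fun _ => ⊥, rfl, Subsingleton.elim _ _, by simp⟩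
  obtain ⟨e, b, hb⟩ := 𝒟.exists_eigenbasis F hspan
  have hne : Nonempty (Fin (Module.finrank C P)) := ⟨⟨0, by omega⟩⟩
  -- The valuation is multiplicative, with small values for highly divisible elements, so its
  -- minimum gives an eigenvalue divisible by all the others.
  obtain ⟨i₀, hi₀⟩ := Finite.exists_min fun i => 𝒟.Lo.valuation (algebraMap C L (b i))
  have hbne : ∀ i, algebraMap C L (b i) ≠ 0 := fun i =>
    (map_ne_zero _).2 (𝒟.eig_ne _ (hb i).1)
  set a := b i₀ with ha
  have haeig : a ∈ 𝒟.eig := (hb i₀).1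
  have hdiv : ∀ i, algebraMap C L a / algebraMap C L (b i) ∈ 𝒟.Lo := by
    intro i
    rw [← 𝒟.Lo.valuation_le_one_iff, map_div₀]
    exact div_le_one_of_le₀ (hi₀ i) zero_le
  have hspan' : Submodule.span L (𝒟.eigenvectors F
      {b | algebraMap C L a / algebraMap C L b ∈ 𝒟.Lo}) = ⊤ := by
    rw [eq_top_iff, ← e.span_eq]
    refine Submodule.span_mono ?_
    rintro _ ⟨i, rfl⟩
    exact ⟨b i, (hb i).1, hdiv i, (hb i).2.2⟩
  -- the functional
  let v : P →ₗ[C] L := (e.coord i₀).restrictScalars C ∘ₗ (TensorProduct.mk C L P 1)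
  have hv : ∀ u, v u = e.coord i₀ ((1 : L) ⊗ₜ u) := fun u => rfl
  have hcoord : ∀ z, e.coord i₀ (𝒟.frobL F z) = algebraMap C L a * 𝒟.σL (e.coord i₀ z) := by
    intro z
    conv_lhs => rw [← e.sum_repr z]
    rw [frobL_sum, map_sum]
    simp only [(hb _).2.2, map_smul, Module.Basis.coord_apply, Module.Basis.repr_self, smul_eq_mul]
    rw [Finset.sum_eq_single i₀]
    · simp [ha, mul_comm]
    · intro j _ hj
      simp [Finsupp.single_eq_of_ne' hj]
    · simp
  have hvF : ∀ u, v (F u) = algebraMap C L a * 𝒟.σL (v u) := by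
    intro u
    rw [hv, hv, ← hcoord, frobL_tmul, map_one]
  obtain ⟨q, H, hH, hli, hq⟩ := 𝒟.exists_good_basis F a hspan'
  have hane : algebraMap C L a ≠ 0 := hbne i₀
  -- Applying `v` to `a q = H F(q)` and cancelling `a` gives v(q) = Hσ(v(q)).
  have hVK : ∀ j, ∃ y : K, algebraMap K L y = v (q j) := by
    apply 𝒟.exists_preimage_of_eq_sum _ H hH
    intro j
    apply mul_left_cancel₀ hane
    have := congrArg v (hq j)
    rw [map_smul, map_sum, Algebra.smul_def] at this
    rw [this, Finset.mul_sum]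
    refine Finset.sum_congr rfl fun i _ => ?_
    rw [map_smul, Algebra.smul_def, hvF]
    ring
  choose y hy using hVK
  let vK : P →ₗ[C] K := q.constr C y
  have hvK : ∀ u, algebraMap K L (vK u) = v u := by
    intro u
    have : (Algebra.linearMap K L).restrictScalars C ∘ₗ vK = v := by
      apply q.ext
      intro j
      simp [vK, hy]
    exact LinearMap.congr_fun this u
  have hvKF : ∀ u, vK (F u) = algebraMap C K a * 𝒟.σK (vK u) := by
    intro u
    apply (algebraMap K L).injective
    rw [hvK, hvF, map_mul, ← σL_algebraMap, hvK, ← algebraMap_CL]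
  have hvKD : ∀ u, vK (D u) = 𝒟.DK (vK u) := by
    -- The derivative terms of the two Leibniz rules cancel, so the defect of horizontality is
    -- linear and need only vanish on the basis `q`.
    let δ : P →ₗ[C] K :=
      { toFun := fun u => vK (D u) - 𝒟.DK (vK u)
        map_add' := fun x y => by simp only [map_add]; ring
        map_smul' := fun c x => by
          rw [hD.leibniz, map_add, map_smul, map_smul, map_smul, DK_smul, RingHom.id_apply,
            smul_sub]
          ring }
    have hδF : ∀ u, δ (F u) = algebraMap C K a * (algebraMap C K 𝒟.s * 𝒟.σK (δ u)) := by
      intro u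
      change vK (D (F u)) - 𝒟.DK (vK (F u)) = _ * (_ * 𝒟.σK (vK (D u) - 𝒟.DK (vK u)))
      rw [hD.horizontal, map_smul, hvKF, hvKF, DK_mul, DK_algebraMap, 𝒟.DC_eig a haeig, map_zero,
        zero_mul, zero_add, 𝒟.DK_σK, map_sub, Algebra.smul_def]
      ring
    have h0 : ∀ j, δ (q j) = 0 := by
      apply 𝒟.eq_zero_of_eq_sum _ H hH
      intro j
      apply mul_left_cancel₀ ((map_ne_zero (algebraMap C K)).2 (𝒟.eig_ne _ haeig))
      have := congrArg δ (hq j)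
      rw [map_smul, map_sum, Algebra.smul_def] at this
      rw [this, Finset.mul_sum]
      refine Finset.sum_congr rfl fun i _ => ?_
      rw [map_smul, Algebra.smul_def, hδF]
      ring
    have hδ : δ = 0 := q.ext fun j => by rw [h0]; rfl
    intro u
    exact sub_eq_zero.1 (LinearMap.congr_fun hδ u)
  -- the image
  let Q : Submodule C K := LinearMap.range vK
  have hGQ : ∀ x ∈ Q, algebraMap C K a * 𝒟.σK x ∈ Q := by
    rintro _ ⟨u, rfl⟩
    exact ⟨F u, hvKF u⟩
  have hDQ : ∀ x ∈ Q, 𝒟.DK x ∈ Q := by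
    rintro _ ⟨u, rfl⟩
    exact ⟨D u, hvKD u⟩
  let G : Q →ₛₗ[𝒟.σC] Q :=
    { toFun := fun x => ⟨algebraMap C K a * 𝒟.σK x, hGQ x x.2⟩
      map_add' := fun x y => Subtype.ext (by
        change algebraMap C K a * 𝒟.σK ((x : K) + y) = _ * _ + _ * _
        rw [map_add, mul_add])
      map_smul' := fun c x => Subtype.ext (by
        change algebraMap C K a * 𝒟.σK (c • (x : K)) = 𝒟.σC c • (_ * _)
        rw [Algebra.smul_def, map_mul, σK_algebraMap, Algebra.smul_def]
        ring) }
  let DQ : Q →+ Q :=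
    { toFun := fun x => ⟨𝒟.DK x, hDQ x x.2⟩
      map_zero' := Subtype.ext (map_zero 𝒟.DK)
      map_add' := fun x y => Subtype.ext (map_add 𝒟.DK (x : K) y) }
  let f : P →ₗ[C] Q := vK.rangeRestrict
  have hf : ∀ u, f (F u) = G (f u) := fun u => Subtype.ext (hvKF u)
  have hfsurj : Function.Surjective f := LinearMap.surjective_rangeRestrict vK
  have hQspan := 𝒟.span_eigenvectors_of_surjective F G f hfsurj hf hspan'
  have hw : 𝒟.frobL G (f.baseChange L (e i₀)) = algebraMap C L a • f.baseChange L (e i₀) := by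
    rw [𝒟.frobL_map F G f hf, (hb i₀).2.2, map_smul]
  -- Multiplying out the image of `z` in L ⊗ Q recovers its coordinate along `e i₀`; for `e i₀`
  -- itself this is 1.
  have hmul : ∀ z, ((Algebra.linearMap K L).restrictScalars C ∘ₗ Q.subtype).liftBaseChange L
      (f.baseChange L z) = e.coord i₀ z := by
    intro z
    induction z with
    | zero => simp
    | tmul x u =>
      rw [LinearMap.baseChange_tmul, LinearMap.liftBaseChange_tmul]
      change x • algebraMap K L (vK u) = _
      rw [hvK, hv, ← map_smul, TensorProduct.smul_tmul', smul_eq_mul, mul_one]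
    | add x y hx hy => rw [map_add, map_add, hx, hy, map_add]
  have h1Q : (1 : K) ∈ Q := 𝒟.one_mem_of_eigenvector Q G a hQspan _ hw (by
    rw [hmul]; simp)
  -- the quotient by the constants
  let N : Submodule C Q := Submodule.span C {⟨1, h1Q⟩}
  have hNmem : ∀ x ∈ N, ∃ c : C, algebraMap C K c = x := by
    intro x hx
    obtain ⟨c, rfl⟩ := Submodule.mem_span_singleton.1 hx
    exact ⟨c, by simp [Algebra.smul_def]⟩
  have hNmem' : ∀ (x : Q) (c : C), (x : K) = algebraMap C K c → x ∈ N := by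
    intro x c hx
    exact Submodule.mem_span_singleton.2 ⟨c, Subtype.ext (by
      rw [hx]
      change c • (1 : K) = _
      rw [Algebra.smul_def, mul_one])⟩
  have hGN : ∀ x ∈ N, G x ∈ N := by
    intro x hx
    obtain ⟨c, hc⟩ := hNmem x hx
    refine hNmem' _ (a * 𝒟.σC c) ?_
    change algebraMap C K a * 𝒟.σK x = _
    rw [← hc, σK_algebraMap, map_mul]
  have hDN : ∀ x ∈ N, DQ x ∈ N := by
    intro x hx
    obtain ⟨c, hc⟩ := hNmem x hx
    refine hNmem' _ (𝒟.DC c) ?_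
    change 𝒟.DK x = _
    rw [← hc, DK_algebraMap]
  have hQhor : 𝒟.IsHorizontal G DQ :=
    { leibniz := fun c x => Subtype.ext (𝒟.DK_smul c (x : K))
      horizontal := fun x => Subtype.ext (by
        change 𝒟.DK (algebraMap C K a * 𝒟.σK x) = 𝒟.s • (algebraMap C K a * 𝒟.σK (𝒟.DK x))
        rw [DK_mul, DK_algebraMap, 𝒟.DC_eig a haeig, map_zero, zero_mul, zero_add, 𝒟.DK_σK,
          Algebra.smul_def]
        ring) }
  have hNne : (⟨1, h1Q⟩ : Q) ≠ 0 := fun h => one_ne_zero (congrArg Subtype.val h)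
  have hQdim : Module.finrank C Q ≤ Module.finrank C P := LinearMap.finrank_range_le vK
  have hNdim : Module.finrank C N = 1 := finrank_span_singleton hNne
  have hdim := Submodule.finrank_quotient_add_finrank N
  -- Removing the line `N` makes the dimension strictly smaller than that of `P`, even if `Q` is as
  -- large as `P`.
  have hflagQ : 𝒟.HasFlag (Submodule.mapQ N N G hGN) (quotD N DQ hDN) := by
    refine ih (Module.finrank C (Q ⧸ N)) (by omega) _ rfl _ _ (hQhor.quot 𝒟 N hGN hDN) ?_
    refine 𝒟.span_eigenvectors_of_surjective G _ N.mkQ N.mkQ_surjective (fun _ => rfl) ?_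
    refine 𝒟.span_eigenvectors_of_surjective F G f hfsurj hf hspan
  have hQC := 𝒟.le_range_of_hasFlag Q DQ (fun _ => rfl) N hNmem _ hDN hflagQ
  -- the kernel
  have hrange : ∀ u, ∃ c : C, algebraMap C K c = vK u := fun u => hQC ⟨vK u, u, rfl⟩
  choose vC₀ hvC₀ using hrange
  let vC : P →ₗ[C] C :=
    { toFun := vC₀
      map_add' := fun x y => (algebraMap C K).injective (by
        rw [hvC₀, map_add, map_add, hvC₀, hvC₀])
      map_smul' := fun c x => (algebraMap C K).injective (by
        rw [hvC₀, RingHom.id_apply, smul_eq_mul, map_mul, hvC₀, map_smul, Algebra.smul_def]) }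
  have hvC : ∀ u, algebraMap C K (vC u) = vK u := hvC₀
  have hvCF : ∀ u, vC (F u) = a * 𝒟.σC (vC u) := fun u => (algebraMap C K).injective (by
    rw [hvC, hvKF, map_mul, ← σK_algebraMap, hvC])
  have hvCD : ∀ u, vC (D u) = 𝒟.DC (vC u) := fun u => (algebraMap C K).injective (by
    rw [hvC, hvKD, ← DK_algebraMap, hvC])
  obtain ⟨w, hw1⟩ := h1Q
  have hwC : vC w = 1 := (algebraMap C K).injective (by rw [hvC, hw1, map_one])
  have hFK : ∀ x ∈ LinearMap.ker vC, F x ∈ LinearMap.ker vC := by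
    intro x hx
    rw [LinearMap.mem_ker] at hx ⊢
    rw [hvCF, hx, map_zero, mul_zero]
  have hDK : ∀ x ∈ LinearMap.ker vC, D x ∈ LinearMap.ker vC := by
    intro x hx
    rw [LinearMap.mem_ker] at hx ⊢
    rw [hvCD, hx, map_zero]
  refine HasFlag.of_ker 𝒟 F vC a haeig hvCF hvCD w hwC hFK hDK ?_
  have hkerdim : Module.finrank C (LinearMap.ker vC) < Module.finrank C P := by
    apply Submodule.finrank_lt
    rw [ne_eq, LinearMap.ker_eq_top]
    intro h
    rw [h] at hwC
    simp at hwC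
  refine ih _ (by omega) _ rfl _ _ (hD.restr 𝒟 _ hFK hDK) ?_
  set ι := (LinearMap.ker vC).subtype.baseChange L with hι
  have hinj : Function.Injective ι :=
    Module.Flat.lTensor_preserves_injective_linearMap (M := L) _
      (LinearMap.ker vC).injective_subtype
  have hιF : ∀ z, 𝒟.frobL F (ι z) = ι (𝒟.frobL (F.restrict hFK) z) :=
    𝒟.frobL_map _ F (LinearMap.ker vC).subtype (fun _ => rfl)
  -- L ⊗ P is the sum of L ⊗ ker and the line of `w`, the second component being the coordinate
  -- along `e i₀`; so the other `e i` come from the kernel.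
  have hdec : ∀ z, ∃ z', z = ι z' + e.coord i₀ z • (1 : L) ⊗ₜ[C] w := by
    intro z
    induction z with
    | zero => exact ⟨0, by simp⟩
    | tmul x u =>
      have hu : u - vC u • w ∈ LinearMap.ker vC := by
        rw [LinearMap.mem_ker, map_sub, map_smul, hwC]
        simp
      refine ⟨x ⊗ₜ ⟨_, hu⟩, ?_⟩
      have h1 : e.coord i₀ (x ⊗ₜ[C] u) = x * algebraMap C L (vC u) := by
        rw [algebraMap_CL (K := K), hvC, hvK, hv, ← smul_eq_mul, ← map_smul,
          TensorProduct.smul_tmul', smul_eq_mul, mul_one]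
      rw [h1, hι, LinearMap.baseChange_tmul, Submodule.subtype_apply, TensorProduct.tmul_sub,
        TensorProduct.tmul_smul, TensorProduct.smul_tmul', TensorProduct.smul_tmul',
        smul_eq_mul, mul_one, Algebra.smul_def, mul_comm x]
      simp
    | add x y hx hy =>
      obtain ⟨x', hx⟩ := hx
      obtain ⟨y', hy⟩ := hy
      refine ⟨x' + y', ?_⟩
      rw [map_add, map_add, add_smul]
      nth_rewrite 1 [hx, hy]
      abel
  have hpre : ∀ i, i ≠ i₀ → ∃ z, ι z = e i := by
    intro i hi
    obtain ⟨z, hz⟩ := hdec (e i)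
    refine ⟨z, ?_⟩
    rw [hz]
    simp [Finsupp.single_eq_of_ne' hi]
  rw [eq_top_iff]
  intro z _
  have h0 : e.coord i₀ (ι z) = 0 := by
    clear * - hvK hv hvC hι
    induction z with
    | zero => simp
    | tmul x u =>
      rw [hι, LinearMap.baseChange_tmul, Submodule.subtype_apply]
      have : (x ⊗ₜ[C] (u : P) : L ⊗[C] P) = x • (1 : L) ⊗ₜ (u : P) := by
        rw [TensorProduct.smul_tmul', smul_eq_mul, mul_one]
      rw [this, map_smul, ← hv, ← hvK, ← hvC, show vC (u : P) = 0 from u.2]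
      simp
    | add x y hx hy => rw [map_add, map_add, hx, hy, add_zero]
  choose! g hg using hpre
  -- Elements of L ⊗ ker have no component along `e i₀`, hence are combinations of the preimages `g
  -- i` of the other eigenvectors.
  have hz : z = ∑ i ∈ Finset.univ.erase i₀, e.repr (ι z) i • g i := by
    apply hinj
    rw [map_sum]
    conv_lhs => rw [← e.sum_repr (ι z)]
    rw [← Finset.add_sum_erase _ _ (Finset.mem_univ i₀)]
    rw [show e.repr (ι z) i₀ = 0 from h0, zero_smul, zero_add]
    refine Finset.sum_congr rfl fun i hi => ?_
    rw [map_smul, hg i (Finset.ne_of_mem_erase hi)]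
  rw [hz]
  refine sum_mem fun i hi => Submodule.smul_mem _ _ (Submodule.subset_span ?_)
  refine ⟨b i, (hb i).1, trivial, hinj ?_⟩
  rw [← hιF, map_smul, hg i (Finset.ne_of_mem_erase hi), (hb i).2.2]

end

end PeriodDatum

/-! ### `p`-adically complete rings -/

section Complete

variable (p : ℕ) {R : Type u} [CommRing R]

lemma smodEq_iff_dvd (n : ℕ) (x y : R) :
    x ≡ y [SMOD ((Ideal.span {(p : R)}) ^ n • ⊤ : Submodule R R)] ↔ (p : R) ^ n ∣ x - y := by
  rw [SModEq.sub_mem, mem_pow_iff]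

lemma exists_limit [IsAdicComplete (Ideal.span {(p : R)}) R] (f : ℕ → R)
    (h : ∀ n, (p : R) ^ n ∣ f (n + 1) - f n) : ∃ l, ∀ n, (p : R) ^ n ∣ l - f n := by
  have key : ∀ m n, m ≤ n → (p : R) ^ m ∣ f n - f m := by
    intro m n hmn
    induction n, hmn using Nat.le_induction with
    | base => simp
    | succ n hn ih =>
      have := dvd_add (dvd_trans (pow_dvd_pow _ hn) (h n)) ih
      rwa [sub_add_sub_cancel] at this
  obtain ⟨l, hl⟩ := IsPrecomplete.prec' (I := Ideal.span {(p : R)}) f (fun {m n} hmn => by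
    rw [smodEq_iff_dvd, ← neg_sub, dvd_neg]
    exact key m n hmn)
  refine ⟨l, fun n => ?_⟩
  have := (smodEq_iff_dvd p n _ _).1 (hl n)
  rwa [← neg_sub, dvd_neg] at this

lemma eq_zero_of_forall_pow_dvd [IsAdicComplete (Ideal.span {(p : R)}) R] {x : R}
    (h : ∀ n, (p : R) ^ n ∣ x) : x = 0 := by
  apply IsHausdorff.haus' (I := Ideal.span {(p : R)})
  intro n
  rw [smodEq_iff_dvd, sub_zero]
  exact h n

lemma isUnit_one_add_of_dvd [IsAdicComplete (Ideal.span {(p : R)}) R] {x : R}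
    (h : (p : R) ∣ x) : IsUnit (1 + x) := by
  have := IsAdicComplete.le_jacobson_bot (Ideal.span {(p : R)})
    (Ideal.mem_span_singleton.2 h)
  have := Ideal.mem_jacobson_bot.1 this 1
  rwa [mul_one, add_comm] at this

instance PComp.isAdicComplete :
    IsAdicComplete (Ideal.span {(p : PComp p R)}) (PComp p R) := by
  have h := (IsAdicComplete.map_algebraMap_iff (Ideal.span {(p : R)}) (S := PComp p R)
    (M := PComp p R)).2 (AdicCompletion.isAdicComplete ⟨{(p : R)}, by simp⟩)
  rwa [Ideal.map_span, Set.image_singleton, map_natCast] at h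

/-- The ideal is finitely generated, so the kernel of evaluation at level `n` is generated by its
`n`-th power. This lets the rest of the proof speak of divisibility only. -/
lemma PComp.val_eq_zero_iff (n : ℕ) (x : PComp p R) : x.val n = 0 ↔ (p : PComp p R) ^ n ∣ x := by
  have h := AdicCompletion.pow_smul_top_eq_ker_eval (I := Ideal.span {(p : R)}) (M := R) (n := n)
    ⟨{(p : R)}, by simp⟩
  have h1 : x.val n = 0 ↔ x ∈ (AdicCompletion.eval (Ideal.span {(p : R)}) R n).ker := Iff.rfl
  rw [h1, ← h, Ideal.span_singleton_pow, Submodule.ideal_span_singleton_smul,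
    Submodule.mem_smul_pointwise_iff_exists]
  constructor
  · rintro ⟨y, _, rfl⟩
    exact ⟨y, by rw [Algebra.smul_def, map_pow, map_natCast]⟩
  · rintro ⟨y, rfl⟩
    exact ⟨y, trivial, by rw [Algebra.smul_def, map_pow, map_natCast]⟩

lemma PComp.mk_eq_val_iff (n : ℕ) (x : PComp p R) (y : R) :
    Submodule.mkQ _ y = x.val n ↔ (p : PComp p R) ^ n ∣ x - algebraMap R (PComp p R) y := by
  rw [← PComp.val_eq_zero_iff, AdicCompletion.val_sub_apply, sub_eq_zero, eq_comm]
  rfl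

lemma PComp.exists_dvd_sub (n : ℕ) (x : PComp p R) :
    ∃ y : R, (p : PComp p R) ^ n ∣ x - algebraMap R (PComp p R) y := by
  obtain ⟨y, hy⟩ := Submodule.mkQ_surjective _ (x.val n)
  exact ⟨y, (PComp.mk_eq_val_iff p n x y).1 hy⟩

lemma PComp.pow_dvd_algebraMap_iff (n : ℕ) (y : R) :
    (p : PComp p R) ^ n ∣ algebraMap R (PComp p R) y ↔ (p : R) ^ n ∣ y := by
  rw [← PComp.val_eq_zero_iff, ← mem_pow_iff]
  exact Submodule.Quotient.mk_eq_zero _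

/-- The limit in a `p`-adically complete ring of an element of its completion. -/
def PComp.lim [IsAdicComplete (Ideal.span {(p : R)}) R] : PComp p R →+ R :=
  ((AdicCompletion.ofLinearEquiv (Ideal.span {(p : R)}) R).symm : PComp p R →ₗ[R] R).toAddMonoidHom

lemma PComp.algebraMap_lim [IsAdicComplete (Ideal.span {(p : R)}) R] (x : PComp p R) :
    algebraMap R (PComp p R) (PComp.lim p x) = x :=
  (AdicCompletion.ofLinearEquiv (Ideal.span {(p : R)}) R).apply_symm_apply x

lemma PComp.lim_algebraMap [IsAdicComplete (Ideal.span {(p : R)}) R] (x : R) :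
    PComp.lim p (algebraMap R (PComp p R) x) = x :=
  (AdicCompletion.ofLinearEquiv (Ideal.span {(p : R)}) R).symm_apply_apply x

lemma PComp.mapAdd_algebraMap {S : Type v} [CommRing S] (g : R →+ S) (x : R) :
    PComp.mapAdd p g (algebraMap R (PComp p R) x) = algebraMap S (PComp p S) (g x) := rfl

lemma AddMonoidHom.natCast_pow_mul {A B : Type*} [CommRing A] [CommRing B] (g : A →+ B) (n : ℕ)
    (x : A) : g ((p : A) ^ n * x) = (p : B) ^ n * g x := by
  have e1 : (p : A) ^ n * x = (p ^ n) • x := by rw [nsmul_eq_mul]; push_cast; rfl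
  have e2 : (p : B) ^ n * g x = (p ^ n) • g x := by rw [nsmul_eq_mul]; push_cast; rfl
  rw [e1, e2, map_nsmul]

lemma dvd_map_sub {A B : Type*} [CommRing A] [CommRing B] (g : A →+ B) {n : ℕ} {x y : A}
    (h : (p : A) ^ n ∣ x - y) : (p : B) ^ n ∣ g x - g y := by
  rw [← map_sub]
  exact pow_dvd_map p g n h

/-- A module-finite algebra over a `p`-adically complete ring which is a Noetherian domain in which
`p` is not invertible is `p`-adically complete. -/
lemma isAdicComplete_of_finite {S : Type v} [CommRing S] [IsDomain S] [IsNoetherianRing S]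
    [Algebra R S] [Module.Finite R S] [IsAdicComplete (Ideal.span {(p : R)}) R]
    (hp : ¬ IsUnit (p : S)) : IsAdicComplete (Ideal.span {(p : S)}) S where
  toIsHausdorff := IsHausdorff.of_isDomain _ (by rwa [ne_eq, Ideal.span_singleton_eq_top])
  toIsPrecomplete := by
    constructor
    intro f hf
    have hf' : ∀ n, ∃ y, f (n + 1) - f n = (p : S) ^ n * y := by
      intro n
      have := (smodEq_iff_dvd p n _ _).1 (hf (Nat.le_succ n))
      rw [← neg_sub, dvd_neg] at this
      exact this
    choose y hy using hf'
    -- The differences `p ^ n * y n` are lifted along a surjection R^r → S, and the lifted series is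
    -- summed coordinatewise in `R`.
    obtain ⟨r, g, hg⟩ := Module.Finite.exists_fin' R S
    choose z hz using fun n => hg (y n)
    obtain ⟨z₀, hz₀⟩ := hg (f 0)
    let F : ℕ → Fin r → R := fun n => z₀ + ∑ i ∈ Finset.range n, (p : R) ^ i • z i
    have hgF : ∀ n, g (F n) = f n := by
      intro n
      induction n with
      | zero => simp [F, hz₀]
      | succ n ih =>
        have : F (n + 1) = F n + (p : R) ^ n • z n := by
          simp only [F, Finset.sum_range_succ, add_assoc]
        rw [this, map_add, ih, map_smul, hz, Algebra.smul_def, map_pow, map_natCast, ← hy]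
        ring
    choose l hl using fun j => exists_limit p (fun n => F n j) (fun n => by
      simp only [F, Finset.sum_range_succ, ← add_assoc, Pi.add_apply, add_sub_cancel_left]
      exact ⟨z n j, rfl⟩)
    refine ⟨g l, fun n => ?_⟩
    rw [smodEq_iff_dvd, ← neg_sub, dvd_neg, ← hgF, ← map_sub]
    choose m hm using fun j => hl j n
    have : l - F n = (p : R) ^ n • m := funext fun j => hm j
    rw [this, map_smul, Algebra.smul_def, map_pow, map_natCast]
    exact dvd_mul_right _ _

end Complete

/-! ### Coefficients -/

section Coeff

variable (p : ℕ) {O : Type u} [CommRing O] [IsAdicComplete (Ideal.span {(p : O)}) O]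

/-- The coefficients of an element of `Γ`. -/
def cf (i : ℤ) : Gam p O →+ O := (PComp.lim p).comp (Gam.coeff p O i)

variable {p}

lemma cf_of (i : ℤ) (y : O⸨X⸩) : cf p i (Gam.of p O y) = y.coeff i :=
  PComp.lim_algebraMap p _

lemma coeff_val_eq_zero_iff_cf (i : ℤ) (n : ℕ) (x : Gam p O) :
    (Gam.coeff p O i x).val n = 0 ↔ (p : O) ^ n ∣ cf p i x := by
  rw [PComp.val_eq_zero_iff, ← PComp.pow_dvd_algebraMap_iff p n (cf p i x)]
  change _ ↔ _ ∣ algebraMap O (PComp p O) (PComp.lim p _)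
  rw [PComp.algebraMap_lim]

lemma Gam.exists_dvd_sub (n : ℕ) (x : Gam p O) :
    ∃ y : O⸨X⸩, (p : Gam p O) ^ n ∣ x - Gam.of p O y := PComp.exists_dvd_sub p n x

lemma dvd_cf_sub {n : ℕ} {x : Gam p O} {y : O⸨X⸩} (h : (p : Gam p O) ^ n ∣ x - Gam.of p O y)
    (i : ℤ) : (p : O) ^ n ∣ cf p i x - y.coeff i := by
  rw [← cf_of (p := p)]
  exact dvd_map_sub p _ h

/-- The coefficients tend to zero `p`-adically at `-∞`. -/
lemma exists_forall_dvd_cf (n : ℕ) (x : Gam p O) : ∃ b : ℤ, ∀ i < b, (p : O) ^ n ∣ cf p i x := by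
  obtain ⟨y, hy⟩ := Gam.exists_dvd_sub n x
  refine ⟨y.order, fun i hi => ?_⟩
  have := dvd_cf_sub hy i
  rwa [HahnSeries.coeff_eq_zero_of_lt_order hi, sub_zero] at this

/-- Laurent series with given coefficients. -/
def laurentMk (f : ℤ → O) (b : ℤ) (h : ∀ i < b, f i = 0) : O⸨X⸩ :=
  HahnSeries.ofSuppBddBelow f ⟨b, fun i hi => not_lt.1 fun hib => hi (h i hib)⟩

lemma laurentMk_coeff (f : ℤ → O) (b : ℤ) (h : ∀ i < b, f i = 0) (i : ℤ) :
    (laurentMk f b h).coeff i = f i := rfl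

lemma laurent_dvd (a : O) (y : O⸨X⸩) (h : ∀ i, a ∣ y.coeff i) :
    ∃ z, y = HahnSeries.C a * z := by
  classical
  choose z hz using h
  -- The chosen quotients are reset to 0 below the order of `y`: when `a` is a zero divisor they
  -- need not vanish there.
  refine ⟨laurentMk (fun i => if i < y.order then 0 else z i) y.order (by
    intro i hi; simp [hi]), ?_⟩
  ext i
  rw [HahnSeries.C_mul_eq_smul, HahnSeries.coeff_smul, laurentMk_coeff, smul_eq_mul]
  split_ifs with hi
  · rw [HahnSeries.coeff_eq_zero_of_lt_order hi, mul_zero]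
  · exact hz i

lemma natCast_pow_dvd_laurent (n : ℕ) (y : O⸨X⸩) (h : ∀ i, (p : O) ^ n ∣ y.coeff i) :
    (p : O⸨X⸩) ^ n ∣ y := by
  obtain ⟨z, rfl⟩ := laurent_dvd _ y h
  rw [map_pow, map_natCast]
  exact dvd_mul_right _ _

/-- A Laurent series approximating `x` modulo `p ^ n` has all coefficients divisible by `p ^ n`, and
can be divided coefficientwise. The p-adic topology of Γ is thus that of uniform convergence of
coefficients. -/
lemma natCast_pow_dvd_iff_cf (n : ℕ) (x : Gam p O) :
    (p : Gam p O) ^ n ∣ x ↔ ∀ i, (p : O) ^ n ∣ cf p i x := by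
  refine ⟨fun h i => pow_dvd_map p _ n h, fun h => ?_⟩
  obtain ⟨y, hy⟩ := Gam.exists_dvd_sub n x
  have h1 : (p : O⸨X⸩) ^ n ∣ y := by
    refine natCast_pow_dvd_laurent n y fun i => ?_
    have := dvd_sub (h i) (dvd_cf_sub hy i)
    rwa [sub_sub_cancel] at this
  have h2 := (PComp.pow_dvd_algebraMap_iff p n y).2 h1
  have := dvd_add hy h2
  rwa [show algebraMap O⸨X⸩ (PComp p O⸨X⸩) y = Gam.of p O y from rfl, sub_add_cancel] at this

lemma Gam.ext_cf {x y : Gam p O} (h : ∀ i, cf p i x = cf p i y) : x = y := by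
  rw [← sub_eq_zero]
  apply eq_zero_of_forall_pow_dvd p
  intro n
  rw [natCast_pow_dvd_iff_cf]
  intro i
  rw [map_sub, h, sub_self]
  exact dvd_zero _

/-- The element of `Γ` with given coefficients. -/
lemma exists_gam (f : ℤ → O) (h : ∀ n : ℕ, ∃ b : ℤ, ∀ i < b, (p : O) ^ n ∣ f i) :
    ∃ x : Gam p O, ∀ i, cf p i x = f i := by
  classical
  choose b hb using h
  -- Only coefficients divisible by `p ^ n` are dropped from `F n`, so these Laurent series form a
  -- p-adic Cauchy sequence.
  let F : ℕ → Gam p O := fun n => Gam.of p O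
    (laurentMk (fun i => if i < b n then 0 else f i) (b n) (by intro i hi; simp [hi]))
  have hF : ∀ n i, (p : O) ^ n ∣ cf p i (F n) - f i := by
    intro n i
    rw [cf_of, laurentMk_coeff]
    split_ifs with hi
    · rw [zero_sub, dvd_neg]
      exact hb n i hi
    · simp
  obtain ⟨x, hx⟩ := exists_limit p F (fun n => by
    rw [natCast_pow_dvd_iff_cf]
    intro i
    have h1 := dvd_sub ((pow_dvd_pow _ (Nat.le_succ n)).trans (hF (n + 1) i)) (hF n i)
    rwa [sub_sub_sub_cancel_right, ← map_sub] at h1)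
  refine ⟨x, fun i => ?_⟩
  rw [← sub_eq_zero]
  apply eq_zero_of_forall_pow_dvd p
  intro n
  have := dvd_add (pow_dvd_map p (cf p i) n (hx n)) (hF n i)
  rwa [map_sub, sub_add_sub_cancel] at this

/-- The coefficients of a product. -/
lemma dvd_cf_mul_sub {n : ℕ} {x y : Gam p O} {x' y' : O⸨X⸩}
    (hx : (p : Gam p O) ^ n ∣ x - Gam.of p O x') (hy : (p : Gam p O) ^ n ∣ y - Gam.of p O y')
    (i : ℤ) : (p : O) ^ n ∣ cf p i (x * y) - (x' * y').coeff i := by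
  apply dvd_cf_sub
  rw [map_mul]
  have : x * y - Gam.of p O x' * Gam.of p O y' = (x - Gam.of p O x') * y +
      Gam.of p O x' * (y - Gam.of p O y') := by ring
  rw [this]
  exact dvd_add (hx.mul_right _) (hy.mul_left _)

lemma cf_single_mul (a : O) (j i : ℤ) (x : Gam p O) :
    cf p i (Gam.of p O (HahnSeries.single j a) * x) = a * cf p (i - j) x := by
  rw [← sub_eq_zero]
  apply eq_zero_of_forall_pow_dvd p
  intro n
  obtain ⟨y, hy⟩ := Gam.exists_dvd_sub n x
  have h1 := dvd_cf_mul_sub (x := Gam.of p O (HahnSeries.single j a)) (x' := HahnSeries.single j a)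
    (by simp) hy i
  have e : (HahnSeries.single j a * y).coeff i = a * y.coeff (i - j) := by
    have := HahnSeries.coeff_single_mul_add (r := a) (x := y) (a := i - j) (b := j)
    rwa [sub_add_cancel] at this
  rw [e] at h1
  have h2 := (dvd_cf_sub hy (i - j)).mul_left a
  have := dvd_sub h1 h2
  convert this using 1
  ring

lemma cf_C_mul (a : O) (i : ℤ) (x : Gam p O) : cf p i (Gam.C p O a * x) = a * cf p i x := by
  have := cf_single_mul (p := p) a 0 i x
  rwa [sub_zero] at this

lemma cf_deriv (i : ℤ) (x : Gam p O) : cf p i (Gam.deriv p O x) = (i + 1) * cf p (i + 1) x := by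
  rw [← sub_eq_zero]
  apply eq_zero_of_forall_pow_dvd p
  intro n
  obtain ⟨y, hy⟩ := Gam.exists_dvd_sub n x
  have h1 := dvd_map_sub p ((cf p i).comp (Gam.deriv p O)) hy
  have e : cf p i (Gam.deriv p O (Gam.of p O y)) = (i + 1) * y.coeff (i + 1) := by
    have : Gam.deriv p O (Gam.of p O y) = Gam.of p O (LaurentSeries.derivative O y) := rfl
    rw [this, cf_of, LaurentSeries.derivative_apply, LaurentSeries.hasseDeriv_coeff]
    simp
  rw [AddMonoidHom.comp_apply, AddMonoidHom.comp_apply, e] at h1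
  have h2 := (dvd_cf_sub hy (i + 1)).mul_left ((i : O) + 1)
  have := dvd_sub h1 h2
  convert this using 1
  ring

/-- The quotients must still tend to 0 at -∞. Dividing by `a` costs at most `p ^ e`, so precision `n
+ e` for `x` gives precision `n` for the quotient. -/
lemma dvd_of_forall_dvd_cf [IsDomain O] (a : O) (x : Gam p O) (h : ∀ i, a ∣ cf p i x) 
    (ha : a ≠ 0) (hp : ∃ e : ℕ, a ∣ (p : O) ^ e) : ∃ z, x = Gam.C p O a * z := by
  choose f hf using h
  obtain ⟨e, he⟩ := hp
  obtain ⟨z, hz⟩ := exists_gam (p := p) f (fun n => by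
    obtain ⟨b, hb⟩ := exists_forall_dvd_cf (n + e) x
    refine ⟨b, fun i hi => ?_⟩
    obtain ⟨d, hd⟩ := hb i hi
    obtain ⟨c, hc⟩ := he
    refine ⟨c * d, mul_left_cancel₀ ha ?_⟩
    rw [← hf, hd, pow_add, hc]
    ring)
  exact ⟨z, Gam.ext_cf fun i => by rw [cf_C_mul, hz, hf]⟩

end Coeff

/-! ### Growth conditions -/

/-- `π` is a uniformizer of `O`, and `p` is a nonzero non-unit of `O`. -/
structure CoeffUnif (p : ℕ) {O : Type u} [CommRing O] (π : O) : Prop where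
  irred : Irreducible π
  dvd_p : π ∣ (p : O)
  p_dvd : ∃ e : ℕ, (p : O) ∣ π ^ e

lemma CoeffUnif.ne_zero {p : ℕ} {O : Type u} [CommRing O] {π : O} (hπ : CoeffUnif p π) : π ≠ 0 :=
  hπ.irred.ne_zero

section Growth

variable {p : ℕ} {O : Type u} [CommRing O] [IsAdicComplete (Ideal.span {(p : O)}) O] (π : O)

/-- The coefficients of `x` which are nonzero modulo `π ^ N` lie on or above the line
`i + R v(x_i) = β`. -/
def Growth (R N : ℕ) (β : ℤ) (x : Gam p O) : Prop :=
  ∀ (i : ℤ) (n : ℕ), n < N → i + R * n < β → π ^ (n + 1) ∣ cf p i x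

variable {π} {R N : ℕ} {β γ : ℤ} {x y : Gam p O}

lemma Growth.add (hx : Growth π R N β x) (hy : Growth π R N β y) : Growth π R N β (x + y) := by
  intro i n hn h
  rw [map_add]
  exact dvd_add (hx i n hn h) (hy i n hn h)

lemma Growth.neg (hx : Growth π R N β x) : Growth π R N β (-x) := by
  intro i n hn h
  rw [map_neg, dvd_neg]
  exact hx i n hn h

lemma Growth.sub (hx : Growth π R N β x) (hy : Growth π R N β y) : Growth π R N β (x - y) := by
  rw [sub_eq_add_neg]
  exact hx.add hy.neg

lemma Growth.zero : Growth π R N β (0 : Gam p O) := by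
  intro i n _ _
  rw [map_zero]
  exact dvd_zero _

lemma Growth.sum {ι : Type*} (s : Finset ι) {f : ι → Gam p O}
    (h : ∀ i ∈ s, Growth π R N β (f i)) : Growth π R N β (∑ i ∈ s, f i) := by
  classical
  induction s using Finset.induction_on with
  | empty => exact Growth.zero
  | insert a s ha ih =>
    rw [Finset.sum_insert ha]
    exact (h _ (Finset.mem_insert_self _ _)).add
      (ih fun i hi => h i (Finset.mem_insert_of_mem hi))

lemma Growth.mono (hx : Growth π R N β x) (h : γ ≤ β) : Growth π R N γ x :=
  fun i n hn h' => hx i n hn (h'.trans_le h)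

lemma Growth.mono_slope {R' : ℕ} (hx : Growth π R N β x) (h : R ≤ R') : Growth π R' N β x := by
  intro i n hn h'
  refine hx i n hn (lt_of_le_of_lt ?_ h')
  have : (R : ℤ) * n ≤ R' * n := by gcongr
  omega

lemma Growth.zero_slope (hx : Growth π R N β x) : Growth π 0 N (β - R * N) x := by
  intro i n hn h
  refine hx i n hn ?_
  have : (R : ℤ) * n ≤ R * N := by gcongr
  push_cast at h
  linarith

/-- Let `π ^ a` be the largest power dividing `u` with `a ≤ n + 1`. If `a ≤ n`, then j + Ra ≥ β,
which leaves k + R(n - a) < γ and hence `n - a + 1` factors for `v`. -/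
lemma dvd_mul_of_growth {u v : O} {j k : ℤ} {n : ℕ}
    (hu : ∀ m < N, j + R * m < β → π ^ (m + 1) ∣ u) (hv : ∀ m < N, k + R * m < γ → π ^ (m + 1) ∣ v)
    (hn : n < N) (h : j + k + R * n < β + γ) : π ^ (n + 1) ∣ u * v := by
  classical
  let a := Nat.findGreatest (fun a => π ^ a ∣ u) (n + 1)
  have ha : π ^ a ∣ u := Nat.findGreatest_spec (P := fun a => π ^ a ∣ u) (Nat.zero_le _) (by simp)
  rcases (Nat.findGreatest_le (P := fun a => π ^ a ∣ u) (n + 1)).lt_or_eq with h1 | h1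
  · have h1 : a < n + 1 := h1
    have h2 : ¬ π ^ (a + 1) ∣ u :=
      Nat.findGreatest_is_greatest (P := fun a => π ^ a ∣ u) (Nat.lt_succ_self _) h1
    have h3 : ¬ (j + R * a < β) := fun h3 => h2 (hu a (by omega) h3)
    have h4 : π ^ (n - a + 1) ∣ v := by
      refine hv (n - a) (by omega) ?_
      have e : ((n - a : ℕ) : ℤ) = n - a := by omega
      rw [e, mul_sub]
      linarith
    have := mul_dvd_mul ha h4
    rwa [← pow_add, show a + (n - a + 1) = n + 1 by omega] at this
  · have h1 : a = n + 1 := h1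
    rw [h1] at ha
    exact ha.mul_right _

/-- At a finite level `N` both factors may be replaced by Laurent series, whose products have
coefficients given by finite sums. -/
lemma Growth.mul (hπ : π ∣ (p : O)) (hx : Growth π R N β x) (hy : Growth π R N γ y) :
    Growth π R N (β + γ) (x * y) := by
  intro i n hn h
  obtain ⟨x', hx'⟩ := Gam.exists_dvd_sub N x
  obtain ⟨y', hy'⟩ := Gam.exists_dvd_sub N y
  have hN : ∀ m < N, π ^ (m + 1) ∣ (p : O) ^ N := fun m hm =>
    (pow_dvd_pow _ hm).trans (pow_dvd_pow_of_dvd hπ N)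
  have key : ∀ {β : ℤ} {x : Gam p O} {x' : O⸨X⸩} (_ : (p : Gam p O) ^ N ∣ x - Gam.of p O x')
      (_ : Growth π R N β x) (j : ℤ), ∀ m < N, j + R * m < β → π ^ (m + 1) ∣ x'.coeff j := by
    intro β x x' hx' hx j m hm h
    have := dvd_sub (hx j m hm h) ((hN m hm).trans (dvd_cf_sub hx' j))
    rwa [sub_sub_cancel] at this
  have h1 : π ^ (n + 1) ∣ (x' * y').coeff i := by
    rw [HahnSeries.coeff_mul]
    refine Finset.dvd_sum fun ij hij => ?_
    have hsum : ij.1 + ij.2 = i := (Finset.mem_antidiagonal.1 hij).2.2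
    exact dvd_mul_of_growth (key hx' hx ij.1) (key hy' hy ij.2) hn (by rw [hsum]; exact h)
  have := dvd_add ((hN n hn).trans (dvd_cf_mul_sub hx' hy' i)) h1
  rwa [sub_add_cancel] at this

/-- At a fixed level every element of Γ has some bound, since its coefficients tend to 0 at -∞; only
uniformity in `N` expresses overconvergence. -/
lemma exists_growth (hπ : π ∣ (p : O)) (R N : ℕ) (x : Gam p O) : ∃ β, Growth π R N β x := by
  obtain ⟨b, hb⟩ := exists_forall_dvd_cf N x
  refine ⟨b, fun i n hn h => ?_⟩
  have : (0 : ℤ) ≤ R * n := by positivity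
  exact ((pow_dvd_pow _ hn).trans (pow_dvd_pow_of_dvd hπ N)).trans (hb i (by omega))

lemma growth_single (j : ℤ) (a : O) (R N : ℕ) :
    Growth π R N j (Gam.of p O (HahnSeries.single j a)) := by
  intro i n _ h
  have : (0 : ℤ) ≤ R * n := by positivity
  rw [cf_of, HahnSeries.coeff_single_of_ne (by omega)]
  exact dvd_zero _

lemma growth_one (R N : ℕ) : Growth π R N 0 (1 : Gam p O) := by
  have := growth_single (p := p) (π := π) 0 (1 : O) R N
  rwa [show HahnSeries.single (0 : ℤ) (1 : O) = 1 from rfl, map_one] at this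

lemma Growth.pow (hπ : π ∣ (p : O)) (hx : Growth π R N β x) (k : ℕ) :
    Growth π R N (k * β) (x ^ k) := by
  induction k with
  | zero => simpa using growth_one R N
  | succ k ih =>
    rw [pow_succ]
    exact (ih.mul hπ hx).mono (by push_cast; linarith)

lemma Growth.C_mul (hx : Growth π R N β x) (a : O) : Growth π R N β (Gam.C p O a * x) := by
  intro i n hn h
  rw [cf_C_mul]
  exact (hx i n hn h).mul_left _

lemma Growth.mono_level {N' : ℕ} (hx : Growth π R N β x) (h : N' ≤ N) : Growth π R N' β x :=
  fun i n hn h' => hx i n (hn.trans_le h) h'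

/-- A factor π raises every valuation by one and so the bound by the slope: for large `R` it
compensates any pole of fixed size. -/
lemma Growth.unif_mul (hx : Growth π R N β x) :
    Growth π R (N + 1) (β + R) (Gam.C p O π * x) := by
  intro i n hn h
  rw [cf_C_mul, pow_succ']
  refine mul_dvd_mul_left _ ?_
  rcases n with _ | n
  · simp
  · refine hx i n (by omega) ?_
    push_cast at h
    linarith

lemma Growth.of_unif_mul [IsDomain O] (hπ : π ≠ 0) (hx : Growth π R (N + 1) β (Gam.C p O π * x)) :
    Growth π R N (β - R) x := by
  intro i n hn h
  have := hx i (n + 1) (by omega) (by push_cast; linarith)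
  rw [cf_C_mul, pow_succ' _ (n + 1)] at this
  exact (mul_dvd_mul_iff_left hπ).1 this

lemma growth_unif_pow_mul (x : Gam p O) : Growth π R N β (Gam.C p O (π ^ N) * x) := by
  intro i n hn _
  rw [cf_C_mul]
  exact (pow_dvd_pow _ hn).mul_right _

lemma unif_pow_dvd_cf_of_growth (h : ∀ β, Growth π R N β x) (i : ℤ) : π ^ N ∣ cf p i x := by
  rcases N with _ | N
  · simp
  · exact h (i + R * N + 1) i N (Nat.lt_succ_self _) (by omega)

lemma CoeffUnif.eq_zero (hπ : CoeffUnif p π) {a : O} (h : ∀ N, π ^ N ∣ a) : a = 0 := by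
  obtain ⟨e, he⟩ := hπ.p_dvd
  apply eq_zero_of_forall_pow_dvd p
  intro n
  have := (pow_dvd_pow_of_dvd he n).trans ((pow_mul π e n).symm.dvd.trans (h (e * n)))
  exact this

lemma CoeffUnif.eq_zero_of_growth (hπ : CoeffUnif p π) (h : ∀ N β, Growth π R N β x) : x = 0 :=
  Gam.ext_cf fun i => by
    rw [map_zero]
    exact hπ.eq_zero fun N => unif_pow_dvd_cf_of_growth (h N) i

/-- Overconvergence in terms of growth. -/
lemma mem_gamCon_iff (hπ : CoeffUnif p π) :
    x ∈ GamCon p O ↔ ∃ (R : ℕ) (β : ℤ), ∀ N, Growth π R N β x := by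
  constructor
  · rintro ⟨c, hc, h⟩
    obtain ⟨i₀, h⟩ := eventually_atTop.1 h
    obtain ⟨R, hR⟩ := exists_nat_ge (1 / c)
    obtain ⟨b, hb⟩ := exists_nat_ge (1 / c)
    have hR1 : 1 ≤ c * R := by
      rw [div_le_iff₀ hc] at hR
      linarith
    have hb1 : 1 ≤ c * b := by
      rw [div_le_iff₀ hc] at hb
      linarith
    -- With `c * R ≥ 1` and `c * b ≥ 1`, an index -j with j > b + Rn satisfies cj ≥ n + 1, which
    -- gives `p ^ (n + 1)` and a fortiori `π ^ (n + 1)`.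
    refine ⟨R, -(max b i₀ : ℕ), fun N i n hn hi => ?_⟩
    have hRn : (0 : ℤ) ≤ R * n := by positivity
    have hi0 : i + R * n < -(max b i₀ : ℕ) := hi
    obtain ⟨j, rfl⟩ : ∃ j : ℕ, i = -(j : ℤ) := ⟨i.natAbs, by omega⟩
    have hij : max b i₀ + R * n < j := by zify; omega
    have h1 := h j (by omega) (n + 1) (by
      have h2 : ((b : ℝ) + R * n) ≤ j := by
        exact_mod_cast (by omega : b + R * n ≤ j)
      have h3 : c * ((b : ℝ) + R * n) ≤ c * j := by gcongr
      have h4 : (1 : ℝ) * n ≤ c * R * n := by gcongr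
      push_cast
      nlinarith)
    rw [coeff_val_eq_zero_iff_cf] at h1
    exact (pow_dvd_pow_of_dvd hπ.dvd_p _).trans h1
  · rintro ⟨R, β, h⟩
    obtain ⟨e, he⟩ := hπ.p_dvd
    -- As `p ^ m` divides `π ^ (e * m)`, the slope in terms of p is Re; the factor 2 absorbs the
    -- constant β once `i` exceeds 2|β| + 1.
    refine ⟨1 / (2 * (R * e + 1)), by positivity, ?_⟩
    filter_upwards [eventually_ge_atTop (2 * β.natAbs + 2)] with i hi m hm
    rw [coeff_val_eq_zero_iff_cf]
    have h1 : (p : O) ^ m ∣ π ^ (e * m) := by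
      rw [pow_mul]
      exact pow_dvd_pow_of_dvd he m
    refine h1.trans ((pow_dvd_pow _ (Nat.le_succ _)).trans (h (e * m + 1) _ _ (Nat.lt_succ_self _) ?_))
    have h2 : (m : ℝ) * (2 * (R * e + 1)) ≤ i := by
      rw [div_mul_eq_mul_div, one_mul, le_div_iff₀ (by positivity)] at hm
      exact hm
    have h3 : m * (2 * (R * e + 1)) ≤ i := by exact_mod_cast h2
    have h4 : 2 * (R * (e * m)) ≤ i := by nlinarith
    push_cast
    have h5 : 2 * ((R : ℤ) * (e * m)) ≤ i := by exact_mod_cast h4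
    omega

/-- `1 + π z` is invertible in `Γ`. -/
lemma isUnit_one_add_unif_mul (hπ : CoeffUnif p π) (z : Gam p O) :
    IsUnit (1 + Gam.C p O π * z) := by
  obtain ⟨e, d, hd⟩ := hπ.p_dvd
  set a := -(Gam.C p O π * z)
  -- `1 - a ^ e` is a unit by p-adic completeness, and `1 - a` divides it.
  have h1 : (p : Gam p O) ∣ -a ^ e := by
    have h0 : a ^ e = (-1) ^ e * ((p : Gam p O) * Gam.C p O d * z ^ e) := by
      rw [show a = -(Gam.C p O π * z) from rfl, neg_pow, mul_pow, ← map_pow, hd, map_mul,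
        map_natCast]
    rw [dvd_neg, h0, mul_assoc]
    exact (dvd_mul_right _ _).mul_left _
  have h2 := isUnit_one_add_of_dvd p h1
  rw [← sub_eq_add_neg] at h2
  have h3 : 1 + Gam.C p O π * z = 1 - a := by simp [a]
  rw [h3]
  have h4 := sub_dvd_pow_sub_pow 1 a e
  rw [one_pow] at h4
  exact isUnit_of_dvd_unit h4 h2

/-- The inverse of `1 + x`, for `x` in `π Γ` of nonnegative growth. -/
lemma growth_of_one_add_mul_eq_one (hπ : CoeffUnif p π) (hx : ∀ N, Growth π R N 0 x)
    (hx' : ∃ z, x = Gam.C p O π * z) (h : (1 + x) * y = 1) (N : ℕ) : Growth π R N 0 y := by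
  obtain ⟨z, hz⟩ := hx'
  have h1 := mul_neg_geom_sum (-x) N
  -- In the truncated geometric series the remainder is a multiple of `π ^ N`, which growth at level
  -- `N` does not see.
  have h2 : y = (∑ k ∈ Finset.range N, (-x) ^ k) + Gam.C p O (π ^ N) * ((-z) ^ N * y) := by
    have h3 : Gam.C p O (π ^ N) * ((-z) ^ N * y) = (-x) ^ N * y := by
      rw [hz, map_pow, ← mul_assoc, ← mul_pow, mul_neg]
    rw [h3]
    have h4 : (1 - -x) * y = 1 := by rw [sub_neg_eq_add]; exact h
    calc y = (1 - (-x) ^ N) * y + (-x) ^ N * y := by ring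
      _ = ((1 - -x) * y) * (∑ k ∈ Finset.range N, (-x) ^ k) + (-x) ^ N * y := by
        rw [← h1]; ring
      _ = _ := by rw [h4, one_mul]
  rw [h2]
  refine Growth.add (Growth.sum _ fun k _ => ?_) (growth_unif_pow_mul _)
  exact ((hx N).neg.pow hπ.dvd_p k).mono (by simp)

end Growth

/-! ### `Γ` and `Γ_con` are discrete valuation rings -/

/-- The element `ϖ` generates the maximal ideal of a discrete valuation ring. -/
structure IsUnif {A : Type u} [CommRing A] (ϖ : A) : Prop where
  not_isUnit : ¬ IsUnit ϖ
  eq_zero : ∀ x, ϖ * x = 0 → x = 0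
  dvd_or_isUnit : ∀ x, ϖ ∣ x ∨ IsUnit x
  sep : ∀ x, (∀ n, ϖ ^ n ∣ x) → x = 0

namespace IsUnif

variable {A : Type u} [CommRing A] {ϖ : A} (h : IsUnif ϖ)

include h

/-- Otherwise `dvd_or_isUnit` would extract factors ϖ indefinitely, contrary to `sep`. -/
lemma exists_eq_pow_mul {x : A} (hx : x ≠ 0) : ∃ (n : ℕ) (w : Aˣ), x = ϖ ^ n * w := by
  by_contra hcon
  push Not at hcon
  apply hx
  apply h.sep
  intro n
  induction n with
  | zero => simp
  | succ n ih =>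
    obtain ⟨y, hy⟩ := ih
    rcases h.dvd_or_isUnit y with h1 | h1
    · rw [hy, pow_succ]
      exact mul_dvd_mul_left _ h1
    · obtain ⟨w, rfl⟩ := h1
      exact absurd hy (hcon n w)

lemma pow_mul_eq_zero (n : ℕ) {x : A} (hx : ϖ ^ n * x = 0) : x = 0 := by
  induction n with
  | zero => simpa using hx
  | succ n ih =>
    rw [pow_succ', mul_assoc] at hx
    exact ih (h.eq_zero _ hx)

lemma isDomain : IsDomain A := by
  have : Nontrivial A := by
    refine ⟨ϖ, 1, fun h1 => h.not_isUnit ?_⟩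
    rw [h1]
    exact isUnit_one
  have : NoZeroDivisors A := by
    constructor
    intro a b hab
    by_contra hcon
    push Not at hcon
    obtain ⟨n, w, rfl⟩ := h.exists_eq_pow_mul hcon.1
    apply hcon.2
    apply h.pow_mul_eq_zero n
    rw [mul_right_comm] at hab
    exact w.isUnit.mul_left_eq_zero.1 hab
  exact NoZeroDivisors.to_isDomain A

lemma ne_zero : ϖ ≠ 0 := by
  have := h.isDomain
  rintro rfl
  exact one_ne_zero (h.eq_zero 1 (zero_mul _))

lemma irreducible [IsDomain A] : Irreducible ϖ := by
  refine ⟨h.not_isUnit, fun a b hab => ?_⟩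
  rcases h.dvd_or_isUnit a with ⟨c, rfl⟩ | h1
  · right
    rw [mul_assoc] at hab
    have : c * b = 1 := by
      apply mul_left_cancel₀ h.ne_zero
      rw [mul_one, ← hab]
    exact IsUnit.of_mul_eq_one_right _ this
  · exact Or.inl h1

lemma isDiscreteValuationRing [IsDomain A] : IsDiscreteValuationRing A := by
  apply IsDiscreteValuationRing.ofHasUnitMulPowIrreducibleFactorization
  refine ⟨ϖ, h.irreducible, fun {x} hx => ?_⟩
  obtain ⟨n, w, rfl⟩ := h.exists_eq_pow_mul hx
  exact ⟨n, w, rfl⟩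

end IsUnif

section

variable {p : ℕ} {O : Type u} [CommRing O] [IsDomain O] [IsDiscreteValuationRing O]
  [IsAdicComplete (Ideal.span {(p : O)}) O] {π : O}

lemma exists_coeffUnif (hp : (p : O) ≠ 0) (hp' : ¬ IsUnit (p : O)) :
    ∃ π : O, CoeffUnif p π := by
  obtain ⟨π, hπ⟩ := IsDiscreteValuationRing.exists_irreducible O
  obtain ⟨n, hn⟩ := IsDiscreteValuationRing.associated_pow_irreducible hp hπ
  refine ⟨π, hπ, ?_, n, hn.dvd⟩
  rcases n with _ | n
  · rw [pow_zero] at hn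
    exact absurd (hn.symm.isUnit isUnit_one) hp'
  · exact (dvd_pow_self π n.succ_ne_zero).trans hn.symm.dvd

lemma CoeffUnif.isUnit_of_not_dvd (hπ : CoeffUnif p π) {a : O} (h : ¬ π ∣ a) : IsUnit a := by
  by_contra h1
  apply h
  rw [← Ideal.mem_span_singleton,
    ← (IsDiscreteValuationRing.irreducible_iff_uniformizer π).1 hπ.irred]
  exact (IsLocalRing.mem_maximalIdeal a).2 h1

lemma CoeffUnif.dvd_of_cf (hπ : CoeffUnif p π) {x : Gam p O} {N : ℕ} (h : ∀ i, π ^ N ∣ cf p i x) :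
    ∃ z, x = Gam.C p O (π ^ N) * z :=
  dvd_of_forall_dvd_cf _ x h (pow_ne_zero _ hπ.ne_zero) ⟨N, pow_dvd_pow_of_dvd hπ.dvd_p N⟩

/-- An element of `Γ` outside `π Γ` is the product of an invertible Laurent series and a
`1`-unit. -/
lemma CoeffUnif.exists_eq_mul_one_add (hπ : CoeffUnif p π) {x : Gam p O}
    (hx : ¬ ∀ i, π ∣ cf p i x) :
    ∃ (g g' : O⸨X⸩) (z : Gam p O), g * g' = 1 ∧
      Gam.of p O g' * x = 1 + Gam.C p O π * z := by
  classical
  push Not at hx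
  obtain ⟨y, hy⟩ := Gam.exists_dvd_sub 1 x
  obtain ⟨b, hb⟩ := exists_forall_dvd_cf 1 x
  obtain ⟨i₀, hi₀, hmin⟩ := Int.exists_least_of_bdd (P := fun i => ¬ π ∣ cf p i x)
    ⟨b, fun i hi => by
      by_contra h
      apply hi
      have := hb i (by omega)
      rw [pow_one] at this
      exact hπ.dvd_p.trans this⟩ hx
  have hxy : ∀ i, π ∣ cf p i x - y.coeff i := fun i => by
    have := dvd_cf_sub hy i
    rw [pow_one] at this
    exact hπ.dvd_p.trans this
  -- `i₀` is the order of `x` modulo π. Cutting the approximation `y` below `i₀` changes it only by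
  -- multiples of π and makes the leading coefficient a unit, so `g` is invertible.
  let g : O⸨X⸩ := laurentMk (fun i => if i < i₀ then 0 else y.coeff i) i₀ (by
    intro i hi; simp [hi])
  have hg : ∀ i, g.coeff i = if i < i₀ then 0 else y.coeff i := fun i => laurentMk_coeff _ _ _ i
  have hgi₀ : IsUnit (g.coeff i₀) := by
    apply hπ.isUnit_of_not_dvd
    rw [hg, if_neg (lt_irrefl _)]
    intro h
    apply hi₀
    have := dvd_add (hxy i₀) h
    rwa [sub_add_cancel] at this
  have hg0 : g ≠ 0 := by
    intro h
    rw [h] at hgi₀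
    simp at hgi₀
  have hord : g.order = i₀ := by
    apply le_antisymm
    · exact HahnSeries.order_le_of_coeff_ne_zero hgi₀.ne_zero
    · by_contra h
      have h1 : g.coeff g.order ≠ 0 := fun h2 => hg0 (HahnSeries.coeff_order_eq_zero.1 h2)
      rw [hg, if_pos (not_le.1 h)] at h1
      exact h1 rfl
  have hunit : IsUnit g := by
    rw [HahnSeries.isUnit_iff, HahnSeries.leadingCoeff_eq, hord]
    exact hgi₀
  obtain ⟨g', hg'⟩ := isUnit_iff_exists_inv.1 hunit
  obtain ⟨w, hw⟩ := hπ.dvd_of_cf (x := x - Gam.of p O g) (N := 1) (fun i => by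
    rw [pow_one, map_sub, cf_of, hg]
    split_ifs with h
    · rw [sub_zero]
      by_contra h1
      exact absurd (hmin i h1) (not_le.2 h)
    · exact hxy i)
  refine ⟨g, g', Gam.of p O g' * w, hg', ?_⟩
  rw [pow_one, sub_eq_iff_eq_add] at hw
  have h1 : Gam.of p O g' * Gam.of p O g = 1 := by rw [← map_mul, mul_comm, hg', map_one]
  rw [hw]
  linear_combination h1

/-- `π` is a uniformizer of `Γ`. -/
lemma CoeffUnif.isUnif_gam (hπ : CoeffUnif p π) : IsUnif (Gam.C p O π) where
  not_isUnit h := by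
    obtain ⟨y, hy⟩ := isUnit_iff_exists_inv.1 h
    have := congrArg (cf p 0) hy
    rw [cf_C_mul, ← map_one (Gam.of p O), cf_of, HahnSeries.coeff_one, if_pos rfl] at this
    exact hπ.irred.not_isUnit (IsUnit.of_mul_eq_one _ this)
  eq_zero x hx := Gam.ext_cf fun i => by
    have := congrArg (cf p i) hx
    rw [cf_C_mul, map_zero] at this
    rw [map_zero]
    exact (mul_eq_zero.1 this).resolve_left hπ.ne_zero
  dvd_or_isUnit x := by
    by_cases hx : ∀ i, π ∣ cf p i x
    · left
      obtain ⟨z, hz⟩ := hπ.dvd_of_cf (N := 1) (by simpa using hx)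
      rw [pow_one] at hz
      exact ⟨z, hz⟩
    · right
      obtain ⟨g, g', z, _, h⟩ := hπ.exists_eq_mul_one_add hx
      have := isUnit_one_add_unif_mul hπ z
      rw [← h] at this
      exact isUnit_of_mul_isUnit_right this
  sep x hx := Gam.ext_cf fun i => by
    rw [map_zero]
    refine hπ.eq_zero fun N => ?_
    obtain ⟨z, rfl⟩ := hx N
    rw [← map_pow, cf_C_mul]
    exact dvd_mul_right _ _

/-- Dividing by π lowers the bound by the slope `R`, uniformly in the level: Γ_con is saturated in
Γ. -/
lemma CoeffUnif.mem_gamCon_of_unif_mul (hπ : CoeffUnif p π) {x : Gam p O}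
    (h : Gam.C p O π * x ∈ GamCon p O) : x ∈ GamCon p O := by
  rw [mem_gamCon_iff hπ] at h ⊢
  obtain ⟨R, β, h⟩ := h
  exact ⟨R, β - R, fun N => (h (N + 1)).of_unif_mul hπ.ne_zero⟩

lemma CoeffUnif.mem_gamCon_of_unif_pow_mul (hπ : CoeffUnif p π) (n : ℕ) {x : Gam p O}
    (h : Gam.C p O π ^ n * x ∈ GamCon p O) : x ∈ GamCon p O := by
  induction n with
  | zero => simpa using h
  | succ n ih =>
    rw [pow_succ', mul_assoc] at h
    exact ih (hπ.mem_gamCon_of_unif_mul h)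

/-- Raising the slope to R + |β| gives πz nonnegative growth, so all terms of the geometric series
obey one bound. -/
lemma CoeffUnif.inv_one_add_mem_gamCon (hπ : CoeffUnif p π) {z y : Gam p O} (hz : z ∈ GamCon p O)
    (h : (1 + Gam.C p O π * z) * y = 1) : y ∈ GamCon p O := by
  obtain ⟨R, β, hz⟩ := (mem_gamCon_iff hπ).1 hz
  refine (mem_gamCon_iff hπ).2 ⟨R + β.natAbs, 0, fun N =>
    growth_of_one_add_mul_eq_one hπ (fun N => ?_) ⟨z, rfl⟩ h N⟩
  exact ((((hz N).mono_slope (Nat.le_add_right _ β.natAbs)).unif_mul).mono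
    (by push_cast; linarith [neg_abs_le β])).mono_level (Nat.le_succ N)

lemma CoeffUnif.isUnit_gamCon (hπ : CoeffUnif p π) {x : GamCon p O}
    (hx : ¬ ∀ i, π ∣ cf p i (x : Gam p O)) : IsUnit x := by
  obtain ⟨g, g', z, hgg, h⟩ := hπ.exists_eq_mul_one_add hx
  have hz : z ∈ GamCon p O := by
    apply hπ.mem_gamCon_of_unif_mul
    have h1 : Gam.C p O π * z = Gam.of p O g' * x - 1 := by rw [h]; ring
    rw [h1]
    exact sub_mem (mul_mem (isOverconvergent_of p O g') x.2) (one_mem _)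
  obtain ⟨y, hy⟩ := isUnit_iff_exists_inv.1 (isUnit_one_add_unif_mul hπ z)
  have hy' := hπ.inv_one_add_mem_gamCon hz hy
  rw [← h] at hy
  refine IsUnit.of_mul_eq_one (⟨_, mul_mem (isOverconvergent_of p O g') hy'⟩ : GamCon p O) ?_
  apply Subtype.ext
  change (x : Gam p O) * (Gam.of p O g' * y) = 1
  rw [← hy]
  ring

/-- `π` is a uniformizer of `Γ_con`. -/
lemma CoeffUnif.isUnif_gamCon (hπ : CoeffUnif p π) : IsUnif (GamCon.C p O π) where
  not_isUnit h := hπ.isUnif_gam.not_isUnit (h.map (GamCon p O).subtype)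
  eq_zero x hx := Subtype.ext (hπ.isUnif_gam.eq_zero x (congrArg Subtype.val hx))
  dvd_or_isUnit x := by
    by_cases hx : ∀ i, π ∣ cf p i (x : Gam p O)
    · left
      obtain ⟨z, hz⟩ := hπ.dvd_of_cf (N := 1) (by simpa using hx)
      rw [pow_one] at hz
      have hz' : z ∈ GamCon p O := hπ.mem_gamCon_of_unif_mul (hz ▸ x.2)
      exact ⟨⟨z, hz'⟩, Subtype.ext hz⟩
    · exact Or.inr (hπ.isUnit_gamCon hx)
  sep x hx := Subtype.ext (hπ.isUnif_gam.sep x fun n => by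
    obtain ⟨z, hz⟩ := hx n
    exact ⟨z, congrArg Subtype.val hz⟩)

end

/-! ### `t`-adic continuity -/

section Cont

variable {p : ℕ} {O : Type u} [CommRing O] [IsAdicComplete (Ideal.span {(p : O)}) O] {π : O}

/-- The monomial `a t ^ k`. -/
abbrev Gam.single (p : ℕ) (k : ℤ) (a : O) : Gam p O := Gam.of p O (HahnSeries.single k a)

lemma Gam.single_mul_single (j k : ℤ) (a b : O) :
    Gam.single p j a * Gam.single p k b = Gam.single p (j + k) (a * b) := by
  rw [← map_mul, HahnSeries.single_mul_single]

lemma Gam.single_zero : Gam.single p 0 (1 : O) = 1 := map_one (Gam.of p O)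

lemma Gam.single_eq (k : ℤ) (a : O) : Gam.single p k a = Gam.C p O a * Gam.single p k 1 := by
  change _ = Gam.single p 0 a * _
  rw [Gam.single_mul_single, zero_add, mul_one]

variable (π) in
/-- Continuity of an additive map for the `t`-adic topology modulo each power of `π`. -/
def TCont (f : Gam p O →+ Gam p O) : Prop :=
  ∀ (N : ℕ) (γ : ℤ), ∃ β : ℤ, ∀ x, Growth π 0 N β x → Growth π 0 N γ (f x)

lemma TCont.comp {f g : Gam p O →+ Gam p O} (hf : TCont π f) (hg : TCont π g) :
    TCont π (f.comp g) := by
  intro N γ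
  obtain ⟨β, h⟩ := hf N γ
  obtain ⟨β', h'⟩ := hg N β
  exact ⟨β', fun x hx => h _ (h' x hx)⟩

lemma TCont.sub {f g : Gam p O →+ Gam p O} (hf : TCont π f) (hg : TCont π g) :
    TCont π (f - g) := by
  intro N γ
  obtain ⟨β, h⟩ := hf N γ
  obtain ⟨β', h'⟩ := hg N γ
  exact ⟨max β β', fun x hx => (h _ (hx.mono (le_max_left _ _))).sub
    (h' _ (hx.mono (le_max_right _ _)))⟩

lemma tcont_mulLeft (hπ : π ∣ (p : O)) (y : Gam p O) : TCont π (AddMonoidHom.mulLeft y) := by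
  intro N γ
  obtain ⟨β, h⟩ := exists_growth hπ 0 N y
  exact ⟨γ - β, fun x hx => (h.mul hπ hx).mono (by omega)⟩

lemma tcont_mulRight (hπ : π ∣ (p : O)) (y : Gam p O) : TCont π (AddMonoidHom.mulRight y) := by
  intro N γ
  obtain ⟨β, h⟩ := exists_growth hπ 0 N y
  exact ⟨γ - β, fun x hx => (hx.mul hπ h).mono (by omega)⟩

lemma tcont_deriv : TCont π (Gam.deriv p O) := by
  intro N γ
  refine ⟨γ + 1, fun x hx i n hn h => ?_⟩
  rw [cf_deriv]
  exact (hx (i + 1) n hn (by omega)).mul_left _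

/-- Modulo `π ^ N` the coefficients far to the left vanish, so finitely many monomials lie below
`β`. This density of monomials is what makes identities between continuous maps checkable on them.
-/
lemma exists_finset_growth (hπ : π ∣ (p : O)) (N : ℕ) (β : ℤ) (x : Gam p O) :
    ∃ s : Finset ℤ, Growth π 0 N β (x - ∑ k ∈ s, Gam.single p k (cf p k x)) := by
  classical
  obtain ⟨b, hb⟩ := exists_growth hπ 0 N x
  refine ⟨Finset.Ico b β, fun i n hn h => ?_⟩
  have h1 : cf p i (∑ k ∈ Finset.Ico b β, Gam.single p k (cf p k x)) =
      if i ∈ Finset.Ico b β then cf p i x else 0 := by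
    rw [map_sum]
    simp only [cf_of]
    split_ifs with hi
    · rw [Finset.sum_eq_single i]
      · simp
      · intro k _ hk
        exact HahnSeries.coeff_single_of_ne (Ne.symm hk)
      · exact fun h => absurd hi h
    · refine Finset.sum_eq_zero fun k hk => HahnSeries.coeff_single_of_ne ?_
      rintro rfl
      exact hi hk
  rw [map_sub, h1]
  simp only [Nat.cast_zero, zero_mul, add_zero] at h
  split_ifs with hi
  · simp
  · rw [sub_zero]
    rw [Finset.mem_Ico] at hi
    exact hb i n hn (by simp only [Nat.cast_zero, zero_mul, add_zero]; omega)

/-- A continuous additive map which vanishes on monomials is zero. -/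
lemma TCont.eq_zero (hπ : CoeffUnif p π) {f : Gam p O →+ Gam p O} (hf : TCont π f)
    (h : ∀ k a, f (Gam.single p k a) = 0) (x : Gam p O) : f x = 0 := by
  refine hπ.eq_zero_of_growth (R := 0) fun N γ => ?_
  obtain ⟨β, hβ⟩ := hf N γ
  obtain ⟨s, hs⟩ := exists_finset_growth hπ.dvd_p N β x
  have := hβ _ hs
  rwa [map_sub, map_sum, Finset.sum_eq_zero fun k _ => h k _, sub_zero] at this

/-- The Leibniz rule. -/
lemma Gam.deriv_mul (hπ : CoeffUnif p π) (x y : Gam p O) :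
    Gam.deriv p O (x * y) = Gam.deriv p O x * y + x * Gam.deriv p O y := by
  -- For fixed `y` the defect of the Leibniz rule is additive and continuous in `x`, so only
  -- monomials `x` need be considered.
  have hc : TCont π (((Gam.deriv p O).comp (AddMonoidHom.mulRight y) -
      (AddMonoidHom.mulRight y).comp (Gam.deriv p O)) -
      AddMonoidHom.mulRight (Gam.deriv p O y)) :=
    ((tcont_deriv.comp (tcont_mulRight hπ.dvd_p y)).sub
      ((tcont_mulRight hπ.dvd_p y).comp tcont_deriv)).sub (tcont_mulRight hπ.dvd_p _)
  have := hc.eq_zero hπ (fun k a => by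
    change Gam.deriv p O (Gam.single p k a * y) - Gam.deriv p O (Gam.single p k a) * y -
      Gam.single p k a * Gam.deriv p O y = 0
    have e : Gam.deriv p O (Gam.single p k a) = Gam.single p (k - 1) (k * a) := by
      apply Gam.ext_cf
      intro i
      rw [cf_deriv, cf_of, cf_of]
      by_cases hi : i = k - 1
      · subst hi
        simp
      · rw [HahnSeries.coeff_single_of_ne hi, HahnSeries.coeff_single_of_ne (by omega), mul_zero]
    rw [e]
    apply Gam.ext_cf
    intro i
    rw [map_sub, map_sub, cf_deriv, cf_single_mul, cf_single_mul, cf_single_mul, cf_deriv, map_zero,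
      show i - (k - 1) = i - k + 1 by ring, show i + 1 - k = i - k + 1 by ring]
    push_cast
    ring) x
  change Gam.deriv p O (x * y) - Gam.deriv p O x * y - x * Gam.deriv p O y = 0 at this
  linear_combination this

end Cont

/-! ### Continuity of Frobenius lifts -/

/-- Each p-th power improves the congruence by one factor ϖ: the cross terms carry `p`, and the last
term is a p-th power of the previous error. -/
lemma pow_dvd_pow_prime_pow_sub {A : Type*} [CommRing A] {p : ℕ} (hp : p.Prime) {ϖ a b : A}
    (hϖ : ϖ ∣ (p : A)) (h : ϖ ∣ a - b) (k : ℕ) : ϖ ^ (k + 1) ∣ a ^ p ^ k - b ^ p ^ k := by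
  induction k with
  | zero => simpa using h
  | succ k ih =>
    obtain ⟨c, hc⟩ := ih
    obtain ⟨r, hr⟩ := exists_add_pow_prime_eq hp (b ^ p ^ k) (ϖ ^ (k + 1) * c)
    rw [← hc, add_sub_cancel] at hr
    rw [pow_succ p k, pow_mul a, pow_mul b, hr, hc, add_assoc ((b ^ p ^ k) ^ p),
      add_sub_cancel_left]
    refine dvd_add ?_ ?_
    · rw [mul_pow, ← pow_mul]
      refine ((pow_dvd_pow _ ?_).mul_right _)
      have := hp.two_le
      nlinarith
    · obtain ⟨d, hd⟩ := hϖ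
      rw [hd]
      exact ⟨d * b ^ p ^ k * c * r, by ring⟩

section Frob

variable {p : ℕ} [hp : Fact p.Prime] {O : Type u} [CommRing O] [IsDomain O]
  [IsDiscreteValuationRing O] [IsAdicComplete (Ideal.span {(p : O)}) O] {π : O}

lemma sum_pow_prime_pow {A : Type*} [CommRing A] (N : ℕ) {ι : Type*} (s : Finset ι) (f : ι → A) :
    (p : A) ∣ (∑ i ∈ s, f i) ^ p ^ N - ∑ i ∈ s, f i ^ p ^ N := by
  classical
  induction s using Finset.induction_on with
  | empty => simp [hp.out.ne_zero]
  | insert a s ha ih =>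
    rw [Finset.sum_insert ha, Finset.sum_insert ha]
    obtain ⟨r, hr⟩ := exists_add_pow_prime_pow_eq hp.out (f a) (∑ i ∈ s, f i) N
    obtain ⟨c, hc⟩ := ih
    rw [hr]
    exact ⟨f a * (∑ i ∈ s, f i) * r + c, by rw [mul_add, ← hc]; ring⟩

/-- Modulo `π`, the coefficients of a `p`-power are the `p`-powers of coefficients. -/
lemma CoeffUnif.dvd_cf_pow_sub (hπ : CoeffUnif p π) (N : ℕ) (y : Gam p O) (m : ℤ) :
    π ∣ cf p m (y ^ p ^ N) - if ((p ^ N : ℕ) : ℤ) ∣ m then cf p (m / (p ^ N : ℕ)) y ^ p ^ N else 0 := by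
  classical
  have hq : 1 ≤ p ^ N := Nat.one_le_pow _ _ hp.out.pos
  generalize hqdef : p ^ N = q at hq
  have hgeom : ∀ k : ℤ, k < |m| + 1 ∨ m < q * k := by
    intro k
    by_contra hcon
    push Not at hcon
    have h1 := le_abs_self m
    have h2 := abs_nonneg m
    have hq' : (1 : ℤ) ≤ q := by exact_mod_cast hq
    nlinarith
  obtain ⟨s, hs⟩ := exists_finset_growth hπ.dvd_p 1 (|m| + 1) y
  set P := ∑ k ∈ s, Gam.single p k (cf p k y)
  have hw : π ∣ cf p m ((y - P) ^ q) := by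
    have := hs.pow hπ.dvd_p q m 0 one_pos (by
      rcases hgeom (|m| + 1) with h | h
      · exact absurd h (lt_irrefl _)
      · simpa using h)
    simpa using this
  have hdvd : ∀ x : Gam p O, (p : Gam p O) ∣ x → π ∣ cf p m x := by
    rintro _ ⟨x, rfl⟩
    have := AddMonoidHom.natCast_pow_mul p (cf p m) 1 x
    rw [pow_one, pow_one] at this
    rw [this]
    exact hπ.dvd_p.mul_right _
  obtain ⟨r, hr⟩ := exists_add_pow_prime_pow_eq hp.out P (y - P) N
  rw [add_sub_cancel, hqdef] at hr
  have h1 : π ∣ cf p m (P ^ q) - cf p m (∑ k ∈ s, Gam.single p (q * k) (cf p k y ^ q)) := by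
    rw [← map_sub]
    apply hdvd
    have := sum_pow_prime_pow (p := p) N s (fun k => Gam.single p k (cf p k y))
    rw [hqdef] at this
    have e : ∑ k ∈ s, Gam.single p (q * k) (cf p k y ^ q) =
        ∑ k ∈ s, Gam.single p k (cf p k y) ^ q := by
      refine Finset.sum_congr rfl fun k _ => ?_
      rw [← map_pow (Gam.of p O), HahnSeries.single_pow, nsmul_eq_mul]
    rw [e]
    exact this
  have h2 : π ∣ cf p m (∑ k ∈ s, Gam.single p (q * k) (cf p k y ^ q)) -
      if (q : ℤ) ∣ m then cf p (m / q) y ^ q else 0 := by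
    rw [map_sum]
    simp only [cf_of]
    have hq0 : (q : ℤ) ≠ 0 := by exact_mod_cast (by omega : q ≠ 0)
    split_ifs with hm
    · obtain ⟨k₀, rfl⟩ := hm
      rw [Int.mul_ediv_cancel_left _ hq0]
      by_cases hk : k₀ ∈ s
      · rw [Finset.sum_eq_single k₀]
        · simp
        · intro k _ hk
          refine HahnSeries.coeff_single_of_ne fun h => hk ?_
          exact (mul_left_cancel₀ hq0 h).symm
        · exact fun h => absurd hk h
      · rw [Finset.sum_eq_zero, zero_sub, dvd_neg]
        · have h3 : π ∣ cf p k₀ (y - P) := by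
            have := hs k₀ 0 one_pos (by
              rcases hgeom k₀ with h | h
              · simpa using h
              · exact absurd h (lt_irrefl _))
            simpa using this
          have h4 : cf p k₀ P = 0 := by
            rw [map_sum]
            refine Finset.sum_eq_zero fun k hk' => ?_
            rw [cf_of]
            refine HahnSeries.coeff_single_of_ne ?_
            rintro rfl
            exact hk hk'
          rw [map_sub, h4, sub_zero] at h3
          exact h3.trans (dvd_pow_self _ (by omega))
        · intro k hk'
          refine HahnSeries.coeff_single_of_ne fun h => hk ?_
          rw [mul_left_cancel₀ hq0 h]
          exact hk'
    · rw [Finset.sum_eq_zero, sub_zero]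
      · exact dvd_zero _
      · intro k _
        refine HahnSeries.coeff_single_of_ne fun h => hm ?_
        exact ⟨k, h⟩
  have h3 : π ∣ cf p m ((p : Gam p O) * P * (y - P) * r) := by
    apply hdvd
    exact ⟨P * (y - P) * r, by ring⟩
  rw [hr, map_add, map_add]
  have := dvd_add (dvd_add h1 h2) (dvd_add hw h3)
  convert this using 1
  ring

/-- The residue field of `O` is perfect if it admits an automorphism lifting Frobenius. -/
lemma exists_pow_root {σ₀ : O ≃+* O} (hσ₀ : LiftsFrobenius p σ₀) (hπ : CoeffUnif p π) (N : ℕ)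
    (c : O) : ∃ r, π ∣ c - r ^ p ^ N := by
  have hmax : ∀ x : O, x ∈ IsLocalRing.maximalIdeal O ↔ π ∣ x := by
    intro x
    rw [(IsDiscreteValuationRing.irreducible_iff_uniformizer π).1 hπ.irred,
      Ideal.mem_span_singleton]
  induction N with
  | zero => exact ⟨c, by simp⟩
  | succ N ih =>
    obtain ⟨r, hr⟩ := ih
    -- As `σ₀` lifts Frobenius, its inverse provides p-th roots modulo π.
    have h1 := (hmax _).1 (hσ₀ (σ₀.symm r))
    rw [RingEquiv.apply_symm_apply] at h1
    refine ⟨σ₀.symm r, ?_⟩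
    have h2 : π ∣ r ^ p ^ N - (σ₀.symm r ^ p) ^ p ^ N := h1.trans (sub_dvd_pow_sub_pow _ _ _)
    have := dvd_add hr h2
    rwa [sub_add_sub_cancel, ← pow_mul, ← pow_succ'] at this

/-- Every element of `Γ` is, modulo `π`, a combination of `q`-th powers with coefficients
`1, t, …, t ^ (q - 1)`. -/
lemma exists_sum_single_mul_pow {σ₀ : O ≃+* O} (hσ₀ : LiftsFrobenius p σ₀) (hπ : CoeffUnif p π)
    (N M : ℕ) (β : ℤ) (x : Gam p O) (hx : Growth π 0 (M + 1) β x) :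
    ∃ (g : ℕ → Gam p O) (z : Gam p O),
      x = (∑ j ∈ Finset.range (p ^ N), Gam.single p j 1 * g j ^ p ^ N) + Gam.C p O π * z ∧
      (∀ j : ℕ, Growth π 0 (M + 1) (-(((j : ℤ) - β) / (p ^ N : ℕ))) (g j)) := by
  classical
  have hq : 1 ≤ p ^ N := Nat.one_le_pow _ _ hp.out.pos
  choose r hr using exists_pow_root hσ₀ hπ N
  generalize hqdef : p ^ N = q at *
  have hq' : (1 : ℤ) ≤ q := by exact_mod_cast hq
  -- The root is forced to be 0 whenever the coefficient vanishes modulo π, so that the supports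
  -- stay bounded below.
  let c : ℤ → O := fun i => if π ∣ cf p i x then 0 else r (cf p i x)
  have hc : ∀ i, π ∣ cf p i x - c i ^ q := by
    intro i
    simp only [c]
    split_ifs with h
    · rw [zero_pow (by omega), sub_zero]
      exact h
    · exact hr _
  obtain ⟨b, hb⟩ := exists_forall_dvd_cf 1 x
  have hc0 : ∀ i, i < b → c i = 0 := by
    intro i hi
    have := hb i hi
    rw [pow_one] at this
    exact if_pos (hπ.dvd_p.trans this)
  have hcβ : ∀ i, i < β → c i = 0 := by
    intro i hi
    have := hx i 0 (Nat.succ_pos _) (by simpa using hi)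
    rw [zero_add, pow_one] at this
    exact if_pos this
  have hkey : ∀ (j : ℕ) (d k : ℤ), k < -((j - d) / q) → (j : ℤ) + q * k < d := by
    intro j d k hk
    have h1 := Int.mul_ediv_add_emod ((j : ℤ) - d) q
    have h2 := Int.emod_nonneg ((j : ℤ) - d) (by omega : (q : ℤ) ≠ 0)
    have h3 := Int.emod_lt_of_pos ((j : ℤ) - d) (by omega : (0 : ℤ) < q)
    have h4 : k ≤ -((j - d) / q) - 1 := by omega
    have h5 : (q : ℤ) * k ≤ q * (-((j - d) / q) - 1) := by gcongr
    linarith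
  -- `g j` collects the exponents congruent to `j` modulo `q`; its lower bound is (b - j)/q rounded
  -- up, written through integer division.
  let g : ℕ → Gam p O := fun j => Gam.of p O
    (laurentMk (fun k => c (j + q * k)) (-((j - b) / q)) (fun k hk => hc0 _ (hkey j b k hk)))
  have hg : ∀ j k, cf p k (g j) = c (j + q * k) := fun j k => by rw [cf_of, laurentMk_coeff]
  have hdvd : ∀ i, π ∣ cf p i (x - ∑ j ∈ Finset.range q, Gam.single p j 1 * g j ^ q) := by
    intro i
    rw [map_sub, map_sum]
    have h2 := Int.emod_nonneg i (by omega : (q : ℤ) ≠ 0)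
    have h3 := Int.emod_lt_of_pos i (by omega : (0 : ℤ) < q)
    have hi := Int.mul_ediv_add_emod i q
    obtain ⟨j₀, hj₀⟩ := Int.eq_ofNat_of_zero_le h2
    have hj₀q : j₀ < q := by omega
    rw [← Finset.add_sum_erase _ _ (Finset.mem_range.2 hj₀q)]
    have h4 : π ∣ ∑ j ∈ (Finset.range q).erase j₀, cf p i (Gam.single p j 1 * g j ^ q) := by
      refine Finset.dvd_sum fun j hj => ?_
      have hj1 := Finset.ne_of_mem_erase hj
      have hj2 := Finset.mem_range.1 (Finset.mem_of_mem_erase hj)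
      rw [cf_single_mul, one_mul]
      have := hπ.dvd_cf_pow_sub N (g j) (i - j)
      rw [hqdef, if_neg, sub_zero] at this
      · exact this
      · rintro ⟨d, hd⟩
        apply hj1
        have : i % q = j := by
          have e : i = j + q * d := by omega
          rw [e, Int.add_mul_emod_self_left]
          exact Int.emod_eq_of_lt (by omega) (by omega)
        omega
    have h5 : π ∣ cf p i (Gam.single p j₀ 1 * g j₀ ^ q) - c i ^ q := by
      rw [cf_single_mul, one_mul]
      have := hπ.dvd_cf_pow_sub N (g j₀) (i - j₀)
      have e : i - j₀ = q * (i / q) := by omega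
      rw [hqdef, if_pos ⟨i / q, e⟩, e, Int.mul_ediv_cancel_left _ (by omega), ← e, hg, ← e,
        add_sub_cancel] at this
      exact this
    have := dvd_sub (dvd_sub (hc i) h5) h4
    convert this using 1
    ring
  obtain ⟨z, hz⟩ := hπ.dvd_of_cf (x := x - ∑ j ∈ Finset.range q, Gam.single p j 1 * g j ^ q) (N := 1)
    fun i => by rw [pow_one]; exact hdvd i
  rw [pow_one, sub_eq_iff_eq_add'] at hz
  refine ⟨g, z, hz, fun j k n hn h => ?_⟩
  rw [hg, hcβ]
  · exact dvd_zero _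
  · exact hkey j β k (by simpa using h)

end Frob

section Frob

variable {p : ℕ} [hp : Fact p.Prime] {O : Type u} [CommRing O] [IsDomain O]
  [IsDiscreteValuationRing O] [IsAdicComplete (Ideal.span {(p : O)}) O] {π : O}
  {σ₀ : O ≃+* O}

lemma CoeffUnif.mem_maximalIdeal_iff (hπ : CoeffUnif p π) (x : O) :
    x ∈ IsLocalRing.maximalIdeal O ↔ π ∣ x := by
  rw [(IsDiscreteValuationRing.irreducible_iff_uniformizer π).1 hπ.irred,
    Ideal.mem_span_singleton]

lemma CoeffUnif.mem_map_maximalIdeal_iff (hπ : CoeffUnif p π) (x : Gam p O) :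
    x ∈ (IsLocalRing.maximalIdeal O).map (Gam.C p O) ↔ Gam.C p O π ∣ x := by
  rw [(IsDiscreteValuationRing.irreducible_iff_uniformizer π).1 hπ.irred,
    Ideal.map_span, Set.image_singleton, Ideal.mem_span_singleton]

lemma CoeffUnif.dvd_frob (hσ₀ : LiftsFrobenius p σ₀) (hπ : CoeffUnif p π) : π ∣ σ₀ π := by
  have h := (hπ.mem_maximalIdeal_iff _).1 (hσ₀ π)
  have := dvd_add h (dvd_pow_self π hp.out.ne_zero)
  rwa [sub_add_cancel] at this

lemma CoeffUnif.associated_frob (hσ₀ : LiftsFrobenius p σ₀) (hπ : CoeffUnif p π) :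
    Associated π (σ₀ π) := by
  have h : Irreducible (σ₀ π) := (MulEquiv.irreducible_iff σ₀).2 hπ.irred
  exact hπ.irred.associated_of_dvd h (hπ.dvd_frob hσ₀)

namespace FrobLift

variable (σ : FrobLift p σ₀)

lemma dvd_sub_pow (hπ : CoeffUnif p π) (x : Gam p O) : Gam.C p O π ∣ σ.toHom x - x ^ p :=
  (hπ.mem_map_maximalIdeal_iff _).1 (σ.lifts x)

/-- A Frobenius lift maps series of order `≥ β` modulo `π ^ N` to series of order `≥ β - B`
modulo `π ^ N`, for a constant `B`. -/
lemma exists_growth_frob (hσ₀ : LiftsFrobenius p σ₀) (hπ : CoeffUnif p π) (N : ℕ) :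
    ∃ B : ℕ, ∀ (β : ℤ) (x : Gam p O), 0 ≤ β → Growth π 0 N β x →
      Growth π 0 N (β - B) (σ.toHom x) := by
  induction N with
  | zero => exact ⟨0, fun β x _ _ i n hn => absurd hn (Nat.not_lt_zero n)⟩
  | succ N ih =>
    obtain ⟨B, hB⟩ := ih
    obtain ⟨b, hb⟩ := exists_growth hπ.dvd_p 0 (N + 1) (σ.toHom (Gam.single p 1 1))
    -- With q = p^N, the term pq pays for the residues j < q and q|b| for the factors σ(t)^j. The
    -- assumption `0 ≤ β` enters through β ≤ pβ.
    refine ⟨B + (p * p ^ N + p ^ N * b.natAbs), fun β x hβ hx => ?_⟩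
    obtain ⟨g, z, hxz, hg⟩ := exists_sum_single_mul_pow hσ₀ hπ N N β x hx
    have hq : 1 ≤ p ^ N := Nat.one_le_pow _ _ hp.out.pos
    generalize hqdef : p ^ N = q at *
    have hq' : (1 : ℤ) ≤ q := by exact_mod_cast hq
    have hp' : (1 : ℤ) ≤ p := by exact_mod_cast hp.out.one_le
    have hceil : ∀ j : ℕ, β - j ≤ q * (-(((j : ℤ) - β) / q)) := by
      intro j
      have h1 := Int.mul_ediv_add_emod ((j : ℤ) - β) q
      have h2 := Int.emod_nonneg ((j : ℤ) - β) (by omega : (q : ℤ) ≠ 0)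
      linarith
    have hz : Growth π 0 N β z := by
      have h1 : Growth π 0 (N + 1) β (Gam.C p O π * z) := by
        rw [← add_sub_cancel_left (∑ j ∈ Finset.range q, Gam.single p j 1 * g j ^ q)
          (Gam.C p O π * z), ← hxz]
        refine hx.sub (Growth.sum _ fun j _ => ?_)
        refine ((growth_single (j : ℤ) 1 0 (N + 1)).mul hπ.dvd_p
          ((hg j).pow hπ.dvd_p q)).mono ?_
        linarith [hceil j]
      simpa using h1.of_unif_mul hπ.ne_zero
    rw [hxz, map_add, map_sum]
    refine Growth.add (Growth.sum _ fun j hj => ?_) ?_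
    · have hjq : (j : ℤ) < q := by exact_mod_cast Finset.mem_range.1 hj
      rw [map_mul, map_pow]
      have e1 : Gam.single p (j : ℤ) (1 : O) = Gam.single p 1 1 ^ j := by
        rw [← map_pow (Gam.of p O), HahnSeries.single_pow]
        simp
      rw [e1, map_pow]
      have h1 : Growth π 0 (N + 1) (β - p * q) (σ.toHom (g j) ^ q) := by
        -- σ(g) is known only modulo π, but its q-th power agrees with g^(pq) modulo π^(N+1), and
        -- the order of the latter is controlled.
        have h2 := pow_dvd_pow_prime_pow_sub hp.out (ϖ := Gam.C p O π)
          (by rw [← map_natCast (Gam.C p O)]; exact map_dvd _ hπ.dvd_p)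
          (σ.dvd_sub_pow hπ (g j)) N
        rw [hqdef] at h2
        obtain ⟨w, hw⟩ := h2
        rw [← sub_add_cancel (σ.toHom (g j) ^ q) ((g j ^ p) ^ q), hw, ← map_pow]
        refine (growth_unif_pow_mul w).add ?_
        rw [← pow_mul]
        refine ((hg j).pow hπ.dvd_p (p * q)).mono ?_
        have h3 : (p : ℤ) * (β - j) ≤ p * (q * (-(((j : ℤ) - β) / q))) :=
          mul_le_mul_of_nonneg_left (hceil j) (by omega)
        have h4 : (p : ℤ) * j ≤ p * q := mul_le_mul_of_nonneg_left hjq.le (by omega)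
        have h5 : 1 * β ≤ p * β := mul_le_mul_of_nonneg_right hp' hβ
        push_cast
        linarith
      refine ((hb.pow hπ.dvd_p j).mul hπ.dvd_p h1).mono ?_
      have h6 : (j : ℤ) * (-b) ≤ q * b.natAbs := by
        have h7 : -b ≤ (b.natAbs : ℤ) := by omega
        calc (j : ℤ) * (-b) ≤ j * b.natAbs := mul_le_mul_of_nonneg_left h7 (by omega)
          _ ≤ q * b.natAbs := mul_le_mul_of_nonneg_right hjq.le (by omega)
      push_cast at h6 ⊢
      have : (0 : ℤ) ≤ B := by positivity
      linarith
    · rw [map_mul, σ.compat]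
      obtain ⟨d, hd⟩ := hπ.dvd_frob hσ₀
      rw [hd, map_mul, mul_assoc]
      refine (((hB β z hβ hz).C_mul d).unif_mul).mono ?_
      push_cast
      have : (0 : ℤ) ≤ p * q + q * |b| := by positivity
      linarith

lemma tcont (hσ₀ : LiftsFrobenius p σ₀) (hπ : CoeffUnif p π) :
    TCont π (σ.toHom : Gam p O →+ Gam p O) := by
  intro N γ
  obtain ⟨B, hB⟩ := σ.exists_growth_frob hσ₀ hπ N
  exact ⟨max 0 (γ + B), fun x hx => (hB _ x (le_max_left _ _) hx).mono
    (by have := le_max_right 0 (γ + B); omega)⟩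

/-- The image of `t ^ i` under the Frobenius lift. -/
def frobMon (i : ℤ) : Gam p O := σ.toHom (Gam.single p i 1)

lemma frobMon_zero : σ.frobMon 0 = 1 := by
  rw [frobMon, Gam.single_zero, map_one]

lemma frobMon_add (i j : ℤ) : σ.frobMon (i + j) = σ.frobMon i * σ.frobMon j := by
  rw [frobMon, frobMon, frobMon, ← map_mul, Gam.single_mul_single, mul_one]

lemma frobMon_natCast_mul (i : ℤ) (n : ℕ) : σ.frobMon (n * i) = σ.frobMon i ^ n := by
  induction n with
  | zero => simp [frobMon_zero]
  | succ n ih => rw [pow_succ, ← ih, ← frobMon_add]; congr 1; push_cast; ring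

lemma toHom_single (k : ℤ) (a : O) :
    σ.toHom (Gam.single p k a) = Gam.C p O (σ₀ a) * σ.frobMon k := by
  rw [Gam.single_eq, map_mul, σ.compat, frobMon]

lemma exists_frobMon_one (hπ : CoeffUnif p π) : ∃ z ∈ GamCon p O,
    σ.frobMon 1 = Gam.single p p 1 + Gam.C p O π * z := by
  obtain ⟨z, hz⟩ := σ.dvd_sub_pow hπ (Gam.single p 1 1)
  have e : Gam.single p 1 (1 : O) ^ p = Gam.single p p 1 := by
    rw [← map_pow (Gam.of p O), HahnSeries.single_pow]
    simp
  rw [e] at hz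
  refine ⟨z, hπ.mem_gamCon_of_unif_mul ?_, by rw [← hz, frobMon]; ring⟩
  rw [← hz]
  exact (GamCon p O).sub_mem (σ.map_con _ (isOverconvergent_of p O _)) (isOverconvergent_of p O _)

/-- σ(t) = t^p (1 + t^(-p) πz) with `z` overconvergent. At slope pR with `R` large the bracket and
its inverse have nonnegative growth, so σ(t^i) is bounded like t^(pi) for both signs of `i`. -/
lemma exists_growth_frobMon (hπ : CoeffUnif p π) :
    ∃ R₀ : ℕ, ∀ R, R₀ ≤ R → ∀ (N : ℕ) (i : ℤ), Growth π (p * R) N (p * i) (σ.frobMon i) := by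
  obtain ⟨z, hz, h⟩ := σ.exists_frobMon_one hπ
  obtain ⟨R₁, β, hβ⟩ := (mem_gamCon_iff hπ).1 hz
  -- `R₁` is the slope of `z`; the rest ensures that the gain from π exceeds p - β, so that πz has
  -- growth at least p.
  refine ⟨R₁ + β.natAbs + p, fun R hR => ?_⟩
  have hp1 : 1 ≤ p := hp.out.one_le
  have hpR : R ≤ p * R := Nat.le_mul_of_pos_left R hp1
  have hz' : ∀ N, Growth π (p * R) N p (Gam.C p O π * z) := fun N =>
    (((hβ N).mono_slope (by omega : R₁ ≤ p * R)).unif_mul.mono (by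
      have : (R : ℤ) ≤ p * R := by exact_mod_cast hpR
      push_cast
      omega)).mono_level (Nat.le_succ N)
  have hx : ∀ N, Growth π (p * R) N 0 (Gam.single p (-p) 1 * (Gam.C p O π * z)) := fun N =>
    ((growth_single (-p : ℤ) (1 : O) (p * R) N).mul hπ.dvd_p (hz' N)).mono (by simp)
  have h1 : ∀ N, Growth π (p * R) N p (σ.frobMon 1) := fun N => by
    rw [h]
    exact (growth_single (p : ℤ) (1 : O) (p * R) N).add (hz' N)
  have h2 : ∀ N, Growth π (p * R) N (-p) (σ.frobMon (-1)) := by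
    intro N
    have e1 : Gam.single p (-p : ℤ) (1 : O) * Gam.single p p 1 = 1 := by
      rw [Gam.single_mul_single, neg_add_cancel, mul_one, Gam.single_zero]
    have e2 : σ.frobMon 1 * σ.frobMon (-1) = 1 := by
      rw [← frobMon_add, add_neg_cancel, frobMon_zero]
    have e3 : (1 + Gam.single p (-p : ℤ) 1 * (Gam.C p O π * z)) *
        (Gam.single p p 1 * σ.frobMon (-1)) = 1 := by
      have e5 := e2
      rw [h] at e5
      linear_combination e5 + (Gam.C p O π * z * σ.frobMon (-1)) * e1
    have h3 := growth_of_one_add_mul_eq_one hπ hx ⟨Gam.single p (-p) 1 * z, by ring⟩ e3 N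
    have e4 : σ.frobMon (-1) = Gam.single p (-p : ℤ) 1 * (Gam.single p p 1 * σ.frobMon (-1)) := by
      rw [← mul_assoc, e1, one_mul]
    rw [e4]
    exact ((growth_single (-p : ℤ) (1 : O) (p * R) N).mul hπ.dvd_p h3).mono (by simp)
  intro N i
  obtain ⟨n, rfl | rfl⟩ := Int.eq_nat_or_neg i
  · have e : σ.frobMon (n : ℤ) = σ.frobMon 1 ^ n := by rw [← frobMon_natCast_mul, mul_one]
    rw [e]
    exact ((h1 N).pow hπ.dvd_p n).mono (by linarith)
  · have e : σ.frobMon (-n : ℤ) = σ.frobMon (-1) ^ n := by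
      rw [← frobMon_natCast_mul, mul_neg, mul_one]
    rw [e]
    exact ((h2 N).pow hπ.dvd_p n).mono (by linarith)

lemma deriv_C_mul (a : O) (x : Gam p O) :
    Gam.deriv p O (Gam.C p O a * x) = Gam.C p O a * Gam.deriv p O x := by
  apply Gam.ext_cf
  intro i
  rw [cf_deriv, cf_C_mul, cf_C_mul, cf_deriv]
  ring

lemma deriv_single (k : ℤ) (a : O) :
    Gam.deriv p O (Gam.single p k a) = Gam.single p (k - 1) (k * a) := by
  apply Gam.ext_cf
  intro i
  rw [cf_deriv, cf_of, cf_of]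
  by_cases hi : i = k - 1
  · subst hi
    simp
  · rw [HahnSeries.coeff_single_of_ne hi, HahnSeries.coeff_single_of_ne (by omega), mul_zero]

lemma deriv_frobMon (hπ : CoeffUnif p π) (k : ℤ) :
    Gam.deriv p O (σ.frobMon k) =
      (k : Gam p O) * σ.frobMon (k - 1) * Gam.deriv p O (σ.frobMon 1) := by
  have e2 : σ.frobMon 1 * σ.frobMon (-1) = 1 := by
    rw [← frobMon_add, add_neg_cancel, frobMon_zero]
  have hs : ∀ k, σ.frobMon (k - 1) = σ.frobMon k * σ.frobMon (-1) := fun k => by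
    rw [← frobMon_add, sub_eq_add_neg]
  induction k with
  | zero =>
    have : (1 : Gam p O) = Gam.single p 0 1 := Gam.single_zero.symm
    rw [frobMon_zero, this, deriv_single]
    simp [Gam.single]
  | succ k ih =>
    rw [frobMon_add, Gam.deriv_mul hπ, ih, hs, add_sub_cancel_right]
    push_cast
    linear_combination ((k : Gam p O) * σ.frobMon k * Gam.deriv p O (σ.frobMon 1)) * e2
  | pred k ih =>
    have h1 : σ.frobMon (-k : ℤ) = σ.frobMon (-k - 1) * σ.frobMon 1 := by
      rw [← frobMon_add, sub_add_cancel]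
    have h2 := congrArg (Gam.deriv p O) h1
    rw [Gam.deriv_mul hπ, ih] at h2
    have h3 := hs (-k - 1)
    rw [h3]
    push_cast at h2 ⊢
    linear_combination (-σ.frobMon (-1)) * h2 -
      (Gam.deriv p O (σ.frobMon (-k - 1))) * e2

/-- The chain rule. -/
lemma deriv_toHom (hσ₀ : LiftsFrobenius p σ₀) (hπ : CoeffUnif p π) (x : Gam p O) :
    Gam.deriv p O (σ.toHom x) =
      Gam.deriv p O (σ.frobMon 1) * σ.toHom (Gam.deriv p O x) := by
  -- Continuity of the Frobenius lift reduces the chain rule to monomials.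
  have hc : TCont π ((Gam.deriv p O).comp (σ.toHom : Gam p O →+ Gam p O) -
      (AddMonoidHom.mulLeft (Gam.deriv p O (σ.frobMon 1))).comp
        ((σ.toHom : Gam p O →+ Gam p O).comp (Gam.deriv p O))) :=
    (tcont_deriv.comp (σ.tcont hσ₀ hπ)).sub
      ((tcont_mulLeft hπ.dvd_p _).comp ((σ.tcont hσ₀ hπ).comp tcont_deriv))
  have := hc.eq_zero hπ (fun k a => by
    change Gam.deriv p O (σ.toHom (Gam.single p k a)) -
      Gam.deriv p O (σ.frobMon 1) * σ.toHom (Gam.deriv p O (Gam.single p k a)) = 0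
    rw [toHom_single, deriv_C_mul, deriv_frobMon _ hπ, deriv_single, toHom_single, map_mul,
      map_intCast, map_mul, map_intCast]
    ring) x
  exact sub_eq_zero.1 this

/-- σ(t) is t^p modulo π, and t^p has derivative divisible by p. This factor makes the equation for
the defect of horizontality contracting. -/
lemma dvd_deriv_frobMon (hπ : CoeffUnif p π) : Gam.C p O π ∣ Gam.deriv p O (σ.frobMon 1) := by
  obtain ⟨z, _, h⟩ := σ.exists_frobMon_one hπ
  rw [h, map_add, deriv_C_mul, deriv_single, Gam.single_eq, mul_one]
  refine dvd_add (Dvd.dvd.mul_right (map_dvd _ ?_) _) (dvd_mul_right _ _)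
  exact_mod_cast hπ.dvd_p

end FrobLift

/-! ### Integration of overconvergent series -/

/-- By Bézout and locality the prime-to-p part of `m` is a unit of `O`, so only the power of p in
`m` matters. -/
lemma natCast_dvd_of_natCast_dvd (hp' : ¬ IsUnit (p : O)) (hp0 : (p : O) ≠ 0) {t m : ℕ}
    (hm : 0 < m) (h : (p : O) ^ t ∣ (m : O)) : p ^ t ≤ m := by
  obtain ⟨s, m', hm', rfl⟩ := Nat.exists_eq_pow_mul_and_not_dvd hm.ne' p hp.out.ne_one
  have h1 : IsUnit (m' : O) := by
    have h2 : IsCoprime (p : ℤ) (m' : ℤ) :=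
      Nat.isCoprime_iff_coprime.2 ((Nat.Prime.coprime_iff_not_dvd hp.out).2 hm')
    have h3 := h2.map (Int.castRingHom O)
    simp only [map_natCast] at h3
    obtain ⟨a, b, hab⟩ := h3
    rcases IsLocalRing.isUnit_or_isUnit_of_add_one hab with h4 | h4
    · exact absurd (isUnit_of_mul_isUnit_right h4) hp'
    · exact isUnit_of_mul_isUnit_right h4
  have h2 : (p : O) ^ t ∣ (p : O) ^ s := by
    rw [Nat.cast_mul, Nat.cast_pow] at h
    exact (IsUnit.dvd_mul_right h1).1 h
  have h3 : t ≤ s := (pow_dvd_pow_iff hp0 hp').1 h2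
  exact Nat.le_mul_of_pos_right _ (by
    rcases Nat.eq_zero_or_pos m' with h0 | h0
    · subst h0; simp at hm'
    · exact h0) |>.trans' (Nat.pow_le_pow_right hp.out.pos h3)

lemma succ_sq_le_four_mul_two_pow (t : ℕ) : (t + 1) ^ 2 ≤ 4 * 2 ^ t := by
  induction t with
  | zero => norm_num
  | succ t ih =>
    rcases t with _ | _ | t
    · norm_num
    · norm_num
    · change (t + 3) ^ 2 ≤ 4 * 2 ^ (t + 2) at ih
      change (t + 4) ^ 2 ≤ 4 * 2 ^ (t + 2 + 1)
      have h : (t + 4) ^ 2 ≤ 2 * (t + 3) ^ 2 := by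
        ring_nf
        omega
      rw [pow_succ 2]
      omega

lemma CoeffUnif.not_isUnit (hπ : CoeffUnif p π) : ¬ IsUnit (p : O) := fun h =>
  hπ.irred.not_isUnit (isUnit_of_dvd_unit hπ.dvd_p h)

lemma CoeffUnif.natCast_ne_zero (hπ : CoeffUnif p π) : (p : O) ≠ 0 := by
  obtain ⟨e, he⟩ := hπ.p_dvd
  exact fun h => pow_ne_zero e hπ.ne_zero (zero_dvd_iff.1 (h ▸ he))

/-- The valuation of an integer is bounded by any positive multiple of the integer, up to a
constant. -/
lemma CoeffUnif.exists_bound (hπ : CoeffUnif p π) (R : ℕ) :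
    ∃ C : ℕ, ∀ a m : ℕ, 0 < m → π ^ a ∣ (m : O) → R * a ≤ m + C := by
  obtain ⟨e, he⟩ := hπ.p_dvd
  -- Put K = Re and t = a / e. Then Ra ≤ K(t + 1), and 8K(t + 1) ≤ 16K² + (t + 1)² together with (t
  -- + 1)² ≤ 4 · 2^t ≤ 4m yields the constant 2K².
  refine ⟨2 * (R * e) ^ 2, fun a m hm h => ?_⟩
  have he0 : 0 < e := by
    rcases Nat.eq_zero_or_pos e with rfl | h0
    · exact absurd (isUnit_of_dvd_one (by simpa using he)) hπ.not_isUnit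
    · exact h0
  have h1 : (p : O) ^ (a / e) ∣ (m : O) :=
    (pow_dvd_pow_of_dvd he _).trans ((pow_mul π e _).symm.dvd.trans
      ((pow_dvd_pow π (Nat.mul_div_le a e)).trans h))
  have h2 := natCast_dvd_of_natCast_dvd hπ.not_isUnit hπ.natCast_ne_zero hm h1
  have h3 : 2 ^ (a / e) ≤ p ^ (a / e) := Nat.pow_le_pow_left hp.out.two_le _
  have h4 := succ_sq_le_four_mul_two_pow (a / e)
  have h5 : a ≤ e * (a / e + 1) := (Nat.lt_mul_div_succ a he0).le
  generalize a / e = t at *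
  have h6 : R * a ≤ R * e * (t + 1) := by rw [mul_assoc]; exact Nat.mul_le_mul_left _ h5
  generalize R * e = K at *
  have h7 : 8 * (K * (t + 1)) ≤ 16 * K ^ 2 + (t + 1) ^ 2 := by
    zify
    nlinarith [sq_nonneg (4 * (K : ℤ) - (t + 1))]
  omega

/-- A series with overconvergent derivative is overconvergent. -/
lemma CoeffUnif.mem_gamCon_of_deriv (hπ : CoeffUnif p π) {x : Gam p O}
    (h : Gam.deriv p O x ∈ GamCon p O) : x ∈ GamCon p O := by
  classical
  rw [mem_gamCon_iff hπ] at h ⊢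
  obtain ⟨R, β, h⟩ := h
  obtain ⟨C, hC⟩ := hπ.exists_bound (2 * R)
  -- Half of the slope serves the derivative, the other half the valuation `b` of the divisor `m`,
  -- for which 2Rb ≤ m + C. The minimum with 0 forces a negative index.
  refine ⟨2 * R, min 0 (2 * β - C), fun N i n hn hi => ?_⟩
  have h0 : (0 : ℤ) ≤ R * n := by positivity
  have hi0 := hi.trans_le (min_le_left _ _)
  have hi1 := hi.trans_le (min_le_right _ _)
  push_cast at hi0 hi1
  obtain ⟨m, rfl⟩ : ∃ m : ℕ, i = -m := ⟨i.natAbs, by rw [mul_assoc] at hi0; omega⟩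
  have hm : 0 < m := by rw [mul_assoc] at hi0; omega
  have hex : ∃ b, ¬ π ^ b ∣ (m : O) := by
    by_contra hcon
    push Not at hcon
    have h1 := hπ.eq_zero hcon
    obtain ⟨e, he⟩ := hπ.p_dvd
    have h2 : (p : O) ^ m ∣ (m : O) := by rw [h1]; exact dvd_zero _
    have h3 := natCast_dvd_of_natCast_dvd hπ.not_isUnit hπ.natCast_ne_zero hm h2
    exact absurd (Nat.lt_pow_self hp.out.one_lt) (by omega : ¬ m < p ^ m)
  obtain ⟨b, hb⟩ : ∃ b, Nat.find hex = b + 1 := by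
    rcases hb : Nat.find hex with _ | b
    · exact absurd (one_dvd _) (pow_zero π ▸ hb ▸ Nat.find_spec hex)
    · exact ⟨b, rfl⟩
  have hb1 : π ^ b ∣ (m : O) := by
    by_contra h1
    exact Nat.find_min hex (m := b) (by omega) h1
  have hb2 : ¬ π ^ (b + 1) ∣ (m : O) := hb ▸ Nat.find_spec hex
  obtain ⟨d, hd⟩ := hb1
  have hdu : IsUnit d := by
    apply hπ.isUnit_of_not_dvd
    rintro ⟨d', rfl⟩
    exact hb2 ⟨d', by rw [hd]; ring⟩
  have hbound := hC b m hm ⟨d, hd⟩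
  have h1 := h (n + b + 1) (-m - 1) (n + b) (Nat.lt_succ_self _) (by
    have : (2 * R * b : ℤ) ≤ m + C := by exact_mod_cast hbound
    push_cast
    linarith)
  rw [cf_deriv] at h1
  have h2 : (((-m - 1 : ℤ) : O) + 1) * cf p (-m - 1 + 1) x = π ^ b * (-d * cf p (-m) x) := by
    rw [sub_add_cancel]
    push_cast
    rw [hd]
    ring
  rw [h2, show n + b + 1 = b + (n + 1) by ring, pow_add,
    mul_dvd_mul_iff_left (pow_ne_zero _ hπ.ne_zero)] at h1
  exact (IsUnit.dvd_mul_left hdu.neg).1 h1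

end Frob

/-! ### A left inverse of Frobenius -/

section Psi

variable {p : ℕ} [hp : Fact p.Prime] {O : Type u} [CommRing O] [IsDomain O]
  [IsDiscreteValuationRing O] [IsAdicComplete (Ideal.span {(p : O)}) O] {π : O}
  {σ₀ : O ≃+* O}

lemma CoeffUnif.dvd_frob_symm (hσ₀ : LiftsFrobenius p σ₀) (hπ : CoeffUnif p π) {N : ℕ} {a : O}
    (h : π ^ N ∣ a) : π ^ N ∣ σ₀.symm a := by
  have h1 : (σ₀ π) ^ N ∣ a := (pow_dvd_pow_of_dvd (hπ.associated_frob hσ₀).symm.dvd N).trans h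
  have h2 := map_dvd σ₀.symm h1
  rwa [map_pow, RingEquiv.symm_apply_apply] at h2

namespace FrobLift

variable (σ : FrobLift p σ₀)

/-- When σ(t) = t^p this operator keeps the coefficients at multiples of p. In general σ(t^(-m)) has
growth -pm at slope pR, and reading off the constant coefficient divides both bound and slope by p.
-/
lemma exists_trace_fun (hσ₀ : LiftsFrobenius p σ₀) (hπ : CoeffUnif p π) :
    ∃ (ψ : Gam p O →+ Gam p O) (R₀ : ℕ),
      (∀ m y, cf p m (ψ y) = σ₀.symm (cf p 0 (y * σ.frobMon (-m)))) ∧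
      ∀ R, R₀ ≤ R → ∀ N β y, Growth π (p * R) N (p * β) y → Growth π R N β (ψ y) := by
  obtain ⟨R₀, hR₀⟩ := σ.exists_growth_frobMon hπ
  have hpp : (1 : ℤ) ≤ p := by exact_mod_cast hp.out.one_le
  have key : ∀ R, R₀ ≤ R → ∀ N (β : ℤ) y, Growth π (p * R) N (p * β) y →
      ∀ (i : ℤ) (n : ℕ), n < N → i + R * n < β →
        π ^ (n + 1) ∣ σ₀.symm (cf p 0 (y * σ.frobMon (-i))) := by
    intro R hR N β y hy i n hn h
    apply hπ.dvd_frob_symm hσ₀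
    refine (hy.mul hπ.dvd_p (hR₀ R hR N (-i))) 0 n hn ?_
    have : (p : ℤ) * (i + R * n) < p * β := mul_lt_mul_of_pos_left h (by omega)
    push_cast
    linarith
  have hex : ∀ y : Gam p O, ∃ x : Gam p O, ∀ m,
      cf p m x = σ₀.symm (cf p 0 (y * σ.frobMon (-m))) := by
    intro y
    apply exists_gam
    intro n
    obtain ⟨e, he⟩ := hπ.p_dvd
    obtain ⟨β, hβ⟩ := exists_growth hπ.dvd_p (p * R₀) (e * n) y
    rcases Nat.eq_zero_or_pos (e * n) with h0 | h0
    · refine ⟨0, fun i _ => ?_⟩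
      have h1 : (p : O) ^ n ∣ 1 := by
        have := pow_dvd_pow_of_dvd he n
        rwa [← pow_mul, h0, pow_zero] at this
      exact h1.trans (one_dvd _)
    refine ⟨-|β| - R₀ * (e * n : ℕ), fun i hi => ?_⟩
    have h1 := key R₀ le_rfl (e * n) (-|β|) y (hβ.mono (by
      have := neg_abs_le β
      have h2 := abs_nonneg β
      nlinarith)) i (e * n - 1) (by omega) (by
        have : (R₀ : ℤ) * (e * n - 1 : ℕ) ≤ R₀ * (e * n : ℕ) := by
          exact_mod_cast Nat.mul_le_mul_left R₀ (Nat.sub_le (e * n) 1)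
        omega)
    rw [Nat.sub_add_cancel h0, pow_mul] at h1
    exact (pow_dvd_pow_of_dvd he n).trans h1
  choose f hf using hex
  refine ⟨AddMonoidHom.mk' f fun x y => ?_, R₀, fun m y => hf y m, fun R hR N β y hy i n hn h => ?_⟩
  · apply Gam.ext_cf
    intro i
    rw [map_add, hf, hf, hf, add_mul, map_add, map_add]
  · change _ ∣ cf p i (f y)
    rw [hf]
    exact key R hR N β y hy i n hn h

/-- There is a left inverse `ψ` of the Frobenius lift, linear over it, and improving growth. -/
lemma exists_leftInverse (hσ₀ : LiftsFrobenius p σ₀) (hπ : CoeffUnif p π) :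
    ∃ (ψ : Gam p O →+ Gam p O) (R₀ : ℕ), ψ 1 = 1 ∧ (∀ x y, ψ (σ.toHom x * y) = x * ψ y) ∧
      ∀ R, R₀ ≤ R → ∀ N β y, Growth π (p * R) N (p * β) y → Growth π R N β (ψ y) := by
  obtain ⟨ψ, R₀, hcf, hψ⟩ := σ.exists_trace_fun hσ₀ hπ
  have hpp : (1 : ℤ) ≤ p := by exact_mod_cast hp.out.one_le
  have hcont : TCont π ψ := by
    intro N γ
    refine ⟨p * (γ + R₀ * N), fun x hx => ?_⟩
    exact (hψ R₀ le_rfl N (γ + R₀ * N) x (hx.mono_slope (Nat.zero_le _))).zero_slope.mono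
      (by linarith)
  have hlin : ∀ x y, ψ (σ.toHom x * y) = x * ψ y := by
    intro x y
    have hc : TCont π (ψ.comp ((AddMonoidHom.mulRight y).comp (σ.toHom : Gam p O →+ Gam p O)) -
        AddMonoidHom.mulRight (ψ y)) :=
      (hcont.comp ((tcont_mulRight hπ.dvd_p y).comp (σ.tcont hσ₀ hπ))).sub
        (tcont_mulRight hπ.dvd_p _)
    have := hc.eq_zero hπ (fun k a => by
      change ψ (σ.toHom (Gam.single p k a) * y) - Gam.single p k a * ψ y = 0
      rw [sub_eq_zero]
      apply Gam.ext_cf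
      intro m
      rw [hcf, cf_single_mul, hcf, toHom_single, mul_assoc, mul_assoc, cf_C_mul, map_mul,
        RingEquiv.symm_apply_apply]
      congr 3
      rw [mul_left_comm, ← frobMon_add, show -(m - k) = k + -m by ring]) x
    exact sub_eq_zero.1 this
  -- Modulo π, σ(t^(-m)) is t^(-pm), so ψ(1) is a 1-unit. Its inverse `c` has nonnegative growth at
  -- every slope `R ≥ R₀`, hence the normalisation preserves the growth estimate.
  have hone : ∃ z, ψ 1 - 1 = Gam.C p O π * z := by
    have := hπ.dvd_of_cf (x := ψ 1 - 1) (N := 1) (fun m => ?_)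
    · rwa [pow_one] at this
    have h1 : π ∣ cf p 0 (σ.frobMon (-m)) - cf p 0 (Gam.single p (-m * p) (1 : O)) := by
      obtain ⟨w, hw⟩ := σ.dvd_sub_pow hπ (Gam.single p (-m) 1)
      have e : Gam.single p (-m) (1 : O) ^ p = Gam.single p (-m * p) 1 := by
        rw [← map_pow (Gam.of p O), HahnSeries.single_pow, one_pow, nsmul_eq_mul, mul_comm]
      rw [← map_sub, frobMon, ← e, hw, cf_C_mul]
      exact dvd_mul_right _ _
    have h2 : cf p m (1 : Gam p O) = cf p 0 (Gam.single p (-m * p) (1 : O)) := by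
      rw [← Gam.single_zero, cf_of, cf_of]
      by_cases hm : m = 0
      · subst hm
        simp
      · rw [HahnSeries.coeff_single_of_ne hm, HahnSeries.coeff_single_of_ne]
        have : -m * (p : ℤ) ≠ 0 := mul_ne_zero (neg_ne_zero.2 hm) (by omega)
        exact this.symm
    have h3 : cf p m (1 : Gam p O) = σ₀.symm (cf p m (1 : Gam p O)) := by
      rw [← Gam.single_zero, cf_of]
      by_cases hm : m = 0
      · subst hm
        simp
      · rw [HahnSeries.coeff_single_of_ne hm, map_zero]
    have h4 := hπ.dvd_frob_symm hσ₀ (N := 1) ((pow_one π).dvd.trans h1)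
    rw [map_sub, hcf, h3, one_mul, h2, ← map_sub]
    exact h4
  obtain ⟨z, hz⟩ := hone
  have hu := isUnit_one_add_unif_mul hπ z
  rw [← hz, add_sub_cancel] at hu
  obtain ⟨c, hc⟩ := hu.exists_right_inv
  have hcg : ∀ R, R₀ ≤ R → ∀ N, Growth π R N 0 c := fun R hR N => by
    refine growth_of_one_add_mul_eq_one hπ (x := ψ 1 - 1) (fun N => ?_) ⟨z, hz⟩
      (by rw [add_sub_cancel]; exact hc) N
    exact (hψ R hR N 0 1 ((growth_one _ N).mono (by simp))).sub (growth_one R N)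
  refine ⟨(AddMonoidHom.mulLeft c).comp ψ, R₀, ?_, fun x y => ?_, fun R hR N β y hy => ?_⟩
  · change c * ψ 1 = 1
    rw [mul_comm, hc]
  · change c * ψ (σ.toHom x * y) = x * (c * ψ y)
    rw [hlin]
    ring
  · exact ((hcg R hR N).mul hπ.dvd_p (hψ R hR N β y hy)).mono (by simp)

end FrobLift

/-- Fixed points of an overconvergent matrix composed with a growth improving map are
overconvergent. -/
lemma mem_gamCon_of_fixed (hπ : CoeffUnif p π) {ψ : Gam p O →+ Gam p O} {R₀ : ℕ}
    (hψ : ∀ R, R₀ ≤ R → ∀ N β y, Growth π (p * R) N (p * β) y → Growth π R N β (ψ y))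
    {ι : Type*} [Fintype ι] (H : ι → ι → Gam p O) (hH : ∀ i j, H i j ∈ GamCon p O)
    (y : ι → Gam p O) (hy : ∀ i, y i = ψ (∑ j, H i j * y j)) (i : ι) : y i ∈ GamCon p O := by
  have hp2 : (2 : ℤ) ≤ p := by exact_mod_cast hp.out.two_le
  choose R₁ h₁ hRh using fun i j => (mem_gamCon_iff hπ).1 (hH i j)
  set R := R₀ + ∑ i, ∑ j, R₁ i j with hR
  set h : ℤ := -(∑ i, ∑ j, ((h₁ i j).natAbs : ℤ)) with hh
  have hpR : R ≤ p * R := Nat.le_mul_of_pos_left R hp.out.pos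
  have h0 : h ≤ 0 := by
    rw [hh, neg_nonpos]
    positivity
  have hHg : ∀ i j N, Growth π (p * R) N h (H i j) := by
    intro i j N
    have e1 : R₁ i j ≤ R := by
      have a1 : R₁ i j ≤ ∑ j, R₁ i j :=
        Finset.single_le_sum (f := fun j => R₁ i j) (fun _ _ => Nat.zero_le _) (Finset.mem_univ j)
      have a2 : ∑ j, R₁ i j ≤ ∑ i, ∑ j, R₁ i j :=
        Finset.single_le_sum (f := fun i => ∑ j, R₁ i j) (fun _ _ => Nat.zero_le _)
          (Finset.mem_univ i)
      omega
    have e2 : h ≤ h₁ i j := by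
      have a1 : ((h₁ i j).natAbs : ℤ) ≤ ∑ j, ((h₁ i j).natAbs : ℤ) :=
        Finset.single_le_sum (f := fun j => ((h₁ i j).natAbs : ℤ)) (fun _ _ => by positivity)
          (Finset.mem_univ j)
      have a2 : ∑ j, ((h₁ i j).natAbs : ℤ) ≤ ∑ i, ∑ j, ((h₁ i j).natAbs : ℤ) :=
        Finset.single_le_sum (f := fun i => ∑ j, ((h₁ i j).natAbs : ℤ)) (fun _ _ => by positivity)
          (Finset.mem_univ i)
      omega
    exact ((hRh i j N).mono_slope (e1.trans hpR)).mono e2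
  refine (mem_gamCon_iff hπ).2 ⟨R, h - p, fun N => ?_⟩
  choose b hb using fun i => exists_growth hπ.dvd_p R N (y i)
  have hbS : ∀ i, ((b i).natAbs : ℤ) ≤ ∑ i, ((b i).natAbs : ℤ) := fun i =>
    Finset.single_le_sum (f := fun i => ((b i).natAbs : ℤ)) (fun _ _ => by positivity)
      (Finset.mem_univ i)
  generalize ∑ i, ((b i).natAbs : ℤ) = S at hbS
  -- Each use of the equation gains one, because p(β + 1) ≤ h + β when β ≤ h - p ≤ 0 and p ≥ 2. The
  -- start -S depends on `N`, but the final bound h - p does not.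
  have key : ∀ n : ℕ, ∀ i, Growth π R N (min (h - p) (-S + n)) (y i) := by
    intro n
    induction n with
    | zero =>
      intro i
      refine (hb i).mono ((min_le_right _ _).trans ?_)
      have := hbS i
      push_cast
      omega
    | succ n ih =>
      intro i
      set β := min (h - p) (-S + n) with hβ
      have hβ' : β ≤ h - p := min_le_left _ _
      have h2 : Growth π (p * R) N (h + β) (∑ j, H i j * y j) :=
        Growth.sum _ fun j _ => (hHg i j N).mul hπ.dvd_p ((ih j).mono_slope hpR)
      rw [hy i]
      refine (hψ R (Nat.le_add_right _ _) N (β + 1) _ (h2.mono ?_)).mono ?_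
      · nlinarith
      · push_cast
        omega
  have h5 := key ((h - p + S).natAbs) i
  refine h5.mono (le_min le_rfl ?_)
  omega

end Psi

/-! ### The direct limit of an injective endomorphism -/

namespace Colim

variable {A : Type u} [CommRing A] (τ : A →+* A)

/-- The inclusion of the `n`-th copy of `A`. -/
def ofNat (n : ℕ) : A →+* Colim τ :=
  Ring.DirectLimit.of (fun _ : ℕ => A) (fun i j _ => ((τ ^ (j - i) : A →+* A) : A → A)) n

lemma of_eq : Colim.of τ = ofNat τ 0 := rfl

instance : DirectedSystem (fun _ : ℕ => A) (fun i j (_ : i ≤ j) => ⇑(τ ^ (j - i) : A →+* A)) where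
  map_self i x := by simp
  map_map k j i hij hjk x := by
    change (τ ^ (k - j) * τ ^ (j - i)) x = _
    rw [← pow_add, show k - j + (j - i) = k - i by omega]

lemma ofNat_add_pow (n k : ℕ) (x : A) : ofNat τ (n + k) ((τ ^ k) x) = ofNat τ n x := by
  have := Ring.DirectLimit.of_f (G := fun _ : ℕ => A)
    (f := fun i j _ => ((τ ^ (j - i) : A →+* A) : A → A)) (Nat.le_add_right n k) x
  simp only [Nat.add_sub_cancel_left] at this
  exact this

lemma exists_ofNat (z : Colim τ) : ∃ n x, ofNat τ n x = z :=
  Ring.DirectLimit.exists_of z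

lemma frob_ofNat (n : ℕ) (x : A) : frob τ (ofNat τ n x) = ofNat τ n (τ x) :=
  Ring.DirectLimit.map_apply_of (G := fun _ : ℕ => A) (G' := fun _ : ℕ => A)
      (f := fun i j _ => τ ^ (j - i)) (f' := fun i j _ => τ ^ (j - i))
      (fun _ => τ) _ (i := n) x

lemma frob_pow_ofNat (n : ℕ) (x : A) : (frob τ ^ n) (ofNat τ n x) = of τ x := by
  have h : ∀ m, (frob τ ^ m) (ofNat τ n x) = ofNat τ n ((τ ^ m) x) := by
    intro m
    induction m with
    | zero => rfl
    | succ m ih => rw [pow_succ', pow_succ', RingHom.coe_mul, RingHom.coe_mul, Function.comp_apply,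
        ih, frob_ofNat, Function.comp_apply]
  rw [h, of_eq, ← ofNat_add_pow τ 0 n x, zero_add]

variable {τ}

lemma pow_injective (hτ : Function.Injective τ) (n : ℕ) : Function.Injective (τ ^ n) := by
  induction n with
  | zero => exact fun _ _ h => h
  | succ n ih => rw [pow_succ, RingHom.coe_mul]; exact ih.comp hτ

lemma ofNat_injective (hτ : Function.Injective τ) (n : ℕ) : Function.Injective (ofNat τ n) :=
  Ring.DirectLimit.of_injective (fun i j (_ : i ≤ j) => τ ^ (j - i))
    (fun i j _ => pow_injective hτ (j - i)) n

/-- Two elements of the direct limit come from a common copy. -/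
lemma exists_ofNat₂ (y z : Colim τ) : ∃ n a b, ofNat τ n a = y ∧ ofNat τ n b = z := by
  obtain ⟨n, a, rfl⟩ := exists_ofNat τ y
  obtain ⟨m, b, rfl⟩ := exists_ofNat τ z
  exact ⟨n + m, (τ ^ m) a, (τ ^ n) b, ofNat_add_pow τ n m a, by
    rw [add_comm, ofNat_add_pow]⟩

/-- A quotient lives in some other copy of `A`; both sides are moved to a common copy, and the
powers of `τ` are then removed by `hq`. -/
lemma natCast_dvd_ofNat_iff (hτ : Function.Injective τ) {q : ℕ}
    (hq : ∀ x, (q : A) ∣ τ x → (q : A) ∣ x) (n : ℕ) (x : A) :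
    (q : Colim τ) ∣ ofNat τ n x ↔ (q : A) ∣ x := by
  constructor
  · rintro ⟨z, hz⟩
    obtain ⟨m, y, rfl⟩ := exists_ofNat τ z
    rw [← map_natCast (ofNat τ m), ← map_mul, ← ofNat_add_pow τ n m x,
      ← ofNat_add_pow τ m n, add_comm m n] at hz
    have h1 := ofNat_injective hτ _ hz
    have hqk : ∀ k x, (q : A) ∣ (τ ^ k) x → (q : A) ∣ x := by
      intro k
      induction k with
      | zero => exact fun x h => h
      | succ k ih =>
        intro x h
        rw [pow_succ, RingHom.coe_mul] at h
        exact hq _ (ih _ h)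
    apply hqk m
    rw [h1, map_mul, map_natCast]
    exact dvd_mul_right _ _
  · intro h
    rw [← map_natCast (ofNat τ n)]
    exact map_dvd _ h

/-- The additive map on the direct limit given by the iterates of a left inverse of `τ`. -/
lemma exists_retraction (hτ : Function.Injective τ) (ψ : A →+ A) (hψ : ∀ x, ψ (τ x) = x) :
    ∃ f : Colim τ →+ A, ∀ n x, f (ofNat τ n x) = ψ^[n] x := by
  have hk : ∀ (n k : ℕ) x, ψ^[n + k] ((τ ^ k) x) = ψ^[n] x := by
    intro n k x
    rw [Function.iterate_add_apply]
    congr 1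
    induction k with
    | zero => rfl
    | succ k ih =>
      rw [Function.iterate_succ_apply, pow_succ', RingHom.coe_mul, Function.comp_apply, hψ, ih]
  have hwd : ∀ n m x y, ofNat τ n x = ofNat τ m y → ψ^[n] x = ψ^[m] y := by
    intro n m x y h
    rw [← ofNat_add_pow τ n m x, ← ofNat_add_pow τ m n y, add_comm m n] at h
    rw [← hk n m, ← hk m n, ofNat_injective hτ _ h, add_comm m n]
  choose N X hNX using exists_ofNat τ
  have hf : ∀ n x, ψ^[N (ofNat τ n x)] (X (ofNat τ n x)) = ψ^[n] x :=
    fun n x => hwd _ _ _ _ (hNX _)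
  refine ⟨AddMonoidHom.mk' (fun z => ψ^[N z] (X z)) fun y z => ?_, hf⟩
  obtain ⟨n, a, b, rfl, rfl⟩ := exists_ofNat₂ y z
  rw [← map_add, hf, hf, hf]
  exact iterate_map_add ψ n a b

end Colim

/-! ### Completions of almost discrete valuation rings -/

section

variable {p : ℕ} {R : Type u} [CommRing R]

/-- Additive maps from a completion to a complete ring are determined by their restriction. -/
lemma PComp.addHom_ext {S : Type v} [CommRing S] [IsAdicComplete (Ideal.span {(p : S)}) S]
    {f g : PComp p R →+ S}
    (h : ∀ y, f (algebraMap R (PComp p R) y) = g (algebraMap R (PComp p R) y)) (x : PComp p R) :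
    f x = g x := by
  rw [← sub_eq_zero]
  apply eq_zero_of_forall_pow_dvd p
  intro n
  obtain ⟨y, hy⟩ := PComp.exists_dvd_sub p n x
  have := dvd_sub (dvd_map_sub p f hy) (dvd_map_sub p g hy)
  rwa [h, sub_sub_sub_cancel_right] at this

/-- The dichotomy and the absence of p-torsion pass to the completion by approximation modulo powers
of p, whereas separatedness is not assumed of `R` and is supplied by the completion. -/
lemma PComp.isUnif {ϖ : R} (hp' : ¬ IsUnit (p : R)) (htf : ∀ x : R, (p : R) * x = 0 → x = 0)
    (hϖp : ϖ ∣ (p : R)) {e : ℕ} (hpϖ : (p : R) ∣ ϖ ^ e) (hϖ : ∀ x, ϖ ∣ x ∨ IsUnit x) :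
    IsUnif (algebraMap R (PComp p R) ϖ) where
  not_isUnit h := by
    apply hp'
    rw [isUnit_iff_dvd_one]
    have h1 : IsUnit (p : PComp p R) := by
      have h2 := map_dvd (algebraMap R (PComp p R)) hpϖ
      rw [map_natCast, map_pow] at h2
      exact isUnit_of_dvd_unit h2 (h.pow e)
    have := (PComp.pow_dvd_algebraMap_iff p 1 (1 : R)).1 (by rw [pow_one]; exact h1.dvd)
    rwa [pow_one] at this
  eq_zero x hx := by
    have h1 : (p : PComp p R) * x = 0 := by
      obtain ⟨c, hc⟩ := hϖp
      have : (p : PComp p R) = algebraMap R (PComp p R) ϖ * algebraMap R (PComp p R) c := by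
        rw [← map_mul, ← hc, map_natCast]
      rw [this, mul_right_comm, hx, zero_mul]
    apply eq_zero_of_forall_pow_dvd p
    intro n
    -- One power of p is lost when `p` is cancelled from `p * y`.
    obtain ⟨y, c, hc⟩ := PComp.exists_dvd_sub p (n + 1) x
    have h2 : (p : PComp p R) ^ (n + 1) ∣ algebraMap R (PComp p R) (p * y) := by
      refine ⟨-p * c, ?_⟩
      rw [map_mul, map_natCast]
      linear_combination h1 - p * hc
    rw [PComp.pow_dvd_algebraMap_iff] at h2
    obtain ⟨d, hd⟩ := h2
    have h3 : y = p ^ n * d := by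
      rw [← sub_eq_zero]
      apply htf
      linear_combination hd
    refine ⟨p * c + algebraMap R (PComp p R) d, ?_⟩
    rw [h3, map_mul, map_pow, map_natCast] at hc
    linear_combination hc
  dvd_or_isUnit x := by
    obtain ⟨y, c, hc⟩ := PComp.exists_dvd_sub p 1 x
    rw [pow_one] at hc
    rcases hϖ y with h | h
    · left
      have h1 : algebraMap R (PComp p R) ϖ ∣ (p : PComp p R) := by
        rw [← map_natCast (algebraMap R (PComp p R))]
        exact map_dvd _ hϖp
      have := dvd_add (h1.mul_right c) (map_dvd (algebraMap R (PComp p R)) h)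
      rwa [← hc, sub_add_cancel] at this
    · right
      obtain ⟨y', hy'⟩ := (h.map (algebraMap R (PComp p R))).exists_right_inv
      have h1 : x = algebraMap R (PComp p R) y * (1 + p * (c * y')) := by
        linear_combination hc - (p * c) * hy'
      rw [h1]
      exact (h.map _).mul (isUnit_one_add_of_dvd p (dvd_mul_right _ _))
  sep x hx := by
    apply eq_zero_of_forall_pow_dvd p
    intro n
    have h1 : (p : PComp p R) ∣ algebraMap R (PComp p R) ϖ ^ e := by
      rw [← map_natCast (algebraMap R (PComp p R)), ← map_pow]
      exact map_dvd _ hpϖ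
    exact (pow_dvd_pow_of_dvd h1 n).trans ((pow_mul _ e n).symm.dvd.trans (hx (e * n)))

end

/-! ### The ring `Γ^perf` -/

section Perf

variable {p : ℕ} [hp : Fact p.Prime] {O : Type u} [CommRing O] [IsDomain O]
  [IsDiscreteValuationRing O] [IsAdicComplete (Ideal.span {(p : O)}) O] {π : O}
  {σ₀ : O ≃+* O} (σ : FrobLift p σ₀)

namespace FrobLift

lemma associated_toHom_unif (hσ₀ : LiftsFrobenius p σ₀) (hπ : CoeffUnif p π) :
    Associated (Gam.C p O π) (σ.toHom (Gam.C p O π)) := by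
  rw [σ.compat]
  exact (hπ.associated_frob hσ₀).map (Gam.C p O)

lemma isUnit_of_isUnit_toHom (hσ₀ : LiftsFrobenius p σ₀) (hπ : CoeffUnif p π) {x : Gam p O}
    (h : IsUnit (σ.toHom x)) : IsUnit x := by
  rcases hπ.isUnif_gam.dvd_or_isUnit x with h1 | h1
  · have h2 := (σ.associated_toHom_unif hσ₀ hπ).dvd.trans (map_dvd σ.toHom h1)
    exact absurd (isUnit_of_dvd_unit h2 h) hπ.isUnif_gam.not_isUnit
  · exact h1

lemma toHom_injective (hσ₀ : LiftsFrobenius p σ₀) (hπ : CoeffUnif p π) :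
    Function.Injective σ.toHom := by
  rw [injective_iff_map_eq_zero]
  intro x hx
  by_contra h0
  have := hπ.isUnif_gam.isDomain
  obtain ⟨n, w, rfl⟩ := hπ.isUnif_gam.exists_eq_pow_mul h0
  rw [map_mul, map_pow] at hx
  rcases mul_eq_zero.1 hx with h1 | h1
  · obtain ⟨c, hc⟩ := (σ.associated_toHom_unif hσ₀ hπ).symm.dvd
    exact hπ.isUnif_gam.ne_zero (by rw [hc, eq_zero_of_pow_eq_zero h1, zero_mul])
  · exact (w.isUnit.map σ.toHom).ne_zero h1

/-- In the valuation ring Γ the alternative is n = xc. Applying σ makes σ(c) a unit unless n = 0,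
and σ reflects units. -/
lemma natCast_dvd_of_dvd_toHom (hσ₀ : LiftsFrobenius p σ₀) (hπ : CoeffUnif p π) (n : ℕ)
    {x : Gam p O} (h : (n : Gam p O) ∣ σ.toHom x) : (n : Gam p O) ∣ x := by
  have hd := hπ.isUnif_gam.isDomain
  have hdvr := hπ.isUnif_gam.isDiscreteValuationRing
  rcases ValuationRing.dvd_total (n : Gam p O) x with h1 | ⟨c, hc⟩
  · exact h1
  · obtain ⟨d, hd⟩ := h
    by_cases hn : (n : Gam p O) = 0
    · rw [hn, zero_mul] at hd
      rw [σ.toHom_injective hσ₀ hπ (hd.trans (map_zero _).symm)]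
      exact dvd_zero _
    have h2 := congrArg σ.toHom hc
    rw [map_natCast, map_mul, hd, mul_assoc] at h2
    have h3 : IsUnit (σ.toHom c) :=
      IsUnit.of_mul_eq_one_right _ (mul_left_cancel₀ hn (h2.symm.trans (mul_one _).symm))
    obtain ⟨c', hc'⟩ := (σ.isUnit_of_isUnit_toHom hσ₀ hπ h3).exists_right_inv
    exact ⟨c', by rw [hc, mul_assoc, hc', mul_one]⟩

lemma natCast_ne_zero_gam (hπ : CoeffUnif p π) : (p : Gam p O) ≠ 0 := by
  intro h
  have h1 := congrArg (cf p 0) h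
  rw [← map_natCast (Gam.C p O), map_zero] at h1
  have h2 : cf p 0 (Gam.C p O (p : O)) = (p : O) := by
    change cf p 0 (Gam.single p 0 (p : O)) = _
    rw [cf_of]
    simp
  exact hπ.natCast_ne_zero (h2.symm.trans h1)

lemma not_isUnit_natCast_gam (hπ : CoeffUnif p π) : ¬ IsUnit (p : Gam p O) := fun h =>
  hπ.isUnif_gam.not_isUnit (isUnit_of_dvd_unit
    (by rw [← map_natCast (Gam.C p O)]; exact map_dvd _ hπ.dvd_p) h)

/-- σ multiplies π by a unit, so π has associated images from all copies of Γ, and the dichotomy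
holds in each copy. -/
lemma unif_dvd_colim (hσ₀ : LiftsFrobenius p σ₀) (hπ : CoeffUnif p π) (z : Colim σ.toHom) :
    Colim.of σ.toHom (Gam.C p O π) ∣ z ∨ IsUnit z := by
  obtain ⟨n, x, rfl⟩ := Colim.exists_ofNat _ z
  rcases hπ.isUnif_gam.dvd_or_isUnit x with h | h
  · left
    refine dvd_trans ?_ (map_dvd (Colim.ofNat σ.toHom n) h)
    rw [Colim.of_eq, ← Colim.ofNat_add_pow σ.toHom 0 n, zero_add]
    apply map_dvd
    have : ∀ n, Associated (Gam.C p O π) ((σ.toHom ^ n) (Gam.C p O π)) := by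
      intro n
      induction n with
      | zero => exact Associated.refl _
      | succ n ih =>
        rw [pow_succ', RingHom.coe_mul, Function.comp_apply]
        exact (σ.associated_toHom_unif hσ₀ hπ).trans (ih.map σ.toHom)
    exact (this n).symm.dvd
  · exact Or.inr (h.map _)

lemma natCast_pow_dvd_colim_iff (hσ₀ : LiftsFrobenius p σ₀) (hπ : CoeffUnif p π) (N n : ℕ)
    (x : Gam p O) :
    (p : Colim σ.toHom) ^ N ∣ Colim.ofNat σ.toHom n x ↔ (p : Gam p O) ^ N ∣ x := by
  have := Colim.natCast_dvd_ofNat_iff (σ.toHom_injective hσ₀ hπ) (q := p ^ N)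
    (fun x h => σ.natCast_dvd_of_dvd_toHom hσ₀ hπ _ h) n x
  push_cast at this
  exact this

/-- `Γ^perf` is a discrete valuation ring with the uniformizer of `O`. -/
lemma isUnif_perf (hσ₀ : LiftsFrobenius p σ₀) (hπ : CoeffUnif p π) :
    IsUnif (GamPerf.C σ π) := by
  obtain ⟨e, he⟩ := hπ.p_dvd
  have hd := hπ.isUnif_gam.isDomain
  refine PComp.isUnif (R := Colim σ.toHom) ?_ ?_ ?_ (e := e) ?_ (σ.unif_dvd_colim hσ₀ hπ)
  · intro h
    have h1 := (σ.natCast_pow_dvd_colim_iff hσ₀ hπ 1 0 1).1 (by rw [pow_one]; exact h.dvd)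
    rw [pow_one] at h1
    exact not_isUnit_natCast_gam hπ (isUnit_of_dvd_one h1)
  · intro z hz
    obtain ⟨n, x, rfl⟩ := Colim.exists_ofNat _ z
    rw [← map_natCast (Colim.ofNat σ.toHom n), ← map_mul] at hz
    have h1 := Colim.ofNat_injective (σ.toHom_injective hσ₀ hπ) n (hz.trans (map_zero _).symm)
    rw [(mul_eq_zero.1 h1).resolve_left (natCast_ne_zero_gam hπ), map_zero]
  · rw [← map_natCast ((Colim.of σ.toHom).comp (Gam.C p O))]
    exact map_dvd ((Colim.of σ.toHom).comp (Gam.C p O)) hπ.dvd_p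
  · have h := map_dvd ((Colim.of σ.toHom).comp (Gam.C p O)) he
    rwa [map_natCast, map_pow] at h

lemma pow_dvd_of_iff (hσ₀ : LiftsFrobenius p σ₀) (hπ : CoeffUnif p π) (N : ℕ) (x : Gam p O) :
    (p : GamPerf σ) ^ N ∣ GamPerf.of σ x ↔ (p : Gam p O) ^ N ∣ x :=
  (PComp.pow_dvd_algebraMap_iff p N _).trans (σ.natCast_pow_dvd_colim_iff hσ₀ hπ N 0 x)

/-- `Γ` is closed in `Γ^perf`. -/
lemma exists_of_eq (hσ₀ : LiftsFrobenius p σ₀) (hπ : CoeffUnif p π) {z : GamPerf σ}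
    (h : ∀ n : ℕ, ∃ y, (p : GamPerf σ) ^ n ∣ z - GamPerf.of σ y) : ∃ y, GamPerf.of σ y = z := by
  choose y hy using h
  obtain ⟨l, hl⟩ := exists_limit p y (fun n => by
    rw [← σ.pow_dvd_of_iff hσ₀ hπ, map_sub]
    have := dvd_sub (hy n) ((pow_dvd_pow _ n.le_succ).trans (hy (n + 1)))
    rwa [sub_sub_sub_cancel_left] at this)
  refine ⟨l, ?_⟩
  rw [eq_comm, ← sub_eq_zero]
  apply eq_zero_of_forall_pow_dvd p
  intro n
  have := dvd_sub (hy n) ((σ.pow_dvd_of_iff hσ₀ hπ n _).2 (hl n))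
  rwa [map_sub, sub_sub_eq_add_sub, sub_add_cancel] at this

lemma frob_algebraMap (y : Colim σ.toHom) :
    GamPerf.frob σ (algebraMap _ _ y) = algebraMap _ _ (Colim.frob σ.toHom y) := rfl

/-- Elements of `Γ^perf` are moved close to `Γ_con` by powers of Frobenius. -/
lemma exists_frob_pow_sub (z : GamPerf σ) (n : ℕ) : ∃ (m : ℕ) (y : GamCon p O),
    (p : GamPerf σ) ^ n ∣ (GamPerf.frob σ ^ m) z - GamPerf.of σ y := by
  obtain ⟨w, hw⟩ := PComp.exists_dvd_sub p n z
  -- The `m`-th copy of Γ is moved into Γ by σ^m, and in Γ the Laurent series, which are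
  -- overconvergent, are dense.
  obtain ⟨m, x, rfl⟩ := Colim.exists_ofNat _ w
  obtain ⟨y, hy⟩ := Gam.exists_dvd_sub n x
  refine ⟨m, ⟨Gam.of p O y, isOverconvergent_of p O y⟩, ?_⟩
  have h1 : ∀ k (w : Colim σ.toHom), (GamPerf.frob σ ^ k) (algebraMap _ _ w) =
      algebraMap _ _ ((Colim.frob σ.toHom ^ k) w) := by
    intro k
    induction k with
    | zero => exact fun _ => rfl
    | succ k ih =>
      intro w
      rw [pow_succ', pow_succ', RingHom.coe_mul, RingHom.coe_mul, Function.comp_apply, ih,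
        frob_algebraMap, Function.comp_apply]
  have h2 := dvd_map_sub p ((GamPerf.frob σ ^ m : GamPerf σ →+* GamPerf σ) :
    GamPerf σ →+ GamPerf σ) hw
  have h3 : (GamPerf.frob σ ^ m) (algebraMap _ _ (Colim.ofNat σ.toHom m x)) = GamPerf.of σ x := by
    rw [h1, Colim.frob_pow_ofNat]
    rfl
  have h4 := pow_dvd_map p (GamPerf.of σ : Gam p O →+ GamPerf σ) n hy
  change _ ∣ (GamPerf.frob σ ^ m) z - (GamPerf.frob σ ^ m) _ at h2
  change _ ∣ GamPerf.of σ _ at h4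
  rw [h3] at h2
  rw [map_sub] at h4
  have := dvd_add h2 h4
  rwa [sub_add_sub_cancel] at this

/-- There is a `Γ`-linear retraction `Γ^perf → Γ` which maps fixed points of an overconvergent
matrix composed with Frobenius to overconvergent series. -/
lemma exists_retraction (hσ₀ : LiftsFrobenius p σ₀) (hπ : CoeffUnif p π) :
    ∃ Θ : GamPerf σ →+ Gam p O, Θ 1 = 1 ∧ (∀ x z, Θ (GamPerf.of σ x * z) = x * Θ z) ∧
      ∀ {n : ℕ} (W : Fin n → GamPerf σ) (H : Fin n → Fin n → GamCon p O),
        (∀ i, GamPerf.frob σ (W i) = ∑ j, GamPerf.of σ (H i j) * W j) →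
        ∀ i, Θ (W i) ∈ GamCon p O := by
  obtain ⟨ψ, R₀, hψ1, hψl, hψg⟩ := σ.exists_leftInverse hσ₀ hπ
  have hψσ : ∀ x, ψ (σ.toHom x) = x := fun x => by
    have := hψl x 1
    rwa [mul_one, hψ1, mul_one] at this
  obtain ⟨f, hf⟩ := Colim.exists_retraction (σ.toHom_injective hσ₀ hπ) ψ hψσ
  let Θ : GamPerf σ →+ Gam p O := (PComp.lim p).comp (PComp.mapAdd p f)
  have hΘ : ∀ w, Θ (algebraMap _ _ w) = f w := fun w => by
    change PComp.lim p (PComp.mapAdd p f _) = _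
    rw [PComp.mapAdd_algebraMap, PComp.lim_algebraMap]
  have hlin : ∀ x z, Θ (GamPerf.of σ x * z) = x * Θ z := by
    intro x z
    refine PComp.addHom_ext (f := Θ.comp (AddMonoidHom.mulLeft (GamPerf.of σ x)))
      (g := (AddMonoidHom.mulLeft x).comp Θ) (fun w => ?_) z
    obtain ⟨n, y, rfl⟩ := Colim.exists_ofNat _ w
    change Θ (algebraMap _ _ (Colim.of σ.toHom x) * algebraMap _ _ _) = x * Θ (algebraMap _ _ _)
    rw [← map_mul, hΘ, hΘ, Colim.of_eq, ← Colim.ofNat_add_pow σ.toHom 0 n, zero_add, ← map_mul,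
      hf, hf]
    clear hf
    induction n generalizing y with
    | zero => rfl
    | succ n ih =>
      rw [Function.iterate_succ_apply, Function.iterate_succ_apply, pow_succ', RingHom.coe_mul,
        Function.comp_apply, hψl, ih]
  -- On the n-th copy Θ is ψ^n and Frobenius acts by σ, so the identity is ψ^(n+1)σ = ψ^n.
  have hfix : ∀ z, ψ (Θ (GamPerf.frob σ z)) = Θ z := by
    intro z
    refine PComp.addHom_ext (f := ψ.comp (Θ.comp (GamPerf.frob σ : GamPerf σ →+ GamPerf σ)))
      (g := Θ) (fun w => ?_) z
    obtain ⟨n, y, rfl⟩ := Colim.exists_ofNat _ w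
    change ψ (Θ (GamPerf.frob σ _)) = _
    rw [frob_algebraMap, Colim.frob_ofNat, hΘ, hΘ, hf, hf, ← Function.iterate_succ_apply' ψ n,
      Function.iterate_succ_apply, hψσ]
  refine ⟨Θ, ?_, hlin, fun W H hW i => ?_⟩
  · have h1 : (1 : GamPerf σ) = algebraMap _ _ (Colim.ofNat σ.toHom 0 1) := by
      rw [map_one, map_one]
    rw [h1, hΘ, hf]
    rfl
  · refine mem_gamCon_of_fixed hπ hψg (fun i j => (H i j : Gam p O)) (fun i j => (H i j).2)
      (fun i => Θ (W i)) (fun i => ?_) i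
    rw [← hfix, hW, map_sum]
    simp only [hlin]

end FrobLift

end Perf

/-! ### Inverting `p` -/

/-- `K` is obtained from its subring `R` by inverting `p`. -/
structure IsInvert (p : ℕ) (R : Type u) (K : Type v) [CommRing R] [Field K] [Algebra R K] :
    Prop where
  injective : Function.Injective (algebraMap R K)
  ne_zero : (p : K) ≠ 0
  exists_mul : ∀ z : K, ∃ (n : ℕ) (x : R), (p : K) ^ n * z = algebraMap R K x

lemma IsUnif.isInvert {p : ℕ} {A : Type u} [CommRing A] [IsDomain A] {ϖ : A} (h : IsUnif ϖ)
    (hp : ϖ ∣ (p : A)) (hp0 : (p : A) ≠ 0) (K : Type v) [Field K] [Algebra A K]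
    [IsFractionRing A K] : IsInvert p A K where
  injective := IsFractionRing.injective A K
  ne_zero := by
    rw [← map_natCast (algebraMap A K)]
    exact fun h => hp0 (IsFractionRing.injective A K (h.trans (map_zero _).symm))
  exists_mul z := by
    obtain ⟨a, b, hb, rfl⟩ := IsFractionRing.div_surjective (A := A) z
    obtain ⟨n, w, rfl⟩ := h.exists_eq_pow_mul (nonZeroDivisors.ne_zero hb)
    obtain ⟨c, hc⟩ := pow_dvd_pow_of_dvd hp n
    obtain ⟨w', hw'⟩ := w.isUnit.exists_right_inv
    refine ⟨n, a * c * w', ?_⟩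
    have h0 : algebraMap A K (ϖ ^ n * w) ≠ 0 := fun h0 =>
      nonZeroDivisors.ne_zero hb (IsFractionRing.injective A K (h0.trans (map_zero _).symm))
    rw [← mul_div_assoc, div_eq_iff h0, ← map_natCast (algebraMap A K), ← map_pow, ← map_mul,
      ← map_mul, hc]
    congr 1
    linear_combination (-ϖ ^ n * c * a) * hw'

namespace IsInvert

variable {p : ℕ} {R : Type u} {K : Type v} [CommRing R] [Field K] [Algebra R K]

lemma exists_mul_family (h : IsInvert p R K) {n : ℕ} (z : Fin n → K) :
    ∃ (m : ℕ) (x : Fin n → R), ∀ i, (p : K) ^ m * z i = algebraMap R K (x i) := by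
  choose m x hx using fun i => h.exists_mul (z i)
  refine ⟨∑ i, m i, fun i => p ^ (∑ i, m i - m i) * x i, fun i => ?_⟩
  have h1 : m i ≤ ∑ i, m i :=
    Finset.single_le_sum (f := m) (fun _ _ => Nat.zero_le _) (Finset.mem_univ i)
  rw [map_mul, map_pow, map_natCast, ← hx, ← mul_assoc, ← pow_add, Nat.sub_add_cancel h1]

lemma addHom_ext (h : IsInvert p R K) {L : Type w} [Field L] (hL : (p : L) ≠ 0) {f g : K →+ L}
    (hfg : ∀ x, f (algebraMap R K x) = g (algebraMap R K x)) (z : K) : f z = g z := by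
  obtain ⟨n, x, hx⟩ := h.exists_mul z
  have h1 := hfg x
  rw [← hx, AddMonoidHom.natCast_pow_mul, AddMonoidHom.natCast_pow_mul] at h1
  exact mul_left_cancel₀ (pow_ne_zero n hL) h1

/-- An additive map commutes with multiplication by powers of p, which suffices to extend it to
fractions x / p^n. Stated additively, it covers Frobenius, derivations and the retraction at once.
-/
lemma exists_addHom (h : IsInvert p R K) {S : Type*} {L : Type w} [CommRing S] [Field L]
    [Algebra S L] (hL : (p : L) ≠ 0) (g : R →+ S) :
    ∃ f : K →+ L, ∀ x, f (algebraMap R K x) = algebraMap S L (g x) := by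
  choose n x hx using h.exists_mul
  have key : ∀ (z : K) (m : ℕ) (y : R), (p : K) ^ m * z = algebraMap R K y →
      algebraMap S L (g (x z)) / (p : L) ^ n z = algebraMap S L (g y) / (p : L) ^ m := by
    intro z m y hy
    rw [div_eq_div_iff (pow_ne_zero _ hL) (pow_ne_zero _ hL)]
    have h1 : (p : R) ^ m * x z = (p : R) ^ n z * y := by
      apply h.injective
      rw [map_mul, map_mul, ← hx, ← hy, map_pow, map_pow, map_natCast]
      ring
    have h2 := congrArg (fun r => algebraMap S L (g r)) h1
    simp only [AddMonoidHom.natCast_pow_mul, map_mul, map_pow, map_natCast] at h2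
    linear_combination h2
  refine ⟨AddMonoidHom.mk' (fun z => algebraMap S L (g (x z)) / (p : L) ^ n z) fun z z' => ?_,
    fun r => ?_⟩
  · rw [key (z + z') (n z + n z') (p ^ n z' * x z + p ^ n z * x z') (by
      rw [map_add, map_mul, map_mul, ← hx, ← hx, map_pow, map_pow, map_natCast]
      ring), map_add, AddMonoidHom.natCast_pow_mul, AddMonoidHom.natCast_pow_mul, map_add, map_mul,
      map_mul, map_pow, map_pow, map_natCast,
      div_add_div _ _ (pow_ne_zero _ hL) (pow_ne_zero _ hL), pow_add]
    congr 1
    ring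
  · change algebraMap S L (g (x _)) / _ = _
    rw [key _ 0 r (by rw [pow_zero, one_mul]), pow_zero, div_one]

lemma exists_ringHom (h : IsInvert p R K) {S : Type*} {L : Type w} [CommRing S] [Field L]
    [Algebra S L] (hL : (p : L) ≠ 0) (g : R →+* S) :
    ∃ f : K →+* L, ∀ x, f (algebraMap R K x) = algebraMap S L (g x) := by
  obtain ⟨f, hf⟩ := h.exists_addHom hL (g : R →+ S)
  have hf' : ∀ x, f (algebraMap R K x) = algebraMap S L (g x) := hf
  refine ⟨{ f with
    map_one' := ?_
    map_mul' := fun y z => ?_ }, hf'⟩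
  · change f 1 = 1
    rw [← map_one (algebraMap R K), hf', map_one, map_one]
  · change f (y * z) = f y * f z
    refine h.addHom_ext hL (f := f.comp (AddMonoidHom.mulLeft y))
      (g := (AddMonoidHom.mulLeft (f y)).comp f) (fun r => ?_) z
    change f (y * _) = f y * f _
    refine h.addHom_ext hL (f := f.comp (AddMonoidHom.mulRight (algebraMap R K r)))
      (g := (AddMonoidHom.mulRight (f (algebraMap R K r))).comp f) (fun r' => ?_) y
    change f (_ * _) = f _ * f _
    rw [← map_mul, hf', hf', hf', map_mul, map_mul]

end IsInvert

/-! ### The period datum of a Frobenius lift -/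

section Datum

variable {p : ℕ} [hp : Fact p.Prime] {O : Type u} [CommRing O] [IsDomain O]
  [IsDiscreteValuationRing O] [IsAdicComplete (Ideal.span {(p : O)}) O] {π : O}
  {σ₀ : O ≃+* O} (σ : FrobLift p σ₀)

lemma CoeffUnif.mem_gamCon_of_natCast_pow_mul (hπ : CoeffUnif p π) (n : ℕ) {x : Gam p O}
    (h : (p : Gam p O) ^ n * x ∈ GamCon p O) : x ∈ GamCon p O := by
  obtain ⟨e, c, hc⟩ := hπ.p_dvd
  apply hπ.mem_gamCon_of_unif_pow_mul (e * n)
  have h1 : Gam.C p O π ^ (e * n) * x = Gam.C p O (c ^ n) * ((p : Gam p O) ^ n * x) := by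
    rw [pow_mul, ← map_pow, hc, map_mul, map_natCast, map_pow]
    ring
  rw [h1]
  exact (GamCon p O).mul_mem (isOverconvergent_of p O _) h

lemma CoeffUnif.isInvert_gam (hπ : CoeffUnif p π) [IsDomain (Gam p O)] (K : Type v) [Field K]
    [Algebra (Gam p O) K] [IsFractionRing (Gam p O) K] : IsInvert p (Gam p O) K :=
  hπ.isUnif_gam.isInvert (by rw [← map_natCast (Gam.C p O)]; exact map_dvd _ hπ.dvd_p)
    (FrobLift.natCast_ne_zero_gam hπ) K

lemma CoeffUnif.isInvert_gamCon (hπ : CoeffUnif p π) (K : Type v) [Field K]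
    [Algebra (GamCon p O) K] [IsDomain (GamCon p O)] [IsFractionRing (GamCon p O) K] :
    IsInvert p (GamCon p O) K :=
  hπ.isUnif_gamCon.isInvert (by rw [← map_natCast (GamCon.C p O)]; exact map_dvd _ hπ.dvd_p)
    (fun h => FrobLift.natCast_ne_zero_gam hπ
      (by have := congrArg (GamCon p O).subtype h; simpa using this)) K

lemma FrobLift.natCast_ne_zero_perf (hσ₀ : LiftsFrobenius p σ₀) (hπ : CoeffUnif p π) :
    (p : GamPerf σ) ≠ 0 := by
  intro h
  obtain ⟨e, he⟩ := hπ.p_dvd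
  have hd := (σ.isUnif_perf hσ₀ hπ).isDomain
  have h1 := map_dvd (GamPerf.C σ) he
  rw [map_natCast, h, map_pow, zero_dvd_iff] at h1
  exact (σ.isUnif_perf hσ₀ hπ).ne_zero (eq_zero_of_pow_eq_zero h1)

lemma FrobLift.isInvert_perf (hσ₀ : LiftsFrobenius p σ₀) (hπ : CoeffUnif p π)
    [IsDomain (GamPerf σ)] (K : Type v) [Field K]
    [Algebra (GamPerf σ) K] [IsFractionRing (GamPerf σ) K] : IsInvert p (GamPerf σ) K :=
  (σ.isUnif_perf hσ₀ hπ).isInvert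
    (by rw [← map_natCast (GamPerf.C σ)]; exact map_dvd _ hπ.dvd_p)
    (σ.natCast_ne_zero_perf hσ₀ hπ) K

/-- The integral elements in the fraction field of a valuation ring. -/
def valuationSubringOf (A : Type u) (L : Type v) [CommRing A] [IsDomain A] [ValuationRing A]
    [Field L] [Algebra A L] [IsFractionRing A L] : ValuationSubring L where
  __ := (algebraMap A L).range
  mem_or_inv_mem' x := ValuationRing.isInteger_or_isInteger A x

lemma deriv_gamConC (a : O) : GamCon.deriv p O (GamCon.C p O a) = 0 := by
  apply Subtype.ext
  change Gam.deriv p O (Gam.single p 0 a) = 0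
  rw [FrobLift.deriv_single]
  simp [Gam.single]

set_option maxHeartbeats 1000000 in
/-- The fraction fields of `Γ_con`, `Γ` and `Γ^perf` form a period datum. -/
theorem FrobLift.exists_periodDatum (hσ₀ : LiftsFrobenius p σ₀) (hπ : CoeffUnif p π)
    [IsDomain (GamCon p O)] [IsDomain (Gam p O)] [IsDomain (GamPerf σ)]
    {C K L : Type u} [Field C] [Field K] [Field L] [Algebra C K] [Algebra K L] [Algebra C L]
    [IsScalarTower C K L]
    [Algebra (GamCon p O) C] [IsFractionRing (GamCon p O) C]
    [Algebra (Gam p O) K] [IsFractionRing (Gam p O) K]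
    [Algebra (GamPerf σ) L] [IsFractionRing (GamPerf σ) L]
    (hCK : ∀ x : GamCon p O, algebraMap C K (algebraMap _ C x) = algebraMap _ K (x : Gam p O))
    (hKL : ∀ x : Gam p O, algebraMap K L (algebraMap _ K x) = algebraMap _ L (GamPerf.of σ x)) :
    ∃ 𝒟 : PeriodDatum p C K L,
      (∀ x, 𝒟.σC (algebraMap (GamCon p O) C x) = algebraMap _ C (σ.con x)) ∧
      (∀ x, 𝒟.σL (algebraMap (GamPerf σ) L x) = algebraMap _ L (GamPerf.frob σ x)) ∧
      (∀ x, 𝒟.DC (algebraMap (GamCon p O) C x) = algebraMap _ C (GamCon.deriv p O x)) ∧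
      𝒟.s = algebraMap _ C (GamCon.deriv p O (σ.con (GamCon.t p O))) ∧
      𝒟.eig = {z | ∃ a : O, a ≠ 0 ∧ σ₀ a = a ∧ z = algebraMap _ C (GamCon.C p O a)} := by
  have hC : IsInvert p (GamCon p O) C := hπ.isInvert_gamCon C
  have hK : IsInvert p (Gam p O) K := hπ.isInvert_gam K
  have hL : IsInvert p (GamPerf σ) L := σ.isInvert_perf hσ₀ hπ L
  have hdvr := (σ.isUnif_perf hσ₀ hπ).isDiscreteValuationRing
  have hCL : ∀ x : GamCon p O, algebraMap C L (algebraMap _ C x) =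
      algebraMap _ L (GamPerf.of σ x) := fun x => by
    rw [IsScalarTower.algebraMap_apply C K L, hCK, hKL]
  obtain ⟨σC, hσC⟩ := hC.exists_ringHom hC.ne_zero σ.con
  obtain ⟨σK, hσK⟩ := hK.exists_ringHom hK.ne_zero σ.toHom
  obtain ⟨σL, hσL⟩ := hL.exists_ringHom hL.ne_zero (GamPerf.frob σ)
  obtain ⟨DC, hDC⟩ := hC.exists_addHom hC.ne_zero (GamCon.deriv p O)
  obtain ⟨DK, hDK⟩ := hK.exists_addHom hK.ne_zero (Gam.deriv p O)
  obtain ⟨Θ, hΘ1, hΘl, hΘm⟩ := σ.exists_retraction hσ₀ hπ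
  obtain ⟨T, hT⟩ := hL.exists_addHom hK.ne_zero Θ
  have hσLm : ∀ m x, (σL ^ m) (algebraMap _ L x) = algebraMap _ L ((GamPerf.frob σ ^ m) x) := by
    intro m
    induction m with
    | zero => exact fun _ => rfl
    | succ m ih =>
      intro x
      rw [pow_succ', pow_succ', RingHom.coe_mul, RingHom.coe_mul, Function.comp_apply, ih, hσL,
        Function.comp_apply]
  -- elements of `K` which are integral in `L`
  have hKint : ∀ (z : K) (a : GamPerf σ), algebraMap K L z = algebraMap _ L a →
      ∃ g : Gam p O, algebraMap _ K g = z ∧ GamPerf.of σ g = a := by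
    intro z a hza
    obtain ⟨m, g, hg⟩ := hK.exists_mul z
    have h1 : GamPerf.of σ g = p ^ m * a := by
      apply hL.injective
      rw [← hKL, ← hg, map_mul, map_mul, hza, map_pow, map_pow, map_natCast, map_natCast]
    obtain ⟨g', rfl⟩ := (σ.pow_dvd_of_iff hσ₀ hπ m g).1 ⟨a, h1⟩
    have h2 : algebraMap _ K g' = z := by
      rw [map_mul, map_pow, map_natCast] at hg
      exact (mul_left_cancel₀ (pow_ne_zero m hK.ne_zero) hg).symm
    refine ⟨g', h2, hL.injective ?_⟩
    rw [← hza, ← h2, hKL]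
  -- Integrality in `L` descends first to Γ, since divisibility by p in Γ^perf does, and then to
  -- Γ_con, which is p-saturated in Γ.
  have hCint : ∀ (z : C) (a : GamPerf σ), algebraMap C L z = algebraMap _ L a →
      ∃ g : GamCon p O, algebraMap _ C g = z := by
    intro z a hza
    obtain ⟨g, hg, -⟩ := hKint (algebraMap C K z) a
      (by rw [← hza, ← IsScalarTower.algebraMap_apply C K L])
    obtain ⟨m, y, hy⟩ := hC.exists_mul z
    have h1 : (y : Gam p O) = p ^ m * g := by
      apply hK.injective
      rw [← hCK, ← hy, map_mul, map_mul, hg, map_pow, map_pow, map_natCast, map_natCast]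
    have h2 : g ∈ GamCon p O := hπ.mem_gamCon_of_natCast_pow_mul m (h1 ▸ y.2)
    refine ⟨⟨g, h2⟩, (algebraMap C K).injective ?_⟩
    rw [hCK, hg]
  refine ⟨{
    σC := σC
    σK := σK
    σL := σL
    DC := DC
    DK := DK
    Lo := valuationSubringOf (GamPerf σ) L
    s := algebraMap _ C (GamCon.deriv p O (σ.con (GamCon.t p O)))
    ϖ := algebraMap _ L (GamPerf.C σ π)
    eig := {z | ∃ a : O, a ≠ 0 ∧ σ₀ a = a ∧ z = algebraMap _ C (GamCon.C p O a)}
    retr := { T with map_smul' := ?_ }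
    σK_algebraMap := ?_
    σL_algebraMap := ?_
    DK_algebraMap := ?_
    DK_mul := ?_
    DK_σK := ?_
    inv_p_notMem := ?_
    σL_mem := ?_
    bounded := ?_
    sep := ?_
    σL_ϖ := ?_
    s_ϖ := ?_
    ϖ_pow := ?_
    closed := ?_
    dense := ?_
    integ := ?_
    retr_one := ?_
    retr_mem := ?_
    eig_ne := ?_
    σC_eig := ?_
    DC_eig := ?_ }, hσC, hσL, hDC, rfl, rfl⟩
  · exact fun x => DFunLike.congr_fun (f := ((σK.comp (algebraMap C K) : C →+* K) : C →+ K))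
      (g := (((algebraMap C K).comp σC : C →+* K) : C →+ K)) (DFunLike.ext _ _ fun x =>
        hC.addHom_ext hK.ne_zero (fun r => by
          change σK (algebraMap C K _) = algebraMap C K (σC _)
          rw [hCK, hσK, hσC, hCK]
          rfl) x) x
  · exact fun x => DFunLike.congr_fun (f := ((σL.comp (algebraMap K L) : K →+* L) : K →+ L))
      (g := (((algebraMap K L).comp σK : K →+* L) : K →+ L)) (DFunLike.ext _ _ fun x =>
        hK.addHom_ext hL.ne_zero (fun r => by
          change σL (algebraMap K L _) = algebraMap K L (σK _)
          rw [hKL, hσL, hσK, hKL, GamPerf.of_frob]) x) x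
  · exact fun x => hC.addHom_ext hK.ne_zero (f := DK.comp (algebraMap C K : C →+ K))
      (g := (algebraMap C K : C →+ K).comp DC) (fun r => by
        change DK (algebraMap C K _) = algebraMap C K (DC _)
        rw [hCK, hDK, hDC, hCK]
        rfl) x
  · intro x y
    refine hK.addHom_ext hK.ne_zero (f := DK.comp (AddMonoidHom.mulRight y))
      (g := (AddMonoidHom.mulRight y).comp DK + AddMonoidHom.mulRight (DK y)) (fun r => ?_) x
    refine hK.addHom_ext hK.ne_zero (f := DK.comp (AddMonoidHom.mulLeft (algebraMap _ K r)))
      (g := AddMonoidHom.mulLeft (DK (algebraMap _ K r)) +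
        (AddMonoidHom.mulLeft (algebraMap _ K r)).comp DK) (fun r' => ?_) y
    change DK (algebraMap _ K r * algebraMap _ K r') = DK (algebraMap _ K r) * algebraMap _ K r' +
      algebraMap _ K r * DK (algebraMap _ K r')
    rw [← map_mul, hDK, hDK, hDK, Gam.deriv_mul hπ, map_add, map_mul, map_mul]
  · exact fun x => hK.addHom_ext hK.ne_zero (f := DK.comp (σK : K →+ K))
      (g := (AddMonoidHom.mulLeft (algebraMap C K (algebraMap _ C
        (GamCon.deriv p O (σ.con (GamCon.t p O)))))).comp ((σK : K →+ K).comp DK)) (fun r => by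
        change DK (σK _) = algebraMap C K _ * σK (DK _)
        rw [hσK, hDK, hDK, hσK, hCK, ← map_mul, σ.deriv_toHom hσ₀ hπ]
        rfl) x
  · rintro ⟨a, ha⟩
    apply FrobLift.not_isUnit_natCast_gam hπ
    have h1 : (p : GamPerf σ) * a = 1 := by
      apply hL.injective
      rw [map_mul, ha, map_natCast, map_one, mul_inv_cancel₀ hL.ne_zero]
    have h2 := (σ.pow_dvd_of_iff hσ₀ hπ 1 1).1 ⟨a, by rw [map_one, pow_one, h1]⟩
    rw [pow_one] at h2
    exact isUnit_of_dvd_one h2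
  · rintro _ ⟨a, rfl⟩
    exact ⟨GamPerf.frob σ a, (hσL a).symm⟩
  · intro z
    obtain ⟨n, a, ha⟩ := hL.exists_mul z
    exact ⟨n, a, ha.symm⟩
  · intro z hz
    obtain ⟨_, ⟨a, rfl⟩, ha⟩ := hz 0
    rw [pow_zero, one_mul] at ha
    rw [ha, eq_zero_of_forall_pow_dvd p (x := a) (fun n => ?_), map_zero]
    obtain ⟨_, ⟨b, rfl⟩, hb⟩ := hz n
    refine ⟨b, hL.injective ?_⟩
    rw [← ha, hb, map_mul, map_pow, map_natCast]
  · obtain ⟨c, hc⟩ := (σ.associated_toHom_unif hσ₀ hπ).dvd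
    refine ⟨_, ⟨GamPerf.of σ c, rfl⟩, ?_⟩
    rw [hσL, ← map_mul]
    congr 1
    change GamPerf.frob σ (GamPerf.of σ _) = GamPerf.of σ _ * GamPerf.of σ _
    rw [← GamPerf.of_frob, hc, map_mul]
  · obtain ⟨c, hc⟩ := σ.dvd_deriv_frobMon hπ
    refine ⟨_, ⟨GamPerf.of σ c, rfl⟩, ?_⟩
    rw [hCL, ← map_mul]
    congr 1
    change GamPerf.of σ (Gam.deriv p O (σ.frobMon 1)) = GamPerf.of σ _ * GamPerf.of σ _
    rw [hc, map_mul]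
  · obtain ⟨e, c, hc⟩ := hπ.p_dvd
    refine ⟨e, _, ⟨GamPerf.C σ c, rfl⟩, ?_⟩
    rw [← map_pow, ← map_pow, hc, map_mul, map_mul, map_natCast, map_natCast]
  · intro z hz
    obtain ⟨n₀, a, ha⟩ := hL.exists_mul z
    obtain ⟨g, hg⟩ := σ.exists_of_eq hσ₀ hπ (z := a) (fun n => by
      obtain ⟨y, _, ⟨c, rfl⟩, hy⟩ := hz n
      have h1 : algebraMap K L ((p : K) ^ n₀ * y) =
          algebraMap _ L (a - (p : GamPerf σ) ^ n₀ * ((p : GamPerf σ) ^ n * c)) := by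
        rw [map_mul, map_pow, map_natCast, map_sub, ← ha, map_mul, map_mul, map_pow, map_pow,
          map_natCast, ← hy]
        ring
      obtain ⟨g, -, hg⟩ := hKint _ _ h1
      exact ⟨g, p ^ n₀ * c, by rw [hg]; ring⟩)
    refine ⟨algebraMap _ K g / (p : K) ^ n₀, ?_⟩
    rw [map_div₀, hKL, hg, ← ha, map_pow, map_natCast,
      mul_div_cancel_left₀ _ (pow_ne_zero _ hL.ne_zero)]
  · intro z n
    obtain ⟨n₀, a, ha⟩ := hL.exists_mul z
    -- The extra `n₀` compensates for the later division by `p ^ n₀`.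
    obtain ⟨m, y, c, hc⟩ := σ.exists_frob_pow_sub a (n₀ + n)
    refine ⟨m, algebraMap _ C y / (p : C) ^ n₀, _, ⟨c, rfl⟩, ?_⟩
    have h1 := congrArg (algebraMap _ L) hc
    rw [map_sub, ← hσLm, ← ha, map_mul, map_pow (σL ^ m), map_natCast (σL ^ m), ← hCL, map_mul,
      map_pow, map_natCast] at h1
    have h2 : (p : L) ^ n₀ ≠ 0 := pow_ne_zero _ hL.ne_zero
    rw [map_div₀, map_pow, map_natCast]
    apply mul_left_cancel₀ h2
    rw [mul_sub, mul_div_cancel₀ _ h2, h1]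
    ring
  · intro z y hzy
    obtain ⟨n, g, hg⟩ := hK.exists_mul z
    obtain ⟨m, r, hr⟩ := hC.exists_mul y
    -- The denominators of `z` and of its derivative are cleared together, so that integration takes
    -- place in Γ.
    have h1 : Gam.deriv p O (p ^ m * g) = p ^ n * r := by
      apply hK.injective
      rw [← hDK, map_mul (algebraMap _ K), map_mul (algebraMap _ K), ← hg, ← hCK, ← hr, map_pow,
        map_pow, map_natCast, AddMonoidHom.natCast_pow_mul,
        AddMonoidHom.natCast_pow_mul, hzy, map_mul, map_pow, map_natCast]
      ring
    have h2 : (p ^ m * g : Gam p O) ∈ GamCon p O := by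
      apply hπ.mem_gamCon_of_deriv
      rw [h1]
      exact (GamCon p O).mul_mem ((GamCon p O).pow_mem (natCast_mem _ p) n) r.2
    refine ⟨algebraMap (GamCon p O) C ⟨_, h2⟩ / (p : C) ^ (m + n), ?_⟩
    rw [map_div₀, hCK, map_mul, ← hg, map_pow, map_pow, map_natCast, map_natCast,
      div_eq_iff (pow_ne_zero _ hK.ne_zero)]
    ring
  · intro k z
    change T (k • z) = k * T z
    rw [Algebra.smul_def]
    refine hK.addHom_ext hK.ne_zero
      (f := T.comp ((AddMonoidHom.mulRight z).comp (algebraMap K L : K →+ L)))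
      (g := AddMonoidHom.mulRight (T z)) (fun g => ?_) k
    refine hL.addHom_ext hK.ne_zero
      (f := T.comp (AddMonoidHom.mulLeft (algebraMap K L (algebraMap _ K g))))
      (g := (AddMonoidHom.mulLeft (algebraMap _ K g)).comp T) (fun a => ?_) z
    change T (algebraMap K L (algebraMap _ K g) * algebraMap _ L a) = algebraMap _ K g * T _
    rw [hKL, ← map_mul, hT, hT, hΘl, map_mul]
  · change T 1 = 1
    rw [← map_one (algebraMap (GamPerf σ) L), hT, hΘ1, map_one]
  · intro n W H hH hW i
    obtain ⟨m, w, hw⟩ := hL.exists_mul_family W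
    have hH' : ∀ i j, ∃ h : GamCon p O, algebraMap _ C h = H i j := fun i j => by
      obtain ⟨a, ha⟩ := hH i j
      exact hCint _ a ha.symm
    choose h hh using hH'
    have h1 := hΘm w h (fun i => by
      apply hL.injective
      rw [← hσL, ← hw, map_mul, map_pow, map_natCast, hW, map_sum, Finset.mul_sum]
      refine Finset.sum_congr rfl fun j _ => ?_
      rw [map_mul, ← hw, ← hCL, hh]
      ring) i
    obtain ⟨x, hx⟩ : ∃ x : GamCon p O, (x : Gam p O) = Θ (w i) := ⟨⟨_, h1⟩, rfl⟩
    refine ⟨algebraMap (GamCon p O) C x / (p : C) ^ m, ?_⟩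
    rw [map_div₀, hCK, hx, map_pow (algebraMap C K), map_natCast,
      div_eq_iff (pow_ne_zero _ hK.ne_zero)]
    change algebraMap _ K (Θ (w i)) = T (W i) * _
    rw [← hT, ← hw, AddMonoidHom.natCast_pow_mul]
    ring
  · rintro _ ⟨a, ha, -, rfl⟩ h0
    apply ha
    have h1 := hC.injective (h0.trans (map_zero _).symm)
    have h2 : cf p 0 (Gam.single p 0 a) = 0 := by
      have := congrArg (fun x : GamCon p O => cf p 0 (x : Gam p O)) h1
      exact this.trans (map_zero (cf p 0))
    rw [cf_of] at h2
    simpa using h2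
  · rintro _ ⟨a, ha, ha', rfl⟩
    rw [hσC]
    congr 1
    apply Subtype.ext
    change σ.toHom (Gam.C p O a) = Gam.C p O a
    rw [σ.compat, ha']
  · rintro _ ⟨a, ha, ha', rfl⟩
    rw [hDC, deriv_gamConC, map_zero]

end Datum

/-! ### Rank one crystals with an eigenvector -/

section RankOne

variable {p : ℕ} {R : Type u} [CommRing R] [IsDomain R] {σ : R →+* R} {Q : Type w}
  [AddCommGroup Q] [Module R Q] [Module.IsTorsionFree R Q]

lemma linearization_tmul (F : Q →ₛₗ[σ] Q) (a : Along σ) (m : Q) :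
    linearization F (a ⊗ₜ m) = Along.out σ a • F m := rfl

lemma along_tmul_smul (a : Along σ) (c : R) (m : Q) :
    a ⊗ₜ[R] (c • m) = (Along.mk σ (Along.out σ a * σ c)) ⊗ₜ[R] m := by
  rw [← TensorProduct.smul_tmul]
  congr 1
  change Along.mk σ (σ c * Along.out σ a) = _
  rw [mul_comm]

lemma exists_smul_eq_tmul {e : Q} (he : ∀ m : Q, ∃ (n : ℕ) (c : R), p ^ n • m = c • e)
    (z : Along σ ⊗[R] Q) : ∃ (n : ℕ) (a : Along σ), p ^ n • z = a ⊗ₜ[R] e := by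
  induction z with
  | zero => exact ⟨0, 0, by rw [smul_zero, TensorProduct.zero_tmul]⟩
  | tmul a m =>
    obtain ⟨n, c, hc⟩ := he m
    exact ⟨n, _, by rw [← TensorProduct.tmul_smul, hc, along_tmul_smul]⟩
  | add x y hx hy =>
    obtain ⟨n, a, ha⟩ := hx
    obtain ⟨m, b, hb⟩ := hy
    refine ⟨n + m, (p ^ m) • a + (p ^ n) • b, ?_⟩
    rw [TensorProduct.add_tmul, ← TensorProduct.smul_tmul', ← TensorProduct.smul_tmul', ← ha, ← hb,
      smul_add, smul_smul, smul_smul, pow_add, mul_comm (p ^ m)]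

/-- Up to powers of p, the linearization is multiplication by `a` on a line: its cokernel is killed
because `a` divides a power of p, its kernel because `R` is a domain. -/
lemma isFCrystal_of_eigenvector [Module.Finite R Q] [Module.Projective R Q] (F : Q →ₛₗ[σ] Q)
    {e : Q} (he0 : e ≠ 0) (he : ∀ m : Q, ∃ (n : ℕ) (c : R), p ^ n • m = c • e) {a : R}
    (ha : a ≠ 0) (hF : F e = a • e) (hap : ∃ (k : ℕ) (c : R), (p : R) ^ k = a * c) :
    IsFCrystal p F where
  finite := inferInstance
  projective := inferInstance
  coker m := by
    obtain ⟨n, c, hc⟩ := he m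
    obtain ⟨k, d, hd⟩ := hap
    refine ⟨k + n, Along.mk σ (c * d) ⊗ₜ e, ?_⟩
    rw [linearization_tmul, pow_add, mul_smul, hc, hF, smul_smul]
    have h1 : (p ^ k : ℕ) • c • e = ((p : R) ^ k) • c • e := by
      rw [← Nat.cast_smul_eq_nsmul R]
      push_cast
      rfl
    rw [h1, hd, smul_smul]
    change (c * d * a) • e = _
    congr 1
    ring
  ker z hz := by
    obtain ⟨n, b, hb⟩ := exists_smul_eq_tmul he z
    refine ⟨n, ?_⟩
    have h1 := congrArg (linearization F) hb
    rw [map_nsmul, hz, smul_zero, linearization_tmul, hF, smul_smul] at h1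
    have h2 := (smul_eq_zero.1 h1.symm).resolve_right he0
    have h3 : b = 0 := (mul_eq_zero.1 h2).resolve_right ha
    rw [hb, h3, TensorProduct.zero_tmul]

lemma isConstant_of_eigenvector {O : Type v} [CommRing O] (σ₀ : O ≃+* O) (ι : O →+* R)
    (F : Q →ₛₗ[σ] Q) {e : Q} (he0 : e ≠ 0)
    (he : ∀ m : Q, ∃ (n : ℕ) (c : R), p ^ n • m = c • e) {a : O}
    (ha : a ≠ 0) (ha' : σ₀ a = a) (hF : F e = ι a • e) : IsConstant p σ₀ ι F := by
  refine ⟨1, fun _ => e, fun _ => a, fun _ => ⟨ha, ha', hF⟩,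
    LinearIndependent.of_subsingleton 0 he0, fun m => ?_⟩
  obtain ⟨n, c, hc⟩ := he m
  refine ⟨n, ?_⟩
  rw [hc]
  exact Submodule.smul_mem _ _ (Submodule.subset_span ⟨0, rfl⟩)

end RankOne

/-! ### From flags to unipotence -/

section Unipotent

variable {p : ℕ} {C K L : Type u} [Field C] [Field K] [Field L] [Algebra C K]
  [Algebra K L] [Algebra C L] [IsScalarTower C K L] (𝒟 : PeriodDatum p C K L)
  {P : Type u} [AddCommGroup P] [Module C P] {FP : P →ₛₗ[𝒟.σC] P} {DP : P →+ P}
  {R : Type v} [CommRing R] [IsDomain R] [IsPrincipalIdealRing R] [Algebra R C] {σ : R →+* R}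
  {N : Type w} [AddCommGroup N] [Module R N] [Module.Finite R N] {F : N →ₛₗ[σ] N}

/-- The steps of the flag are pulled back along `u`. Being preimages of subspaces they are
saturated, so the quotients are torsion-free, hence free over the principal ideal domain `R`, and
generated up to powers of p by an eigenvector. -/
lemma PeriodDatum.HasFlag.isUnipotent (hC : IsInvert p R C) {O : Type*} [CommRing O]
    (σ₀ : O ≃+* O) (ι : O →+* R)
    (heig : ∀ z ∈ 𝒟.eig, ∃ a : O, a ≠ 0 ∧ σ₀ a = a ∧ z = algebraMap R C (ι a))
    (hι : ∀ a : O, a ≠ 0 → ∃ (k : ℕ) (c : R), (p : R) ^ k = ι a * c)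
    (u : N →+ P) (hu : ∀ (a : R) z, u (a • z) = algebraMap R C a • u z)
    (hinj : Function.Injective u) (hsurj : ∀ v, ∃ (m : ℕ) (z : N), u z = (p : C) ^ m • v)
    (huF : ∀ z, u (F z) = FP (u z)) (h : 𝒟.HasFlag FP DP) : IsUnipotent p σ₀ ι F := by
  obtain ⟨n, Fil, h0, hn, hstep⟩ := h
  have hσC : ∀ i ≤ n, ∀ x ∈ Fil i, FP x ∈ Fil i := by
    intro i
    induction i with
    | zero =>
      intro _ x hx
      rw [h0, Submodule.mem_bot] at hx
      rw [hx, map_zero]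
      exact zero_mem _
    | succ i ih =>
      intro hi x hx
      obtain ⟨q, b, hb, hq, hsup, hFq, -⟩ := hstep i hi
      rw [hsup] at hx ⊢
      obtain ⟨y, hy, z, hz, rfl⟩ := Submodule.mem_sup.1 hx
      obtain ⟨c, rfl⟩ := Submodule.mem_span_singleton.1 hz
      rw [map_add, LinearMap.map_smulₛₗ]
      refine add_mem (Submodule.mem_sup_left (ih (by omega) y hy)) (Submodule.smul_mem _ _ ?_)
      rw [← sub_add_cancel (FP q) (b • q)]
      exact add_mem (Submodule.mem_sup_left hFq) (Submodule.mem_sup_right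
        (Submodule.smul_mem _ _ (Submodule.mem_span_singleton_self q)))
  -- The index is capped at `n`: nothing is known about `Fil` beyond `n`, while the filtration must
  -- be increasing and stable for all indices.
  let G : ℕ → Submodule R N := fun i =>
    { carrier := {z | u z ∈ Fil (min i n)}
      zero_mem' := by
        rw [Set.mem_ofPred_eq, map_zero]
        exact zero_mem _
      add_mem' := fun {y z} hy hz => by
        rw [Set.mem_ofPred_eq, map_add]
        exact add_mem hy hz
      smul_mem' := fun a z hz => by
        rw [Set.mem_ofPred_eq, hu]
        exact Submodule.smul_mem _ _ hz }
  have hG : ∀ i, i ≤ n → ∀ z, z ∈ G i ↔ u z ∈ Fil i := fun i hi z => by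
    change u z ∈ Fil (min i n) ↔ _
    rw [min_eq_left hi]
  have hmono : ∀ i, G i ≤ G (i + 1) := by
    intro i z hz
    rcases Nat.lt_or_ge i n with hi | hi
    · rw [hG i hi.le] at hz
      rw [hG (i + 1) hi]
      obtain ⟨q, b, -, -, hsup, -⟩ := hstep i hi
      rw [hsup]
      exact Submodule.mem_sup_left hz
    · change u z ∈ Fil (min i n) at hz
      change u z ∈ Fil (min (i + 1) n)
      rw [min_eq_right hi] at hz
      rwa [min_eq_right (by omega)]
  have hGF : ∀ i, ∀ z ∈ G i, F z ∈ G i := by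
    intro i z hz
    change u (F z) ∈ Fil (min i n)
    rw [huF]
    exact hσC _ (min_le_right _ _) _ hz
  have hnsmul : ∀ (k : ℕ) (z : N), u (p ^ k • z) = (p : C) ^ k • u z := fun k z => by
    rw [map_nsmul, ← Nat.cast_smul_eq_nsmul C]
    push_cast
    rfl
  refine ⟨n, G, hmono, hGF, ?_, ?_, fun i hi => ?_⟩
  · rw [eq_bot_iff]
    intro z hz
    rw [hG 0 (Nat.zero_le n), h0, Submodule.mem_bot] at hz
    exact hinj (hz.trans (map_zero u).symm)
  · rw [eq_top_iff]
    intro z _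
    rw [hG n le_rfl, hn]
    trivial
  obtain ⟨q, b, hb, hq, hsup, hFq, -⟩ := hstep i hi
  obtain ⟨a, ha0, ha, rfl⟩ := heig b hb
  obtain ⟨m, z₀, hz₀⟩ := hsurj q
  have hz₀mem : z₀ ∈ G (i + 1) := by
    rw [hG _ hi, hz₀, hsup]
    exact Submodule.smul_mem _ _ (Submodule.mem_sup_right (Submodule.mem_span_singleton_self q))
  let Q := (G (i + 1)) ⧸ (G i).submoduleOf (G (i + 1))
  let mk : G (i + 1) →ₗ[R] Q := Submodule.mkQ _
  have hmk : ∀ x : G (i + 1), mk x = 0 ↔ u x ∈ Fil i := fun x => by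
    rw [← hG i hi.le]
    exact Submodule.Quotient.mk_eq_zero _
  have hmk' : ∀ x y : G (i + 1), mk x = mk y ↔ u x - u y ∈ Fil i := fun x y => by
    rw [← sub_eq_zero, ← map_sub, hmk, AddSubgroupClass.coe_sub, map_sub]
  have htf : Module.IsTorsionFree R Q := by
    refine Module.IsTorsionFree.of_smul_eq_zero fun r x hx => ?_
    obtain ⟨x, rfl⟩ := Submodule.mkQ_surjective _ x
    by_cases hr : r = 0
    · exact Or.inl hr
    right
    change mk x = 0
    change r • mk x = 0 at hx
    rw [← map_smul, hmk, SetLike.val_smul, hu] at hx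
    rw [hmk]
    refine ((Fil i).smul_mem_iff ?_).1 hx
    exact fun h => hr (hC.injective (h.trans (map_zero _).symm))
  have hfin : Module.Finite R Q := inferInstance
  have hfree : Module.Free R Q := Module.free_of_finite_type_torsion_free'
  set e : Q := mk ⟨z₀, hz₀mem⟩ with he
  have he0 : e ≠ 0 := by
    rw [he, ne_eq, hmk]
    change u z₀ ∉ Fil i
    rw [hz₀, (Fil i).smul_mem_iff (pow_ne_zero _ hC.ne_zero)]
    exact hq
  have hspan : ∀ x : Q, ∃ (k : ℕ) (c : R), p ^ k • x = c • e := by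
    intro x
    obtain ⟨x, rfl⟩ := Submodule.mkQ_surjective _ x
    have hx := x.2
    rw [hG _ hi, hsup] at hx
    obtain ⟨y, hy, z, hz, hyz⟩ := Submodule.mem_sup.1 hx
    obtain ⟨c, rfl⟩ := Submodule.mem_span_singleton.1 hz
    obtain ⟨k, c', hc'⟩ := hC.exists_mul c
    refine ⟨m + k, c', ?_⟩
    change (p ^ (m + k)) • mk x = c' • mk ⟨z₀, hz₀mem⟩
    rw [← map_nsmul, ← map_smul, hmk']
    change u (p ^ (m + k) • (x : N)) - u (c' • z₀) ∈ Fil i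
    rw [hnsmul, hu, ← hc', hz₀, ← hyz]
    have : (p : C) ^ (m + k) • (y + c • q) - ((p : C) ^ k * c) • (p : C) ^ m • q =
        (p : C) ^ (m + k) • y := by
      module
    rw [this]
    exact Submodule.smul_mem _ _ hy
  have hFe : subquotient F (G i) (G (i + 1)) (hGF i) (hGF (i + 1)) e = ι a • e := by
    change mk (F.restrict (hGF (i + 1)) ⟨z₀, hz₀mem⟩) = ι a • mk ⟨z₀, hz₀mem⟩
    rw [← map_smul, hmk']
    change u (F z₀) - u (ι a • z₀) ∈ Fil i
    rw [huF, hu, hz₀, LinearMap.map_smulₛₗ, map_pow, map_natCast]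
    have : (p : C) ^ m • FP q - algebraMap R C (ι a) • (p : C) ^ m • q =
        (p : C) ^ m • (FP q - algebraMap R C (ι a) • q) := by
      module
    rw [this]
    exact Submodule.smul_mem _ _ hFq
  have hιa : ι a ≠ 0 := fun h => 𝒟.eig_ne _ hb (by rw [h, map_zero])
  exact ⟨isFCrystal_of_eigenvector _ he0 hspan hιa hFe (hι a ha0),
    isConstant_of_eigenvector σ₀ ι _ he0 hspan ha0 ha hFe⟩

end Unipotent

/-! ### Coordinates -/

section Coordinates

variable {S : Type u} [CommRing S] {N : Type w} [AddCommGroup N] [Module S N] {r : ℕ}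
  (b : Module.Basis (Fin r) S N)

lemma repr_semilinear {τ : S →+* S} (F : N →ₛₗ[τ] N) (z : N) (i : Fin r) :
    b.repr (F z) i = ∑ j, b.repr (F (b j)) i * τ (b.repr z j) := by
  conv_lhs => rw [← b.sum_repr z]
  simp only [map_sum, LinearMap.map_smulₛₗ, map_smul, Finsupp.coe_finsetSum, Finset.sum_apply,
    Finsupp.smul_apply, smul_eq_mul]
  exact Finset.sum_congr rfl fun j _ => mul_comm _ _

lemma repr_connection {d : S →+ S} (D : N →+ N) (hD : ∀ (x : S) m, D (x • m) = d x • m + x • D m)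
    (z : N) (i : Fin r) :
    b.repr (D z) i = d (b.repr z i) + ∑ j, b.repr (D (b j)) i * b.repr z j := by
  conv_lhs => rw [← b.sum_repr z]
  simp only [map_sum, hD, map_add, map_smul, Finsupp.coe_finsetSum, Finset.sum_apply,
    Finsupp.smul_apply, smul_eq_mul, Finset.sum_add_distrib, Finsupp.add_apply]
  congr 1
  · simp [Finsupp.single_apply]
  · exact Finset.sum_congr rfl fun j _ => mul_comm _ _

/-- The coordinates of the elements of a free module, in an extension of the ring. -/
def coordMap (C : Type v) [CommRing C] [Algebra S C] : N →+ (Fin r → C) where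
  toFun z i := algebraMap S C (b.repr z i)
  map_zero' := by ext; simp
  map_add' y z := by ext; simp

lemma coordMap_smul (C : Type v) [CommRing C] [Algebra S C] (a : S) (z : N) :
    coordMap b C (a • z) = algebraMap S C a • coordMap b C z := by
  ext i
  simp [coordMap]

end Coordinates

section Matrix

variable {C : Type u} [CommRing C] {r : ℕ}

/-- The semilinear endomorphism with a given matrix. -/
def matFrob (σ : C →+* C) (A : Fin r → Fin r → C) : (Fin r → C) →ₛₗ[σ] (Fin r → C) where
  toFun v i := ∑ j, A i j * σ (v j)
  map_add' v w := by
    ext i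
    simp [mul_add, Finset.sum_add_distrib]
  map_smul' c v := by
    ext i
    simp only [Pi.smul_apply, smul_eq_mul, map_mul, Finset.mul_sum]
    exact Finset.sum_congr rfl fun j _ => by ring

/-- The connection with a given matrix. -/
def matConn (d : C →+ C) (B : Fin r → Fin r → C) : (Fin r → C) →+ (Fin r → C) where
  toFun v i := d (v i) + ∑ j, B i j * v j
  map_zero' := by ext; simp
  map_add' v w := by
    ext i
    simp only [Pi.add_apply, map_add, mul_add, Finset.sum_add_distrib]
    ring

end Matrix

section

variable {p : ℕ} {C K L : Type u} [Field C] [Field K] [Field L] [Algebra C K]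
  [Algebra K L] [Algebra C L] [IsScalarTower C K L] (𝒟 : PeriodDatum p C K L) {r : ℕ}
  {A B : Fin r → Fin r → C}

namespace PeriodDatum

lemma DC_σC (x : C) : 𝒟.DC (𝒟.σC x) = 𝒟.s * 𝒟.σC (𝒟.DC x) := by
  apply (algebraMap C K).injective
  rw [← DK_algebraMap, ← σK_algebraMap, DK_σK, DK_algebraMap, σK_algebraMap, map_mul]

/-- The hypothesis is horizontality on basis vectors; the remaining terms, where coordinates are
differentiated, agree by `DC_σC`. -/
lemma isHorizontal_matrix
    (h : ∀ k j, 𝒟.DC (A k j) + ∑ i, B k i * A i j = 𝒟.s * ∑ i, A k i * 𝒟.σC (B i j)) :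
    𝒟.IsHorizontal (matFrob 𝒟.σC A) (matConn 𝒟.DC B) where
  leibniz x v := by
    ext i
    change 𝒟.DC (x * v i) + ∑ j, B i j * (x * v j) =
      𝒟.DC x * v i + x * (𝒟.DC (v i) + ∑ j, B i j * v j)
    rw [DC_mul, mul_add, Finset.mul_sum, add_assoc]
    congr 2
    exact Finset.sum_congr rfl fun j _ => by ring
  horizontal v := by
    ext k
    change 𝒟.DC (∑ j, A k j * 𝒟.σC (v j)) + ∑ i, B k i * ∑ j, A i j * 𝒟.σC (v j) =
      𝒟.s * ∑ i, A k i * 𝒟.σC (𝒟.DC (v i) + ∑ j, B i j * v j)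
    have h1 : ∀ j, (𝒟.DC (A k j) + ∑ i, B k i * A i j) * 𝒟.σC (v j) =
        (𝒟.s * ∑ i, A k i * 𝒟.σC (B i j)) * 𝒟.σC (v j) := fun j => by rw [h]
    have h2 := Finset.sum_congr (s₁ := Finset.univ) rfl fun j _ => h1 j
    simp only [add_mul, Finset.sum_add_distrib, Finset.sum_mul, Finset.mul_sum] at h2
    simp only [map_sum, map_add, map_mul, DC_mul, DC_σC, mul_add, Finset.sum_add_distrib,
      Finset.mul_sum]
    rw [Finset.sum_comm (f := fun i j => B k i * (A i j * 𝒟.σC (v j))),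
      Finset.sum_comm (f := fun i j => 𝒟.s * (A k i * (𝒟.σC (B i j) * 𝒟.σC (v j))))]
    have e1 : ∀ j i, B k i * (A i j * 𝒟.σC (v j)) = B k i * A i j * 𝒟.σC (v j) := fun j i => by
      ring
    have e2 : ∀ j i, 𝒟.s * (A k i * (𝒟.σC (B i j) * 𝒟.σC (v j))) =
        𝒟.s * (A k i * 𝒟.σC (B i j)) * 𝒟.σC (v j) := fun j i => by ring
    have e3 : ∀ j, A k j * (𝒟.s * 𝒟.σC (𝒟.DC (v j))) = 𝒟.s * (A k j * 𝒟.σC (𝒟.DC (v j))) :=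
      fun j => by ring
    simp only [e1, e2, e3]
    rw [add_right_comm, h2, add_comm]

/-- An isobasis of eigenvectors over a ring with fraction field `L` spans over `L`. -/
lemma span_eigenvectors_eq_top {S : Type v} [CommRing S] [Algebra S L] {τ : S →+* S}
    {N : Type w} [AddCommGroup N] [Module S N] (b : Module.Basis (Fin r) S N) (F : N →ₛₗ[τ] N)
    (hτ : ∀ x, 𝒟.σL (algebraMap S L x) = algebraMap S L (τ x))
    (hA : ∀ i j, algebraMap S L (b.repr (F (b j)) i) = algebraMap C L (A i j))
    {r' : ℕ} (e : Fin r' → N) (c : Fin r' → S) (c' : Fin r' → C) (hc : ∀ j, F (e j) = c j • e j)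
    (hcc : ∀ j, algebraMap S L (c j) = algebraMap C L (c' j)) (hc' : ∀ j, c' j ∈ 𝒟.eig)
    (hspan : ∀ m : N, ∃ n : ℕ, p ^ n • m ∈ Submodule.span S (Set.range e)) :
    Submodule.span L (𝒟.eigenvectors (matFrob 𝒟.σC A) Set.univ) = ⊤ := by
  let w : N →+ L ⊗[C] (Fin r → C) :=
    { toFun := fun z => ∑ i, algebraMap S L (b.repr z i) ⊗ₜ Pi.single i 1
      map_zero' := by simp
      map_add' := fun y z => by
        simp only [map_add, Finsupp.add_apply, TensorProduct.add_tmul, Finset.sum_add_distrib] }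
  have hw : ∀ z, w z = ∑ i, algebraMap S L (b.repr z i) ⊗ₜ Pi.single i 1 := fun _ => rfl
  have hws : ∀ (a : S) z, w (a • z) = algebraMap S L a • w z := fun a z => by
    simp only [hw, map_smul, Finsupp.smul_apply, smul_eq_mul, map_mul, Finset.smul_sum,
      TensorProduct.smul_tmul', smul_eq_mul]
  have hFsingle : ∀ j, matFrob 𝒟.σC A (Pi.single j 1) = ∑ i, A i j • Pi.single i (1 : C) := by
    intro j
    ext k
    change ∑ l, A k l * 𝒟.σC ((Pi.single j 1 : Fin r → C) l) = _
    rw [Finset.sum_apply, Finset.sum_eq_single j, Finset.sum_eq_single k]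
    · simp
    · intro i _ hi
      simp [hi.symm]
    · simp
    · intro i _ hi
      simp [hi]
    · simp
  have hwF : ∀ z, w (F z) = 𝒟.frobL (matFrob 𝒟.σC A) (w z) := by
    intro z
    rw [hw, hw, map_sum]
    simp only [frobL_tmul, hFsingle, TensorProduct.tmul_sum, hτ]
    rw [Finset.sum_comm]
    refine Finset.sum_congr rfl fun i _ => ?_
    rw [repr_semilinear b F z i, map_sum, TensorProduct.sum_tmul]
    refine Finset.sum_congr rfl fun j _ => ?_
    rw [map_mul, hA, TensorProduct.tmul_smul, TensorProduct.smul_tmul', Algebra.smul_def]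
  have hwe : ∀ j, w (e j) ∈ 𝒟.eigenvectors (matFrob 𝒟.σC A) Set.univ := fun j =>
    ⟨c' j, hc' j, trivial, by rw [← hwF, hc, hws, hcc]⟩
  have hwspan : ∀ z ∈ Submodule.span S (Set.range e),
      w z ∈ Submodule.span L (𝒟.eigenvectors (matFrob 𝒟.σC A) Set.univ) := by
    intro z hz
    induction hz using Submodule.span_induction with
    | mem x hx =>
      obtain ⟨j, rfl⟩ := hx
      exact Submodule.subset_span (hwe j)
    | zero => rw [map_zero]; exact zero_mem _
    | add x y _ _ hx hy => rw [map_add]; exact add_mem hx hy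
    | smul a x _ hx => rw [hws]; exact Submodule.smul_mem _ _ hx
  have hbasis : ∀ i, (1 : L) ⊗ₜ[C] (Pi.single i 1 : Fin r → C) ∈
      Submodule.span L (𝒟.eigenvectors (matFrob 𝒟.σC A) Set.univ) := by
    intro i
    -- Only a p-power multiple of the basis vector lies in the span of the isobasis, which suffices
    -- because p is invertible in `L`.
    obtain ⟨n, hn⟩ := hspan (b i)
    have h1 := hwspan _ hn
    have h2 : w (b i) = 1 ⊗ₜ Pi.single i 1 := by
      rw [hw, Finset.sum_eq_single i]
      · simp
      · intro j _ hj
        simp [hj.symm]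
      · simp
    rw [map_nsmul, h2, ← Nat.cast_smul_eq_nsmul L] at h1
    refine (Submodule.smul_mem_iff _ ?_).1 h1
    push_cast
    exact pow_ne_zero _ 𝒟.p_ne
  rw [eq_top_iff]
  intro z _
  induction z with
  | zero => exact zero_mem _
  | add x y hx hy => exact add_mem (hx trivial) (hy trivial)
  | tmul x v =>
    have h1 : x ⊗ₜ[C] v = ∑ i, (x * algebraMap C L (v i)) • ((1 : L) ⊗ₜ[C] Pi.single i (1 : C)) := by
      conv_lhs => rw [pi_eq_sum_univ' v]
      rw [TensorProduct.tmul_sum]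
      refine Finset.sum_congr rfl fun i _ => ?_
      rw [TensorProduct.tmul_smul, TensorProduct.smul_tmul', TensorProduct.smul_tmul',
        Algebra.smul_def, smul_eq_mul, mul_one, mul_comm]
    rw [h1]
    exact sum_mem fun i _ => Submodule.smul_mem _ _ (hbasis i)

end PeriodDatum

end

/-! ### Finite extensions of complete rings -/

/-- An injective integral extension reflects units, so `p` stays a non-unit and completeness passes
to the finite extension. -/
lemma complete_of_finite {p : ℕ} {R : Type u} {S : Type v} [CommRing R] [CommRing S] [IsDomain S]
    [IsNoetherianRing S] [Algebra R S] [Module.Finite R S] [FaithfulSMul R S]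
    [IsAdicComplete (Ideal.span {(p : R)}) R] (hp : ¬ IsUnit (p : R)) (hp0 : (p : R) ≠ 0) :
    IsAdicComplete (Ideal.span {(p : S)}) S ∧ ¬ IsUnit (p : S) ∧ (p : S) ≠ 0 := by
  have hinj := FaithfulSMul.algebraMap_injective R S
  have hloc : IsLocalHom (algebraMap R S) :=
    RingHom.IsIntegral.isLocalHom (algebraMap_isIntegral_iff.2 inferInstance) hinj
  have hu : ¬ IsUnit (p : S) := fun h => by
    rw [← map_natCast (algebraMap R S)] at h
    exact hp (isUnit_of_map_unit _ _ h)
  refine ⟨isAdicComplete_of_finite (R := R) p hu, hu, fun h => hp0 (hinj ?_)⟩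
  rw [map_natCast, h, map_zero]

/-! ### Extension of the coefficient ring -/

section Ext

variable {p : ℕ} {O : Type u} [CommRing O] [IsLocalRing O] {σ₀ : O ≃+* O}
  {O' : Type v} [CommRing O'] [IsLocalRing O'] {σ₀' : O' ≃+* O'} [Algebra O O']

lemma deriv_ext (x : GamCon p O) :
    GamCon.deriv p O' (GamCon.ext p O O' x) = GamCon.ext p O O' (GamCon.deriv p O x) := by
  apply Subtype.ext
  change Gam.deriv p O' (Gam.ext p O O' x) = Gam.ext p O O' (Gam.deriv p O x)
  refine PComp.addHom_ext (f := (Gam.deriv p O').comp (Gam.ext p O O' : Gam p O →+ Gam p O'))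
    (g := (Gam.ext p O O' : Gam p O →+ Gam p O').comp (Gam.deriv p O)) (fun y => ?_) (x : Gam p O)
  change algebraMap _ _ (LaurentSeries.derivative O' (laurentMap (algebraMap O O') y)) =
    algebraMap _ _ (laurentMap (algebraMap O O') (LaurentSeries.derivative O y))
  congr 1
  ext i
  change _ = algebraMap O O' ((LaurentSeries.derivative O y).coeff i)
  rw [LaurentSeries.derivative_apply, LaurentSeries.derivative_apply, LaurentSeries.hasseDeriv_coeff,
    LaurentSeries.hasseDeriv_coeff, map_zsmul]
  rfl

lemma ext_t : GamCon.ext p O O' (GamCon.t p O) = GamCon.t p O' := by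
  apply Subtype.ext
  change Gam.of p O' (laurentMap (algebraMap O O') (HahnSeries.single 1 1)) = Gam.of p O' _
  congr 1
  ext i
  change algebraMap O O' ((HahnSeries.single 1 1 : O⸨X⸩).coeff i) = _
  rw [HahnSeries.coeff_single, HahnSeries.coeff_single]
  split_ifs
  · exact map_one _
  · exact map_zero _

lemma con_ext {σ : FrobLift p σ₀} {σ' : FrobLift p σ₀'} (h : σ'.Extends σ) (x : GamCon p O) :
    σ'.con (GamCon.ext p O O' x) = GamCon.ext p O O' (σ.con x) :=
  Subtype.ext (h (x : Gam p O))

end Ext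

/-! ### Base changes of crystals in coordinates. -/

section BaseChange

variable {R : Type u} {S : Type v} {M : Type w} [CommRing R] [CommRing S] [AddCommGroup M]
  [Module R M] {σ : R →+* R} {r : ℕ}

lemma repr_baseChange (b : Module.Basis (Fin r) R M) (φ : R →+* S) (τ : S →+* S)
    (h : ∀ x, φ (σ x) = τ (φ x)) (F : M →ₛₗ[σ] M) (i j : Fin r) :
    (b.baseChange (Along φ)).repr (baseChange φ τ h F (b.baseChange (Along φ) j)) i =
      Along.mk φ (φ (b.repr (F (b j)) i)) := by
  rw [Module.Basis.baseChange_apply]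
  change (b.baseChange _).repr (Along.mk φ (τ 1) ⊗ₜ F (b j)) i = _
  rw [map_one, map_one, Module.Basis.baseChange_repr_tmul, Algebra.smul_def, mul_one]
  rfl

variable {p : ℕ} {C K L : Type v} [Field C] [Field K] [Field L] [Algebra C K]
  [Algebra K L] [Algebra C L] [IsScalarTower C K L] (𝒟 : PeriodDatum p C K L)
  {A : Fin r → Fin r → C} (b : Module.Basis (Fin r) R M) (φ : R →+* S) (τ : S →+* S)
  (h : ∀ x, φ (σ x) = τ (φ x)) (F : M →ₛₗ[σ] M) {O : Type*} [CommRing O] (σ₀ : O ≃+* O)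
  (κ : O →+* S)

lemma PeriodDatum.span_of_isConstant_baseChange [Algebra S L]
    (hτ : ∀ x, 𝒟.σL (algebraMap S L x) = algebraMap S L (τ x))
    (hA : ∀ i j, algebraMap S L (φ (b.repr (F (b j)) i)) = algebraMap C L (A i j))
    (κ' : O → C) (hκ : ∀ a, algebraMap S L (κ a) = algebraMap C L (κ' a))
    (heig : ∀ a, a ≠ 0 → σ₀ a = a → κ' a ∈ 𝒟.eig)
    (hconst : IsConstant p σ₀ ((Along.mk φ).comp κ) (baseChange φ τ h F)) :
    Submodule.span L (𝒟.eigenvectors (matFrob 𝒟.σC A) Set.univ) = ⊤ := by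
  obtain ⟨r', e, lam, he, -, hm⟩ := hconst
  let : Algebra (Along φ) L := ((algebraMap S L).comp (Along.out φ)).toAlgebra
  have hτ' : ∀ x : Along φ, 𝒟.σL (algebraMap (Along φ) L x) =
      algebraMap (Along φ) L (Along.lift φ τ x) := fun x => hτ (Along.out φ x)
  refine 𝒟.span_eigenvectors_eq_top (S := Along φ) (b.baseChange (Along φ)) (baseChange φ τ h F)
    hτ' (fun i j => ?_) e _ (fun j => κ' (lam j)) (fun j => (he j).2.2) (fun j => ?_)
    (fun j => heig _ (he j).1 (he j).2.1) hm
  · rw [repr_baseChange]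
    exact hA i j
  · exact hκ (lam j)

/-- The coordinates in the base-changed basis embed the module as a lattice in C^r compatibly with
Frobenius, which is what the pull-back of the flag needs. -/
lemma PeriodDatum.HasFlag.isUnipotent_baseChange [IsDomain S] [IsPrincipalIdealRing S]
    [Algebra S C] [Module.Finite R M] (hC : IsInvert p S C)
    (hτ : ∀ x, 𝒟.σC (algebraMap S C x) = algebraMap S C (τ x))
    (hA : ∀ i j, algebraMap S C (φ (b.repr (F (b j)) i)) = A i j)
    (heig : ∀ z ∈ 𝒟.eig, ∃ a : O, a ≠ 0 ∧ σ₀ a = a ∧ z = algebraMap S C (κ a))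
    (hκ : ∀ a : O, a ≠ 0 → ∃ (k : ℕ) (c : S), (p : S) ^ k = κ a * c)
    {DP : (Fin r → C) →+ (Fin r → C)} (hflag : 𝒟.HasFlag (matFrob 𝒟.σC A) DP) :
    IsUnipotent p σ₀ ((Along.mk φ).comp κ) (baseChange φ τ h F) := by
  let : Algebra (Along φ) C := ((algebraMap S C).comp (Along.out φ)).toAlgebra
  have : IsDomain (Along φ) := inferInstanceAs (IsDomain S)
  have : IsPrincipalIdealRing (Along φ) := inferInstanceAs (IsPrincipalIdealRing S)
  have hC' : IsInvert p (Along φ) C := ⟨hC.injective, hC.ne_zero, hC.exists_mul⟩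
  refine hflag.isUnipotent 𝒟 hC' σ₀ _ heig hκ (coordMap (b.baseChange (Along φ)) C)
    (coordMap_smul _ C) ?_ (fun v => ?_) (fun z => ?_)
  · rw [injective_iff_map_eq_zero]
    intro z hz
    apply (b.baseChange (Along φ)).repr.injective
    ext i
    apply hC'.injective
    rw [map_zero, Finsupp.zero_apply, map_zero]
    exact congrFun hz i
  · obtain ⟨m, x, hx⟩ := hC'.exists_mul_family v
    refine ⟨m, (b.baseChange (Along φ)).equivFun.symm x, ?_⟩
    ext i
    change algebraMap _ C ((b.baseChange (Along φ)).equivFun _ i) = _ * v i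
    rw [LinearEquiv.apply_symm_apply, ← hx]
  · ext i
    change algebraMap _ C ((b.baseChange (Along φ)).repr _ i) =
      ∑ j, A i j * 𝒟.σC (algebraMap _ C _)
    rw [repr_semilinear, map_sum]
    refine Finset.sum_congr rfl fun j _ => ?_
    rw [map_mul, repr_baseChange, ← hA]
    congr 1
    exact (hτ _).symm

lemma PeriodDatum.isHorizontal_baseChange {d : R →+ R} {t : R} (ρ : R →+* C)
    (hσ : ∀ x, 𝒟.σC (ρ x) = ρ (σ x)) (hd : ∀ x, 𝒟.DC (ρ x) = ρ (d x)) (ht : 𝒟.s = ρ t)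
    {D : M →+ M} (hD : ∀ (x : R) m, D (x • m) = d x • m + x • D m)
    (hF : ∀ m, D (F m) = t • F (D m)) :
    𝒟.IsHorizontal (matFrob 𝒟.σC fun i j => ρ (b.repr (F (b j)) i))
      (matConn 𝒟.DC fun i j => ρ (b.repr (D (b j)) i)) := by
  apply 𝒟.isHorizontal_matrix
  intro k j
  have h1 := congrArg (fun z => ρ (b.repr z k)) (hF (b j))
  simp only [repr_connection b D hD (F (b j)), map_smul, Finsupp.smul_apply,
    smul_eq_mul, repr_semilinear b F (D (b j)), map_add, map_mul, map_sum] at h1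
  simp only [hσ, hd, ht]
  exact h1

end BaseChange

/-! ### The theorem for a crystal with a chosen basis. -/

section Main

variable {p : ℕ} [hp : Fact p.Prime] {O : Type u} [CommRing O] [IsDomain O]
  [IsDiscreteValuationRing O]
  {σ₀ : O ≃+* O} {O' : Type v} [CommRing O'] [IsDomain O'] [IsDiscreteValuationRing O']
  [IsAdicComplete (Ideal.span {(p : O')}) O'] {σ₀' : O' ≃+* O'} [Algebra O O']
  {M : Type w} [AddCommGroup M] [Module (GamCon p O) M]

/-- The theorem, with the fraction fields of `Γ_con`, `Γ` and `Γ^perf` given. -/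
lemma FNablaCrystal.isUnipotent_of_isConstant_aux {σ : FrobLift p σ₀} (X : FNablaCrystal σ M)
    (hσ₀' : LiftsFrobenius p σ₀') {π' : O'} (hπ' : CoeffUnif p π') {r : ℕ}
    (b : Module.Basis (Fin r) (GamCon p O) M)
    (σ' : FrobLift p σ₀') (hext : σ'.Extends σ)
    [IsDomain (GamCon p O')] [IsDomain (Gam p O')] [IsDomain (GamPerf σ')]
    [IsPrincipalIdealRing (GamCon p O')]
    (C K L : Type v) [Field C] [Field K] [Field L] [Algebra C K] [Algebra K L] [Algebra C L]
    [IsScalarTower C K L]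
    [Algebra (GamCon p O') C] [IsFractionRing (GamCon p O') C]
    [Algebra (Gam p O') K] [IsFractionRing (Gam p O') K]
    [Algebra (GamPerf σ') L] [IsFractionRing (GamPerf σ') L]
    (hCK : ∀ x : GamCon p O', algebraMap C K (algebraMap _ C x) = algebraMap _ K (x : Gam p O'))
    (hKL : ∀ x : Gam p O', algebraMap K L (algebraMap _ K x) = algebraMap _ L (GamPerf.of σ' x))
    (hconst : IsConstant p σ₀' ((Along.mk (GamCon.toPerf O σ')).comp (GamPerf.C σ'))
      (X.frobPerf σ' hext)) :
    IsUnipotent p σ₀' ((Along.mk (GamCon.ext p O O')).comp (GamCon.C p O'))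
      (X.frobExt σ' hext) := by
  have hC : IsInvert p (GamCon p O') C := hπ'.isInvert_gamCon C
  obtain ⟨𝒟, hσC, hσL, hDC, hs, heig⟩ := σ'.exists_periodDatum hσ₀' hπ' hCK hKL
  have hCL : ∀ x : GamCon p O', algebraMap C L (algebraMap _ C x) =
      algebraMap _ L (GamPerf.of σ' x) := fun x => by
    rw [IsScalarTower.algebraMap_apply C K L, hCK, hKL]
  obtain ⟨ρ, hρ⟩ : ∃ ρ : GamCon p O →+* C,
      ∀ x, algebraMap (GamCon p O') C (GamCon.ext p O O' x) = ρ x :=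
    ⟨(algebraMap (GamCon p O') C).comp (GamCon.ext p O O'), fun _ => rfl⟩
  have hρσ : ∀ x, 𝒟.σC (ρ x) = ρ (σ.con x) := fun x => by rw [← hρ, hσC, con_ext hext, hρ]
  have hρD : ∀ x, 𝒟.DC (ρ x) = ρ (GamCon.deriv p O x) := fun x => by
    rw [← hρ, hDC, deriv_ext, hρ]
  have hρs : 𝒟.s = ρ (GamCon.deriv p O (σ.con (GamCon.t p O))) := by
    rw [hs, ← hρ, ← deriv_ext, ← con_ext hext, ext_t]
  have hCκ : ∀ a, algebraMap (GamPerf σ') L (GamPerf.C σ' a) =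
      algebraMap C L (algebraMap (GamCon p O') C (GamCon.C p O' a)) := fun a => by
    rw [hCL]
    rfl
  have hhor := 𝒟.isHorizontal_baseChange (R := GamCon p O) (M := M) (d := GamCon.deriv p O)
    (t := GamCon.deriv p O (σ.con (GamCon.t p O))) (D := X.D) b X.F ρ hρσ hρD hρs X.leibniz
    X.horizontal
  have hspan := 𝒟.span_of_isConstant_baseChange b (GamCon.toPerf O σ') (GamPerf.frob σ') _ X.F σ₀'
    (GamPerf.C σ') hσL (A := fun i j => ρ (b.repr (X.F (b j)) i))
    (fun i j => by rw [← hρ]; exact (hCL _).symm)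
    (fun a => algebraMap _ C (GamCon.C p O' a)) (fun a => hCκ a)
    (fun a h1 h2 => by rw [heig]; exact ⟨a, h1, h2, rfl⟩) hconst
  have : Module.Finite (GamCon p O) M := X.isFCrystal.finite
  refine (𝒟.hasFlag_of_span_eigenvectors _ (Fin r → C) rfl _ _ hhor hspan).isUnipotent_baseChange
    𝒟 b (GamCon.ext p O O') σ'.con _ X.F σ₀' (GamCon.C p O') hC hσC (fun i j => hρ _)
    (fun z hz => by rwa [heig] at hz) (fun a ha => ?_)
  -- A nonzero `a` is associated to a power `π' ^ n`, hence divides `p ^ n`.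
  obtain ⟨n, hn⟩ := IsDiscreteValuationRing.associated_pow_irreducible ha hπ'.irred
  obtain ⟨c, hc⟩ := hn.dvd.trans (pow_dvd_pow_of_dvd hπ'.dvd_p n)
  refine ⟨n, GamCon.C p O' c, ?_⟩
  rw [← map_mul, ← hc, map_pow, map_natCast]

/-- An `(F, ∇)`-crystal which becomes constant over `Γ^perf` is unipotent. -/
theorem FNablaCrystal.isUnipotent_of_isConstant {σ : FrobLift p σ₀} (X : FNablaCrystal σ M)
    (hσ₀' : LiftsFrobenius p σ₀') {π' : O'} (hπ' : CoeffUnif p π') {r : ℕ}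
    (b : Module.Basis (Fin r) (GamCon p O) M)
    (σ' : FrobLift p σ₀') (hext : σ'.Extends σ)
    (hconst : IsConstant p σ₀' ((Along.mk (GamCon.toPerf O σ')).comp (GamPerf.C σ'))
      (X.frobPerf σ' hext)) :
    IsUnipotent p σ₀' ((Along.mk (GamCon.ext p O O')).comp (GamCon.C p O'))
      (X.frobExt σ' hext) := by
  have := hπ'.isUnif_gamCon.isDomain
  have := hπ'.isUnif_gam.isDomain
  have := (σ'.isUnif_perf hσ₀' hπ').isDomain
  have := hπ'.isUnif_gamCon.isDiscreteValuationRing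
  have hC := hπ'.isInvert_gamCon (FractionRing (GamCon p O'))
  have hK := hπ'.isInvert_gam (FractionRing (Gam p O'))
  have hL := σ'.isInvert_perf hσ₀' hπ' (FractionRing (GamPerf σ'))
  obtain ⟨f, hf⟩ := hC.exists_ringHom hK.ne_zero (GamCon p O').subtype
  obtain ⟨g, hg⟩ := hK.exists_ringHom hL.ne_zero (GamPerf.of σ')
  let : Algebra (FractionRing (GamCon p O')) (FractionRing (Gam p O')) := f.toAlgebra
  let : Algebra (FractionRing (Gam p O')) (FractionRing (GamPerf σ')) := g.toAlgebra
  let : Algebra (FractionRing (GamCon p O')) (FractionRing (GamPerf σ')) := (g.comp f).toAlgebra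
  have : IsScalarTower (FractionRing (GamCon p O')) (FractionRing (Gam p O'))
      (FractionRing (GamPerf σ')) := IsScalarTower.of_algebraMap_eq fun _ => rfl
  exact X.isUnipotent_of_isConstant_aux hσ₀' hπ' b σ' hext _ _ _ hf hg hconst

end Main

end OCrys

end

theorem mainTheorem4 (p : ℕ) [Fact p.Prime]
    (k : Type*) [Field k] [IsAlgClosed k] [CharP k p]
    (O : Type*) [CommRing O] [IsDomain O] [IsDiscreteValuationRing O]
    [Algebra (WittVector p k) O] [Module.Finite (WittVector p k) O]
    [FaithfulSMul (WittVector p k) O]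
    (σ₀ : O ≃+* O) (_hσ₀ : OCrys.LiftsFrobenius p σ₀) (σ : OCrys.FrobLift p σ₀)
    (M : Type*) [AddCommGroup M] [Module (OCrys.GamCon p O) M]
    (X : OCrys.FNablaCrystal σ M)
    (O' : Type*) [CommRing O'] [IsDomain O'] [IsDiscreteValuationRing O']
    [Algebra O O'] [Module.Finite O O'] [FaithfulSMul O O']
    (σ₀' : O' ≃+* O') (_hσ₀' : OCrys.LiftsFrobenius p σ₀')
    (_hext₀ : ∀ a : O, σ₀' (algebraMap O O' a) = algebraMap O O' (σ₀ a))
    (σ' : OCrys.FrobLift p σ₀') (hext : σ'.Extends σ)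
    (_hconst : OCrys.IsConstant p σ₀'
      ((OCrys.Along.mk (OCrys.GamCon.toPerf O σ')).comp (OCrys.GamPerf.C σ'))
      (X.frobPerf σ' hext)) :
    OCrys.IsUnipotent p σ₀'
      ((OCrys.Along.mk (OCrys.GamCon.ext p O O')).comp (OCrys.GamCon.C p O'))
      (X.frobExt σ' hext) := by
  obtain ⟨hcomp, hu, h0⟩ := OCrys.complete_of_finite (p := p) (R := WittVector p k) (S := O)
    (WittVector.irreducible p).not_isUnit (WittVector.p_nonzero p k)
  obtain ⟨hcomp', hu', h0'⟩ := OCrys.complete_of_finite (p := p) (R := O) (S := O') hu h0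
  obtain ⟨π, hπ⟩ := OCrys.exists_coeffUnif h0 hu
  obtain ⟨π', hπ'⟩ := OCrys.exists_coeffUnif h0' hu'
  have := hπ.isUnif_gamCon.isDomain
  have := hπ.isUnif_gamCon.isDiscreteValuationRing
  have := X.isFCrystal.finite
  have := X.isFCrystal.projective
  -- Since Γ_con is local, the locally free module `M` has a global basis, which supplies the
  -- coordinates.
  have : Module.Free (OCrys.GamCon p O) M := Module.free_of_flat_of_isLocalRing
  exact X.isUnipotent_of_isConstant _hσ₀' hπ' (Module.finBasis (OCrys.GamCon p O) M) σ' hext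
    _hconst
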